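/- Let $G$ be a countable inverse semigroup with set of idempotents $E$; write $g\le h$ iff $g=eh$ for some $e\in E$. A $G$-algebra is a $\mathbb Z/2$-graded $C^*$-algebra $A$ with a semigroup homomorphism $\alpha\colon G\to \mathrm{End}(A)$ into the $*$-endomorphisms of $A$ that respect the grading, such that $\alpha_{gg^{-1}}(x)y=x\,\alpha_{gg^{-1}}(y)$ for all $g\in G$, $x,y\in A$, and such that an identity of $G$, if there is one, acts as the identity and a zero element of $G$, if there is one, acts as $0$ (the element of a one-element semigroup counts as an identity only). Let $X$ be the space of nonzero multiplicative maps $E\to\{0,1\}$ (which vanish at the zero element of $G$, if there is one) with the topology of pointwise convergence, and let $1_e\in C_0(X)$, $e\in E$, be the function $\chi\mapsto\chi(e)$; $C_0(X)$ is a $G$-algebra under $g(1_e)=1_{geg^{-1}}$. Assume that $G$ is $E$-continuous: for every $g\in G$ the pointwise supremum $\bigvee\{1_e: e\in E,\ e\le g\}$ lies in $C_0(X)$. Let $L^2(G)$ be the $G$-Hilbert $C_0(X)$-module that is the completion of the linear span of vectors $\varphi_g$, $g\in G$, with $$\langle\varphi_g,\varphi_h\rangle=\bigvee\{1_e: e\in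 E,\ eg=eh,\ e\le gg^{-1}hh^{-1}\},\qquad \varphi_g\,1_e=\varphi_{eg},\qquad g(\varphi_h)=\varphi_{gh}.$$ Let $C_0(X)^\infty$ be the direct sum of countably infinitely many copies of $C_0(X)$ with the diagonal action. For a $G$-Hilbert module $\mathcal E$ with action $U$, the compact operators $\mathcal K(\mathcal E)$ carry the action $g(T)=U_gTU_{g^{-1}}$. For $G$-algebras $A,B$ let $A\otimes^X B$ be the quotient of the maximal tensor product $A\otimes_{\max}B$ by the relations $e(a)\otimes b=a\otimes e(b)$ ($e\in E$, $a\in A$, $b\in B$), with the diagonal $G$-action. Put $\mathcal K_G=\mathcal K(C_0(X)^\infty)\otimes^X\mathcal K(L^2(G))$. An element $m$ of the multiplier algebra $\mathcal M(B)$ of a $G$-algebra $(B,\beta)$ is called $G$-invariant if, as an operator on $B$, it commutes with $\beta_g$ for all $g\in G$. Let $(A,\alpha)$ be a $G$-algebra that has a strictly positive element (some $h\ge 0$ in $A$ with $hA$ dense in $A$). Let $p\in\mathcal M(A)$ be a $G$-invariant projection that is full (the linear span of $ApA$ is dense in $A$). Then $p\otimes1_{\mathcal M(\mathcal K_G)}$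 and $1_{\mathcal M(A)}\otimes1_{\mathcal M(\mathcal K_G)}$ are Murray–von Neumann equivalent in $\mathcal M(A\otimes^X\mathcal K_G)$ by a $G$-invariant partial isometry: there is a $G$-invariant partial isometry $v\in\mathcal M(A\otimes^X\mathcal K_G)$ with $v^*v=p\otimes 1$ and $vv^*=1\otimes 1$. -/

import Mathlib

set_option linter.unusedSectionVars false

/-! ### Completing an algebra that carries a C⋆-seminorm -/

/-- A complex `⋆`-algebra with a C⋆-seminorm (submultiplicative, `‖x⋆ x‖ = ‖x‖²`). -/
class PreCStarAlgebra (R : Type*) extends NonUnitalSeminormedRing R, StarRing R,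
    NormedSpace ℂ R, IsScalarTower ℂ R R, SMulCommClass ℂ R R, StarModule ℂ R where
  norm_star_mul_self_eq : ∀ x : R, ‖star x * x‖ = ‖x‖ * ‖x‖

namespace PreCStarAlgebra

open UniformSpace UniformSpace.Completion Function

variable {R : Type*} [PreCStarAlgebra R]

theorem norm_star_eq (x : R) : ‖star x‖ = ‖x‖ := by
  have key : ∀ y : R, ‖y‖ ≤ ‖star y‖ := by
    intro y
    have h1 := norm_star_mul_self_eq y
    have h2 := norm_mul_le (star y) y
    rcases (norm_nonneg y).eq_or_lt with h | h
    · rw [← h]; exact norm_nonneg _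
    · rw [h1] at h2
      exact le_of_mul_le_mul_right h2 h
  refine le_antisymm ?_ (key x)
  simpa using key (star x)

noncomputable instance instMulCompletion : Mul (Completion R) :=
  ⟨curry <| (isDenseInducing_coe.prodMap isDenseInducing_coe).extend
    ((↑) ∘ uncurry (fun x y : R => x * y))⟩

@[norm_cast]
theorem coe_mul (a b : R) : ((a * b : R) : Completion R) = a * b :=
  ((isDenseInducing_coe.prodMap isDenseInducing_coe).extend_eq
      ((continuous_coe R).comp (continuous_mul (M := R))) (a, b)).symm

instance : ContinuousMul (Completion R) where
  continuous_mul := by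
    let m := (AddMonoidHom.mul : R →+ R →+ R).compr₂ toCompl
    have : Continuous fun p : R × R => m p.1 p.2 := (continuous_coe R).comp continuous_mul
    have di : IsDenseInducing (toCompl : R → Completion R) := isDenseInducing_coe
    exact (di.extend_Z_bilin di this :)

/-- The involution of `R` as an additive, norm preserving map. -/
noncomputable def starHom : NormedAddGroupHom R R where
  toFun := star
  map_add' := star_add
  bound' := ⟨1, fun x => by rw [norm_star_eq, one_mul]⟩

noncomputable instance : Star (Completion R) := ⟨Completion.map star⟩

theorem uniformContinuous_star : UniformContinuous (star : R → R) :=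
  (starHom (R := R)).uniformContinuous

@[norm_cast]
theorem coe_star (a : R) : ((star a : R) : Completion R) = star (a : Completion R) :=
  (map_coe uniformContinuous_star a).symm

theorem continuous_star' : Continuous (star : Completion R → Completion R) :=
  continuous_map

noncomputable instance : NonUnitalRing (Completion R) where
  toAddCommGroup := inferInstance
  toMul := inferInstance
  zero_mul a := Completion.induction_on a (isClosed_eq (by fun_prop) continuous_const)
    fun a => by rw [← coe_zero, ← coe_mul, zero_mul]
  mul_zero a := Completion.induction_on a (isClosed_eq (by fun_prop) continuous_const)
    fun a => by rw [← coe_zero, ← coe_mul, mul_zero]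
  mul_assoc a b c := Completion.induction_on₃ a b c (isClosed_eq (by fun_prop) (by fun_prop))
    fun a b c => by rw [← coe_mul, ← coe_mul, ← coe_mul, ← coe_mul, mul_assoc]
  left_distrib a b c := Completion.induction_on₃ a b c (isClosed_eq (by fun_prop) (by fun_prop))
    fun a b c => by rw [← coe_add, ← coe_mul, ← coe_mul, ← coe_mul, ← coe_add, mul_add]
  right_distrib a b c := Completion.induction_on₃ a b c (isClosed_eq (by fun_prop) (by fun_prop))
    fun a b c => by rw [← coe_add, ← coe_mul, ← coe_mul, ← coe_mul, ← coe_add, add_mul]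

noncomputable instance : NonUnitalNormedRing (Completion R) where
  __ := (inferInstance : NormedAddCommGroup (Completion R))
  __ := (inferInstance : NonUnitalRing (Completion R))
  norm_mul_le a b := Completion.induction_on₂ a b
    (isClosed_le (by fun_prop) (by fun_prop))
    fun a b => by rw [← coe_mul, norm_coe, norm_coe, norm_coe]; exact norm_mul_le a b

noncomputable instance : StarRing (Completion R) where
  star_involutive a := Completion.induction_on a
    (isClosed_eq (continuous_star'.comp continuous_star') continuous_id)
    fun a => by rw [← coe_star, ← coe_star, star_star]
  star_mul a b := Completion.induction_on₂ a b
    (isClosed_eq (continuous_star'.comp (by fun_prop))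
      ((continuous_star'.comp continuous_snd).mul (continuous_star'.comp continuous_fst)))
    fun a b => by rw [← coe_mul, ← coe_star, ← coe_star, ← coe_star, ← coe_mul, star_mul]
  star_add a b := Completion.induction_on₂ a b
    (isClosed_eq (continuous_star'.comp (by fun_prop))
      ((continuous_star'.comp continuous_fst).add (continuous_star'.comp continuous_snd)))
    fun a b => by rw [← coe_add, ← coe_star, ← coe_star, ← coe_star, ← coe_add, star_add]

instance : CStarRing (Completion R) where
  norm_mul_self_le a := Completion.induction_on a
    (isClosed_le (by fun_prop) (continuous_norm.comp (continuous_star'.mul continuous_id)))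
    fun a => by
      rw [← coe_star, ← coe_mul, norm_coe, norm_coe, norm_star_mul_self_eq]

theorem continuous_smul' (c : ℂ) : Continuous (fun x : Completion R => c • x) :=
  uniformContinuous_const_smul c |>.continuous

theorem smul_mul_completion (c : ℂ) (a b : Completion R) : (c • a) * b = c • (a * b) :=
  Completion.induction_on₂ a b
    (isClosed_eq (((continuous_smul' c).comp continuous_fst).mul continuous_snd)
      ((continuous_smul' c).comp continuous_mul)) fun a b => by
      rw [← Completion.coe_smul, ← coe_mul, ← coe_mul, ← Completion.coe_smul, smul_mul_assoc]

theorem mul_smul_completion (c : ℂ) (a b : Completion R) : a * (c • b) = c • (a * b) :=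
  Completion.induction_on₂ a b
    (isClosed_eq (continuous_fst.mul ((continuous_smul' c).comp continuous_snd))
      ((continuous_smul' c).comp continuous_mul)) fun a b => by
      rw [← Completion.coe_smul, ← coe_mul, ← coe_mul, ← Completion.coe_smul, mul_smul_comm]

theorem star_smul_completion (c : ℂ) (a : Completion R) : star (c • a) = star c • star a :=
  Completion.induction_on a
    (isClosed_eq (continuous_star'.comp (continuous_smul' c))
      ((continuous_smul' (star c)).comp continuous_star'))
    fun a => by
      rw [← Completion.coe_smul, ← coe_star, ← coe_star, ← Completion.coe_smul, star_smul]

instance : IsScalarTower ℂ (Completion R) (Completion R) := ⟨smul_mul_completion⟩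

instance : SMulCommClass ℂ (Completion R) (Completion R) :=
  ⟨fun c a b => (mul_smul_completion c a b).symm⟩

instance : StarModule ℂ (Completion R) := ⟨star_smul_completion⟩

/-- The separated completion of an algebra with a C⋆-seminorm is a C⋆-algebra. -/
noncomputable instance : NonUnitalCStarAlgebra (Completion R) where

variable {S : Type*} [PreCStarAlgebra S]

/-- A contractive `⋆`-homomorphism extends to the completions. -/
noncomputable def completionMap (f : R →⋆ₙₐ[ℂ] S) (hf : ∀ x, ‖f x‖ ≤ ‖x‖) :
    Completion R →⋆ₙₐ[ℂ] Completion S :=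
  let F : R →L[ℂ] S := LinearMap.mkContinuous
    { toFun := f, map_add' := map_add f, map_smul' := map_smul f } 1
    (fun x => by rw [one_mul]; exact hf x)
  { toFun := F.completion
    map_smul' := fun c x => map_smul F.completion c x
    map_zero' := map_zero _
    map_add' := map_add _
    map_mul' := fun a b => Completion.induction_on₂ a b
      (isClosed_eq (by fun_prop) (by fun_prop)) fun a b => by
        rw [← coe_mul, F.completion_apply_coe, F.completion_apply_coe, F.completion_apply_coe,
          ← coe_mul]
        exact congrArg _ (map_mul f a b)
    map_star' := fun a => Completion.induction_on a
      (isClosed_eq (F.completion.continuous.comp continuous_star')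
        (continuous_star'.comp F.completion.continuous)) fun a => by
        rw [← coe_star, F.completion_apply_coe, F.completion_apply_coe, ← coe_star]
        exact congrArg _ (map_star f a) }

theorem completionMap_coe (f : R →⋆ₙₐ[ℂ] S) (hf : ∀ x, ‖f x‖ ≤ ‖x‖) (x : R) :
    completionMap f hf (x : Completion R) = (f x : Completion S) :=
  ContinuousLinearMap.completion_apply_coe _ x

theorem continuous_completionMap (f : R →⋆ₙₐ[ℂ] S) (hf : ∀ x, ‖f x‖ ≤ ‖x‖) :
    Continuous (completionMap f hf) :=
  ContinuousLinearMap.continuous _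

end PreCStarAlgebra

/-! ### Adjointable and compact operators on a Hilbert C⋆-module -/

namespace HilbertModule

open CStarModule

section
variable {B E : Type*} [NonUnitalCStarAlgebra B] [PartialOrder B] [StarOrderedRing B]
  [NormedAddCommGroup E] [NormedSpace ℂ E] [SMul B E] [CStarModule B E]

variable (B) in
theorem ext_inner {x y : E} (h : ∀ z : E, inner B z x = inner B z y) : x = y := by
  rw [← sub_eq_zero, ← CStarModule.inner_self (A := B), CStarModule.inner_sub_right, h, sub_self]

theorem smul_add_module (b : B) (x y : E) : b • (x + y) = b • x + b • y :=
  ext_inner B fun z => by simp [mul_add]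

theorem add_smul_module (b c : B) (x : E) : (b + c) • x = b • x + c • x :=
  ext_inner B fun z => by simp [add_mul]

theorem smul_smul_complex (z : ℂ) (b : B) (x : E) : (z • b) • x = z • (b • x) :=
  ext_inner B fun w => by simp [smul_mul_assoc]

theorem mul_smul_module (b c : B) (x : E) : (b * c) • x = b • (c • x) :=
  ext_inner B fun z => by simp [mul_assoc]

theorem norm_smul_module_le (b : B) (x : E) : ‖b • x‖ ≤ ‖b‖ * ‖x‖ := by
  have h1 : ‖b • x‖ ^ 2 ≤ (‖b‖ * ‖x‖) ^ 2 := by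
    rw [norm_sq_eq B]
    simp only [inner_op_smul_right, inner_op_smul_left]
    calc ‖b * (inner B x x * star b)‖ ≤ ‖b‖ * (‖inner B x x‖ * ‖star b‖) :=
          (norm_mul_le _ _).trans (by gcongr; exact norm_mul_le _ _)
      _ = (‖b‖ * ‖x‖) ^ 2 := by rw [norm_star, ← norm_sq_eq B]; ring
  exact (pow_le_pow_iff_left₀ (norm_nonneg _) (by positivity) two_ne_zero).1 h1

/-- The elementary operator `θ_{x,y} z = x ⟨y, z⟩`. -/
noncomputable def rankOne (x y : E) : E →L[ℂ] E :=
  LinearMap.mkContinuous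
    { toFun := fun z => inner B y z • x
      map_add' := fun z w => by rw [CStarModule.inner_add_right, add_smul_module]
      map_smul' := fun c z => by
        rw [inner_smul_right_complex, smul_smul_complex, RingHom.id_apply] }
    (‖y‖ * ‖x‖) fun z => by
      refine (norm_smul_module_le _ _).trans ?_
      have := norm_inner_le (A := B) E (x := y) (y := z)
      calc ‖inner B y z‖ * ‖x‖ ≤ (‖y‖ * ‖z‖) * ‖x‖ := by gcongr
        _ = ‖y‖ * ‖x‖ * ‖z‖ := by ring

theorem rankOne_apply (x y z : E) : rankOne (B := B) x y z = inner B y z • x := rfl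

end

section
variable (B E : Type*) [NonUnitalCStarAlgebra B] [PartialOrder B] [StarOrderedRing B]
  [NormedAddCommGroup E] [NormedSpace ℂ E] [SMul B E] [CStarModule B E]

/-- The algebra `𝓛(E)` of adjointable operators. -/
def adjointable : Subalgebra ℂ (E →L[ℂ] E) where
  carrier := {T | ∃ S : E →L[ℂ] E, ∀ x y, inner B (T x) y = inner B x (S y)}
  mul_mem' := by
    rintro T T' ⟨S, hS⟩ ⟨S', hS'⟩
    exact ⟨S' * S, fun x y => by
      rw [_root_.mul_apply_eq_comp, _root_.mul_apply_eq_comp, hS, hS']⟩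
  add_mem' := by
    rintro T T' ⟨S, hS⟩ ⟨S', hS'⟩
    exact ⟨S + S', fun x y => by
      rw [_root_.add_apply, _root_.add_apply, CStarModule.inner_add_left,
        CStarModule.inner_add_right, hS, hS']⟩
  algebraMap_mem' := fun c => ⟨algebraMap ℂ _ (star c), fun x y => by
    simp [Algebra.algebraMap_eq_smul_one]⟩

variable {B E}

/-- The adjoint of an adjointable operator. -/
noncomputable def adj (T : adjointable B E) : E →L[ℂ] E := T.2.choose

theorem inner_adj (T : adjointable B E) (x y : E) :
    inner B ((T : E →L[ℂ] E) x) y = inner B x (adj T y) := T.2.choose_spec x y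

theorem adj_inner (T : adjointable B E) (x y : E) :
    inner B (adj T x) y = inner B x ((T : E →L[ℂ] E) y) := by
  rw [← star_inner (A := B) y, ← inner_adj, star_inner]

theorem adj_unique (T : adjointable B E) (S : E →L[ℂ] E)
    (h : ∀ x y, inner B ((T : E →L[ℂ] E) x) y = inner B x (S y)) : adj T = S := by
  ext y
  exact ext_inner B fun z => by rw [← inner_adj, h]

noncomputable instance : Star (adjointable B E) :=
  ⟨fun T => ⟨adj T, T, fun x y => adj_inner T x y⟩⟩

theorem coe_star (T : adjointable B E) : ((star T : adjointable B E) : E →L[ℂ] E) = adj T := rfl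

theorem inner_star (T : adjointable B E) (x y : E) :
    inner B ((T : E →L[ℂ] E) x) y = inner B x (((star T : adjointable B E) : E →L[ℂ] E) y) :=
  inner_adj T x y

theorem star_eq_of (T S : adjointable B E)
    (h : ∀ x y, inner B ((T : E →L[ℂ] E) x) y = inner B x ((S : E →L[ℂ] E) y)) : star T = S :=
  Subtype.ext (adj_unique T S h)

noncomputable instance : StarRing (adjointable B E) where
  star_involutive T := star_eq_of _ _ fun x y => adj_inner T x y
  star_mul S T := star_eq_of _ _ fun x y => by
    simp only [MulMemClass.coe_mul, _root_.mul_apply_eq_comp]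
    rw [inner_star, inner_star]
  star_add S T := star_eq_of _ _ fun x y => by
    simp only [AddMemClass.coe_add, _root_.add_apply, CStarModule.inner_add_left,
      CStarModule.inner_add_right]
    rw [inner_star, inner_star]

instance : StarModule ℂ (adjointable B E) where
  star_smul c T := star_eq_of _ _ fun x y => by
    change inner B (c • (T : E →L[ℂ] E) x) y = inner B x (star c • adj T y)
    rw [inner_smul_left_complex, inner_smul_right_complex, inner_adj]

instance : CStarRing (adjointable B E) where
  norm_mul_self_le T := by
    have h : ‖(T : E →L[ℂ] E)‖ ≤ Real.sqrt ‖star T * T‖ := by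
      refine ContinuousLinearMap.opNorm_le_bound _ (Real.sqrt_nonneg _) fun x => ?_
      have h1 : ‖(T : E →L[ℂ] E) x‖ ^ 2 ≤ ‖star T * T‖ * ‖x‖ ^ 2 := by
        rw [norm_sq_eq B, inner_star]
        calc _ ≤ ‖x‖ * ‖((star T * T : adjointable B E) : E →L[ℂ] E) x‖ := norm_inner_le E
          _ ≤ ‖x‖ * (‖star T * T‖ * ‖x‖) := by
              gcongr
              exact ContinuousLinearMap.le_opNorm _ _
          _ = _ := by ring
      refine (pow_le_pow_iff_left₀ (norm_nonneg _) (by positivity) two_ne_zero).1 ?_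
      have h0 : 0 ≤ ‖star T * T‖ := norm_nonneg _
      rw [mul_pow, Real.sq_sqrt h0]
      exact h1
    calc ‖T‖ * ‖T‖ ≤ Real.sqrt ‖star T * T‖ * Real.sqrt ‖star T * T‖ := by
          gcongr <;> exact h
      _ = ‖star T * T‖ := by
          have h0 : 0 ≤ ‖star T * T‖ := norm_nonneg _
          exact Real.mul_self_sqrt h0

theorem isClosed_adjointable [CompleteSpace E] :
    IsClosed (adjointable B E : Set (E →L[ℂ] E)) := by
  rw [← isSeqClosed_iff_isClosed]
  intro T T₀ hT hlim
  let T' : ℕ → adjointable B E := fun n => ⟨T n, hT n⟩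
  have hc : CauchySeq fun n => adj (T' n) := by
    rw [Metric.cauchySeq_iff']
    intro ε hε
    obtain ⟨N, hN⟩ := Metric.cauchySeq_iff'.1 hlim.cauchySeq ε hε
    refine ⟨N, fun n hn => ?_⟩
    have := hN n hn
    rw [dist_eq_norm] at this ⊢
    have h2 : ‖star (T' n - T' N)‖ = ‖T' n - T' N‖ :=
      norm_star (E := adjointable B E) (T' n - T' N)
    rw [star_sub] at h2
    exact lt_of_eq_of_lt h2 this
  obtain ⟨S, hS⟩ := cauchySeq_tendsto_of_complete hc
  refine ⟨S, fun x y => ?_⟩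
  have h1 : Filter.Tendsto (fun n => inner B (T n x) y) Filter.atTop (nhds (inner B (T₀ x) y)) := by
    have := ((ContinuousLinearMap.apply ℂ E x).continuous.tendsto T₀).comp hlim
    exact ((continuous_inner (A := B)).tendsto (T₀ x, y)).comp (this.prodMk_nhds tendsto_const_nhds)
  have h2 : Filter.Tendsto (fun n => inner B x (adj (T' n) y)) Filter.atTop
      (nhds (inner B x (S y))) := by
    have := ((ContinuousLinearMap.apply ℂ E y).continuous.tendsto S).comp hS
    exact ((continuous_inner (A := B)).tendsto (x, S y)).comp (tendsto_const_nhds.prodMk_nhds this)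
  refine tendsto_nhds_unique h1 (h2.congr fun n => ?_)
  rw [← inner_adj]

instance [CompleteSpace E] : CompleteSpace (adjointable B E) :=
  (isClosed_adjointable (B := B) (E := E)).completeSpace_coe

noncomputable instance [CompleteSpace E] : CStarAlgebra (adjointable B E) where

/-- `θ_{x,y}` as an adjointable operator. -/
noncomputable def theta (x y : E) : adjointable B E :=
  ⟨rankOne (B := B) x y, rankOne (B := B) y x, fun z w => by
    simp [rankOne_apply]⟩

variable (B E) in
/-- The C⋆-algebra `𝓚(E)` of compact operators: the closed `⋆`-subalgebra of `𝓛(E)`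
generated by the `θ_{x,y}`. -/
noncomputable def compacts [CompleteSpace E] : NonUnitalStarSubalgebra ℂ (adjointable B E) :=
  (NonUnitalStarAlgebra.adjoin ℂ
    {T : adjointable B E | ∃ x y : E, T = theta x y}).topologicalClosure

instance [CompleteSpace E] : IsClosed (compacts B E : Set (adjointable B E)) :=
  NonUnitalStarSubalgebra.isClosed_topologicalClosure _

theorem theta_mem [CompleteSpace E] (x y : E) : (theta x y : adjointable B E) ∈ compacts B E :=
  NonUnitalStarSubalgebra.le_topologicalClosure _
    (NonUnitalStarAlgebra.subset_adjoin ℂ _ ⟨x, y, rfl⟩)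

variable (B E) in
/-- `𝓚(E)` as a type. -/
def Compacts [CompleteSpace E] : Type _ := compacts B E

noncomputable instance [CompleteSpace E] : NonUnitalCStarAlgebra (Compacts B E) :=
  NonUnitalStarSubalgebra.nonUnitalCStarAlgebra (compacts B E)

/-- The inclusion `𝓚(E) → 𝓛(E)`. -/
noncomputable def Compacts.val [CompleteSpace E] (T : Compacts B E) : adjointable B E := T.1

theorem Compacts.ext [CompleteSpace E] {S T : Compacts B E} (h : S.val = T.val) : S = T :=
  Subtype.ext h

end

end HilbertModule

/-! ### Inverse semigroups -/

/-- An inverse semigroup: every `a` has a generalized inverse `a⁻¹`, and idempotents commute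
(equivalently, the generalized inverse is unique, see `InverseSemigroup.inv_unique`). -/
class InverseSemigroup (G : Type*) extends Semigroup G, Inv G where
  mul_inv_mul : ∀ a : G, a * a⁻¹ * a = a
  inv_mul_inv : ∀ a : G, a⁻¹ * a * a⁻¹ = a⁻¹
  idem_comm : ∀ e f : G, e * e = e → f * f = f → e * f = f * e

namespace InverseSemigroup

variable {G : Type*} [InverseSemigroup G]

theorem mul_inv_idem (a : G) : a * a⁻¹ * (a * a⁻¹) = a * a⁻¹ := by
  rw [← mul_assoc, mul_inv_mul]

theorem inv_mul_idem (a : G) : a⁻¹ * a * (a⁻¹ * a) = a⁻¹ * a := by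
  rw [← mul_assoc, inv_mul_inv]

theorem inv_unique {a b : G} (h1 : a * b * a = a) (h2 : b * a * b = b) : b = a⁻¹ := by
  have hba : b * a * (b * a) = b * a := by rw [← mul_assoc, h2]
  have hab : a * b * (a * b) = a * b := by rw [← mul_assoc, h1]
  calc b = b * a * b := h2.symm
    _ = b * (a * a⁻¹ * a) * b := by rw [mul_inv_mul]
    _ = b * a * (a⁻¹ * a) * b := by simp only [mul_assoc]
    _ = a⁻¹ * a * (b * a) * b := by rw [idem_comm _ _ hba (inv_mul_idem a)]
    _ = a⁻¹ * (a * b) := by rw [mul_assoc _ (b * a) b, h2, mul_assoc]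
    _ = a⁻¹ * a * a⁻¹ * (a * b) := by rw [inv_mul_inv]
    _ = a⁻¹ * (a * a⁻¹ * (a * b)) := by simp only [mul_assoc]
    _ = a⁻¹ * (a * b * (a * a⁻¹)) := by rw [idem_comm _ _ hab (mul_inv_idem a)]
    _ = a⁻¹ * (a * b * a * a⁻¹) := by simp only [mul_assoc]
    _ = a⁻¹ := by rw [h1, ← mul_assoc, inv_mul_inv]

theorem inv_inv' (a : G) : a⁻¹⁻¹ = a := (inv_unique (inv_mul_inv a) (mul_inv_mul a)).symm

theorem inv_idem {e : G} (he : e * e = e) : e⁻¹ = e :=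
  (inv_unique (by rw [he, he]) (by rw [he, he])).symm

theorem mul_inv_rev' (a b : G) : (a * b)⁻¹ = b⁻¹ * a⁻¹ := by
  refine (inv_unique ?_ ?_).symm
  · calc a * b * (b⁻¹ * a⁻¹) * (a * b) = a * (b * b⁻¹ * (a⁻¹ * a)) * b := by simp only [mul_assoc]
      _ = a * (a⁻¹ * a * (b * b⁻¹)) * b := by
          rw [idem_comm _ _ (mul_inv_idem b) (inv_mul_idem a)]
      _ = (a * a⁻¹ * a) * (b * b⁻¹ * b) := by simp only [mul_assoc]
      _ = a * b := by rw [mul_inv_mul, mul_inv_mul]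
  · calc b⁻¹ * a⁻¹ * (a * b) * (b⁻¹ * a⁻¹) = b⁻¹ * (a⁻¹ * a * (b * b⁻¹)) * a⁻¹ := by
          simp only [mul_assoc]
      _ = b⁻¹ * (b * b⁻¹ * (a⁻¹ * a)) * a⁻¹ := by
          rw [idem_comm _ _ (mul_inv_idem b) (inv_mul_idem a)]
      _ = (b⁻¹ * b * b⁻¹) * (a⁻¹ * a * a⁻¹) := by simp only [mul_assoc]
      _ = b⁻¹ * a⁻¹ := by rw [inv_mul_inv, inv_mul_inv]

/-- The natural order: `g ≤ h` iff `g = e h` for an idempotent `e`. -/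
def NatLE (g h : G) : Prop := ∃ e : G, e * e = e ∧ g = e * h

theorem natLE_idem {e f : G} (hf : f * f = f) : NatLE e f → e * f = e := by
  rintro ⟨d, _, rfl⟩
  rw [mul_assoc, hf]

/-- `e` is an identity element. -/
def IsOne (e : G) : Prop := ∀ h : G, e * h = h ∧ h * e = h

/-- `z` is a zero element (the unique element of a one-element semigroup counts as an identity
only). -/
def IsZero (z : G) : Prop := Nontrivial G ∧ ∀ h : G, z * h = z ∧ h * z = z

theorem IsZero.idem {z : G} (hz : IsZero z) : z * z = z := (hz.2 z).1

end InverseSemigroup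

open InverseSemigroup

/-! ### `G`-algebras -/

/-- An action of the inverse semigroup `G` on the C⋆-algebra `A` by `⋆`-endomorphisms: a unital
semigroup homomorphism into `End A` with `α_{gg⁻¹}(x) y = x α_{gg⁻¹}(y)`. -/
structure GAction (G A : Type*) [InverseSemigroup G] [NonUnitalCStarAlgebra A] where
  act : G → A →⋆ₙₐ[ℂ] A
  act_mul : ∀ g h a, act (g * h) a = act g (act h a)
  act_one : ∀ e, IsOne e → ∀ a, act e a = a
  act_zero : ∀ z, IsZero z → ∀ a, act z a = 0
  compat : ∀ g x y, act (g * g⁻¹) x * y = x * act (g * g⁻¹) y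

/-- A `G`-algebra: a `ℤ/2`-graded C⋆-algebra (the grading is given by the automorphism `grading`
of order two, with `±1`-eigenspaces the even and odd elements) with a `G`-action that respects
the grading. -/
structure GAlgebra (G A : Type*) [InverseSemigroup G] [NonUnitalCStarAlgebra A] extends
    GAction G A where
  grading : A →⋆ₙₐ[ℂ] A
  grading_grading : ∀ a, grading (grading a) = a
  act_grading : ∀ g a, act g (grading a) = grading (act g a)

namespace GAction

variable {G A : Type*} [InverseSemigroup G] [NonUnitalCStarAlgebra A] (α : GAction G A)

theorem compat_idem {e : G} (he : e * e = e) (x y : A) : α.act e x * y = x * α.act e y := by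
  have := α.compat e x y
  rwa [inv_idem he, he] at this

end GAction

/-! ### The balanced maximal tensor product -/

section BalancedTensor

open TensorProduct

variable {G A B : Type*} [InverseSemigroup G] [NonUnitalCStarAlgebra A] [NonUnitalCStarAlgebra B]

/-- The algebraic tensor product of `A` and `B`, to be equipped with the largest C⋆-seminorm
compatible with the actions `α` and `β`. -/
def AlgTensor (_α : GAction G A) (_β : GAction G B) : Type _ := A ⊗[ℂ] B

namespace AlgTensor

variable (α : GAction G A) (β : GAction G B)

noncomputable instance : NonUnitalRing (AlgTensor α β) :=
  inferInstanceAs (NonUnitalRing (A ⊗[ℂ] B))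
noncomputable instance : StarRing (AlgTensor α β) := inferInstanceAs (StarRing (A ⊗[ℂ] B))
noncomputable instance : Module ℂ (AlgTensor α β) := inferInstanceAs (Module ℂ (A ⊗[ℂ] B))
instance : StarModule ℂ (AlgTensor α β) := inferInstanceAs (StarModule ℂ (A ⊗[ℂ] B))
instance : IsScalarTower ℂ (AlgTensor α β) (AlgTensor α β) :=
  inferInstanceAs (IsScalarTower ℂ (A ⊗[ℂ] B) (A ⊗[ℂ] B))
instance : SMulCommClass ℂ (AlgTensor α β) (AlgTensor α β) :=
  inferInstanceAs (SMulCommClass ℂ (A ⊗[ℂ] B) (A ⊗[ℂ] B))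

/-- The elementary tensor `a ⊗ b`. -/
noncomputable def mk (a : A) (b : B) : AlgTensor α β := a ⊗ₜ[ℂ] b

variable {α β}

theorem mk_mul (a a' : A) (b b' : B) : mk α β a b * mk α β a' b' = mk α β (a * a') (b * b') :=
  Algebra.TensorProduct.tmul_mul_tmul a a' b b'

theorem mk_star (a : A) (b : B) : star (mk α β a b) = mk α β (star a) (star b) := rfl

theorem induction {P : AlgTensor α β → Prop} (x : AlgTensor α β) (h0 : P 0)
    (ht : ∀ a b, P (mk α β a b)) (ha : ∀ x y, P x → P y → P (x + y)) : P x :=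
  TensorProduct.induction_on x h0 ht ha

/-- The C⋆-seminorms on the algebraic tensor product that annihilate the balancing relations
`e(a) ⊗ b - a ⊗ e(b)`, `e` idempotent. (The bound on elementary tensors holds for every
C⋆-seminorm.) -/
structure IsBalancedCStarSeminorm (N : Seminorm ℂ (AlgTensor α β)) : Prop where
  mul_le : ∀ x y, N (x * y) ≤ N x * N y
  star_mul_self : ∀ x, N (star x * x) = N x * N x
  tmul_le : ∀ a b, N (mk α β a b) ≤ ‖a‖ * ‖b‖
  balanced : ∀ e, e * e = e → ∀ a b, N (mk α β (α.act e a) b - mk α β a (β.act e b)) = 0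

variable (α β) in
/-- The index type of all balanced C⋆-seminorms. -/
def BalancedSeminorm : Type _ :=
  {N : Seminorm ℂ (AlgTensor α β) // IsBalancedCStarSeminorm N}

instance : Nonempty (BalancedSeminorm α β) :=
  ⟨⟨0, ⟨by simp, by simp, fun a b => by simpa using by positivity, by simp⟩⟩⟩

theorem bddAbove (x : AlgTensor α β) :
    BddAbove (Set.range fun N : BalancedSeminorm α β => N.1 x) := by
  induction x using AlgTensor.induction with
  | h0 => exact ⟨0, by rintro _ ⟨N, rfl⟩; simp⟩
  | ht a b => exact ⟨‖a‖ * ‖b‖, by rintro _ ⟨N, rfl⟩; exact N.2.tmul_le a b⟩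
  | ha x y hx hy =>
    obtain ⟨c, hc⟩ := hx
    obtain ⟨d, hd⟩ := hy
    refine ⟨c + d, ?_⟩
    rintro _ ⟨N, rfl⟩
    exact (map_add_le_add N.1 x y).trans (add_le_add (hc ⟨N, rfl⟩) (hd ⟨N, rfl⟩))

section Norm

variable (α β) in
/-- The largest balanced C⋆-seminorm. -/
noncomputable abbrev maxNorm : Norm (AlgTensor α β) :=
  ⟨fun x => ⨆ N : BalancedSeminorm α β, N.1 x⟩

attribute [local instance] maxNorm

theorem norm_def (x : AlgTensor α β) : ‖x‖ = ⨆ N : BalancedSeminorm α β, N.1 x := rfl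

theorem le_norm (N : BalancedSeminorm α β) (x : AlgTensor α β) : N.1 x ≤ ‖x‖ :=
  le_ciSup (bddAbove x) N

theorem norm_le {x : AlgTensor α β} {c : ℝ} (h : ∀ N : BalancedSeminorm α β, N.1 x ≤ c) :
    ‖x‖ ≤ c :=
  ciSup_le h

theorem norm_nonneg' (x : AlgTensor α β) : 0 ≤ ‖x‖ :=
  (apply_nonneg (Classical.arbitrary (BalancedSeminorm α β)).1 x).trans (le_norm _ x)

theorem core : SeminormedSpace.Core ℂ (AlgTensor α β) where
  norm_nonneg := norm_nonneg'
  norm_smul c x := by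
    rw [norm_def, norm_def, Real.mul_iSup_of_nonneg (norm_nonneg c)]
    exact iSup_congr fun N => map_smul_eq_mul N.1 c x
  norm_triangle x y := norm_le fun N =>
    (map_add_le_add N.1 x y).trans (add_le_add (le_norm N x) (le_norm N y))

variable (α β) in
noncomputable abbrev maxSeminormedGroup : SeminormedAddCommGroup (AlgTensor α β) :=
  SeminormedAddCommGroup.ofCore (core (α := α) (β := β))

attribute [local instance] maxSeminormedGroup

variable (α β) in
noncomputable abbrev maxNormedSpace : NormedSpace ℂ (AlgTensor α β) where
  norm_smul_le c x := (core.norm_smul c x).le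

variable (α β) in
noncomputable abbrev maxSeminormedRing : NonUnitalSeminormedRing (AlgTensor α β) where
  __ := (inferInstance : SeminormedAddCommGroup (AlgTensor α β))
  __ := (inferInstance : NonUnitalRing (AlgTensor α β))
  norm_mul_le x y := norm_le fun N => (N.2.mul_le x y).trans
    (mul_le_mul (le_norm N x) (le_norm N y) (apply_nonneg _ _) (norm_nonneg' x))

attribute [local instance] maxNormedSpace maxSeminormedRing

noncomputable instance : PreCStarAlgebra (AlgTensor α β) where
  __ := (inferInstance : NormedSpace ℂ (AlgTensor α β))
  smul_assoc := smul_assoc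
  smul_comm := smul_comm
  star_smul := star_smul
  norm_star_mul_self_eq x := by
    refine le_antisymm (norm_le fun N => ?_) ?_
    · rw [N.2.star_mul_self]
      exact mul_le_mul (le_norm N x) (le_norm N x) (apply_nonneg _ _) (norm_nonneg' x)
    · have h : ‖x‖ ≤ Real.sqrt ‖star x * x‖ := norm_le fun N => by
        refine Real.le_sqrt_of_sq_le ?_
        rw [sq, ← N.2.star_mul_self]
        exact le_norm N _
      calc ‖x‖ * ‖x‖ ≤ Real.sqrt ‖star x * x‖ * Real.sqrt ‖star x * x‖ :=
            mul_le_mul h h (norm_nonneg' x) (Real.sqrt_nonneg _)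
        _ = _ := Real.mul_self_sqrt (norm_nonneg' _)

end Norm

theorem le_norm' (N : BalancedSeminorm α β) (x : AlgTensor α β) : N.1 x ≤ ‖x‖ := le_norm N x

theorem norm_le' {x : AlgTensor α β} {c : ℝ} (h : ∀ N : BalancedSeminorm α β, N.1 x ≤ c) :
    ‖x‖ ≤ c := norm_le h

theorem norm_mk_le (a : A) (b : B) : ‖mk α β a b‖ ≤ ‖a‖ * ‖b‖ := norm_le' fun N => N.2.tmul_le a b

theorem norm_balanced (e : G) (he : e * e = e) (a : A) (b : B) :
    ‖mk α β (α.act e a) b - mk α β a (β.act e b)‖ = 0 :=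
  le_antisymm (norm_le' fun N => (N.2.balanced e he a b).le) (norm_nonneg _)

/-- `α_g ⊗ β_g` on the algebraic tensor product. -/
noncomputable def actAlg (α : GAction G A) (β : GAction G B) (g : G) :
    AlgTensor α β →⋆ₙₐ[ℂ] AlgTensor α β :=
  let L : AlgTensor α β →ₗ[ℂ] AlgTensor α β :=
    TensorProduct.map ((α.act g : A →ₙₐ[ℂ] A) : A →ₗ[ℂ] A) ((β.act g : B →ₙₐ[ℂ] B) : B →ₗ[ℂ] B)
  have hL : ∀ a b, L (mk α β a b) = mk α β (α.act g a) (β.act g b) := fun a b => rfl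
  { toFun := L
    map_smul' := fun c x => map_smul L c x
    map_zero' := map_zero L
    map_add' := map_add L
    map_mul' := fun x y => by
      induction x using AlgTensor.induction with
      | h0 => simp
      | ha x x' hx hx' => rw [add_mul, map_add, hx, hx', map_add, add_mul]
      | ht a b =>
        induction y using AlgTensor.induction with
        | h0 => simp
        | ha x x' hx hx' => rw [mul_add, map_add, hx, hx', map_add, mul_add]
        | ht a' b' => rw [mk_mul, hL, hL, hL, mk_mul, map_mul, map_mul]
    map_star' := fun x => by
      induction x using AlgTensor.induction with
      | h0 => simp
      | ha x x' hx hx' =>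
        change L _ = star (L _) at hx hx' ⊢
        rw [star_add, map_add, hx, hx', map_add, star_add]
      | ht a b =>
        change L _ = star (L _)
        rw [mk_star, hL, hL, mk_star, map_star, map_star] }

theorem actAlg_mk (g : G) (a : A) (b : B) :
    actAlg α β g (mk α β a b) = mk α β (α.act g a) (β.act g b) := rfl

theorem norm_actAlg_le (g : G) (x : AlgTensor α β) : ‖actAlg α β g x‖ ≤ ‖x‖ := by
  refine norm_le' fun N => ?_
  let L : AlgTensor α β →ₗ[ℂ] AlgTensor α β :=
    { toFun := actAlg α β g, map_add' := map_add _, map_smul' := map_smul _ }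
  have hL : ∀ x, L x = actAlg α β g x := fun _ => rfl
  refine le_norm' ⟨N.1.comp L, ⟨fun x y => ?_, fun x => ?_, fun a b => ?_, fun e he a b => ?_⟩⟩ x
  · simp only [Seminorm.comp_apply, hL, map_mul]
    exact N.2.mul_le _ _
  · simp only [Seminorm.comp_apply, hL, map_mul, map_star]
    exact N.2.star_mul_self _
  · simp only [Seminorm.comp_apply, hL, actAlg_mk]
    exact (N.2.tmul_le _ _).trans (mul_le_mul (NonUnitalStarAlgHom.norm_apply_le _ _)
      (NonUnitalStarAlgHom.norm_apply_le _ _) (norm_nonneg _) (norm_nonneg _))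
  · simp only [Seminorm.comp_apply, hL, map_sub, actAlg_mk]
    have h1 : g * e = (g * e * g⁻¹) * g := by
      calc g * e = g * g⁻¹ * g * e := by rw [mul_inv_mul]
        _ = g * (g⁻¹ * g * e) := by simp only [mul_assoc]
        _ = g * (e * (g⁻¹ * g)) := by rw [idem_comm _ _ (inv_mul_idem g) he]
        _ = _ := by simp only [mul_assoc]
    have h2 : (g * e * g⁻¹) * (g * e * g⁻¹) = g * e * g⁻¹ := by
      calc (g * e * g⁻¹) * (g * e * g⁻¹) = (g * e * g⁻¹ * g) * e * g⁻¹ := by simp only [mul_assoc]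
        _ = g * (e * e) * g⁻¹ := by rw [← h1]; simp only [mul_assoc]
        _ = _ := by rw [he]
    have := N.2.balanced _ h2 (α.act g a) (β.act g b)
    rwa [← α.act_mul, ← β.act_mul, ← h1, α.act_mul, β.act_mul] at this

end AlgTensor

open UniformSpace

/-- The balanced tensor product `A ⊗^X B` of two `G`-algebras: the maximal C⋆-tensor product modulo
the relations `e(a) ⊗ b = a ⊗ e(b)`, that is, the separated completion of the algebraic tensor
product in the largest C⋆-seminorm that annihilates these relations. -/
abbrev BalTensor (α : GAction G A) (β : GAction G B) : Type _ := Completion (AlgTensor α β)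

namespace BalTensor

variable {α : GAction G A} {β : GAction G B}

variable (α β) in
/-- The elementary tensor `a ⊗ b` in `A ⊗^X B`. -/
noncomputable def tmul (a : A) (b : B) : BalTensor α β := (AlgTensor.mk α β a b : Completion _)

theorem tmul_balanced (e : G) (he : e * e = e) (a : A) (b : B) :
    tmul α β (α.act e a) b = tmul α β a (β.act e b) := by
  rw [← sub_eq_zero, ← norm_eq_zero, tmul, tmul, ← Completion.coe_sub, Completion.norm_coe]
  exact AlgTensor.norm_balanced e he a b

/-- Two continuous additive maps on `A ⊗^X B` that agree on elementary tensors are equal. -/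
theorem ext_add {M : Type*} [AddCommGroup M] [TopologicalSpace M] [T2Space M]
    (f g : BalTensor α β →+ M) (hf : Continuous f) (hg : Continuous g)
    (h : ∀ a b, f (tmul α β a b) = g (tmul α β a b)) (x : BalTensor α β) : f x = g x := by
  refine Completion.induction_on x (isClosed_eq hf hg) fun x => ?_
  induction x using AlgTensor.induction with
  | h0 => rw [Completion.coe_zero, map_zero, map_zero]
  | ht a b => exact h a b
  | ha x y hx hy => rw [Completion.coe_add, map_add, map_add, hx, hy]

/-- The endomorphism `α_g ⊗ β_g` of `A ⊗^X B`. -/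
noncomputable def actHom (α : GAction G A) (β : GAction G B) (g : G) :
    BalTensor α β →⋆ₙₐ[ℂ] BalTensor α β :=
  PreCStarAlgebra.completionMap (AlgTensor.actAlg α β g) (AlgTensor.norm_actAlg_le g)

theorem actHom_tmul (g : G) (a : A) (b : B) :
    actHom α β g (tmul α β a b) = tmul α β (α.act g a) (β.act g b) :=
  PreCStarAlgebra.completionMap_coe _ _ _

theorem continuous_actHom (g : G) : Continuous (actHom α β g) :=
  PreCStarAlgebra.continuous_completionMap _ _

theorem tmul_mul (a a' : A) (b b' : B) :
    tmul α β a b * tmul α β a' b' = tmul α β (a * a') (b * b') := by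
  rw [tmul, tmul, ← PreCStarAlgebra.coe_mul, AlgTensor.mk_mul, tmul]

/-- The diagonal action `g ↦ α_g ⊗ β_g` on `A ⊗^X B`. -/
noncomputable def action (α : GAction G A) (β : GAction G B) : GAction G (BalTensor α β) where
  act := actHom α β
  act_mul g h := ext_add (actHom α β (g * h) : BalTensor α β →+ BalTensor α β)
    ((actHom α β g : BalTensor α β →+ BalTensor α β).comp
      (actHom α β h : BalTensor α β →+ BalTensor α β))
    (continuous_actHom _) ((continuous_actHom _).comp (continuous_actHom _)) fun a b => by
      change actHom α β (g * h) _ = actHom α β g (actHom α β h _)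
      rw [actHom_tmul, actHom_tmul, actHom_tmul, α.act_mul, β.act_mul]
  act_one e he := ext_add (actHom α β e : BalTensor α β →+ BalTensor α β)
    (AddMonoidHom.id _) (continuous_actHom _) continuous_id fun a b => by
      change actHom α β e _ = tmul α β a b
      rw [actHom_tmul, α.act_one e he, β.act_one e he]
  act_zero z hz := ext_add (actHom α β z : BalTensor α β →+ BalTensor α β)
    0 (continuous_actHom _) continuous_const fun a b => by
      change actHom α β z _ = 0
      rw [actHom_tmul, α.act_zero z hz, tmul, ← Completion.coe_zero]
      exact congrArg _ (TensorProduct.zero_tmul _ _)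
  compat g x y := by
    have h1 : ∀ a b, actHom α β (g * g⁻¹) (tmul α β a b) * y
        = tmul α β a b * actHom α β (g * g⁻¹) y := fun a b =>
      ext_add ((AddMonoidHom.mulLeft (actHom α β (g * g⁻¹) (tmul α β a b))))
        ((AddMonoidHom.mulLeft (tmul α β a b)).comp
          (actHom α β (g * g⁻¹) : BalTensor α β →+ BalTensor α β))
        (continuous_const_mul _) ((continuous_const_mul _).comp (continuous_actHom _))
        (fun a' b' => by
          change actHom α β (g * g⁻¹) (tmul α β a b) * tmul α β a' b'
            = tmul α β a b * actHom α β (g * g⁻¹) (tmul α β a' b')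
          rw [actHom_tmul, actHom_tmul, tmul_mul, tmul_mul, α.compat, β.compat]) y
    exact ext_add ((AddMonoidHom.mulRight y).comp
          (actHom α β (g * g⁻¹) : BalTensor α β →+ BalTensor α β))
        (AddMonoidHom.mulRight (actHom α β (g * g⁻¹) y))
        ((continuous_mul_const _).comp (continuous_actHom _)) (continuous_mul_const _) h1 x

end BalTensor

end BalancedTensor

/-! ### Multipliers `m ⊗ 1` -/

section Multipliers

open TensorProduct UniformSpace
open scoped MultiplierAlgebra

variable {G A B : Type*} [InverseSemigroup G] [NonUnitalCStarAlgebra A] [NonUnitalCStarAlgebra B]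

namespace AlgTensor

variable {α : GAction G A} {β : GAction G B}

/-- `T ⊗ id` on the algebraic tensor product. -/
noncomputable def mapLeft (α : GAction G A) (β : GAction G B) (T : A →L[ℂ] A) :
    AlgTensor α β →ₗ[ℂ] AlgTensor α β :=
  TensorProduct.map (T : A →ₗ[ℂ] A) LinearMap.id

theorem mapLeft_mk (T : A →L[ℂ] A) (a : A) (b : B) :
    mapLeft α β T (mk α β a b) = mk α β (T a) b := rfl

theorem mk_add_left (a a' : A) (b : B) : mk α β (a + a') b = mk α β a b + mk α β a' b :=
  TensorProduct.add_tmul _ _ _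

theorem mapLeft_add (S T : A →L[ℂ] A) (x : AlgTensor α β) :
    mapLeft α β (S + T) x = mapLeft α β S x + mapLeft α β T x := by
  induction x using AlgTensor.induction with
  | h0 => simp
  | ht a b => exact mk_add_left _ _ _
  | ha x y hx hy => rw [map_add, map_add, map_add, hx, hy]; abel

theorem mapLeft_real_smul_one (r : ℝ) (x : AlgTensor α β) :
    mapLeft α β ((algebraMap ℝ 𝓜(ℂ, A) r).fst) x = (r : ℂ) • x := by
  have h : ∀ a, (algebraMap ℝ 𝓜(ℂ, A) r).fst a = (r : ℂ) • a := fun a => by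
    rw [Algebra.algebraMap_eq_smul_one]
    change ((r : ℝ) • (1 : 𝓜(ℂ, A))).fst a = _
    rfl
  induction x using AlgTensor.induction with
  | h0 => simp
  | ht a b => rw [mapLeft_mk, h]; exact TensorProduct.smul_tmul' _ _ _
  | ha x y hx hy => rw [map_add, hx, hy, smul_add]

theorem star_mapLeft_mul (m n : 𝓜(ℂ, A)) (x y : AlgTensor α β) :
    star (mapLeft α β m.fst x) * mapLeft α β n.fst y
      = star x * mapLeft α β (star m * n).fst y := by
  induction x using AlgTensor.induction with
  | h0 => simp
  | ha x x' hx hx' => rw [map_add, star_add, add_mul, hx, hx', star_add, add_mul]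
  | ht a b =>
    induction y using AlgTensor.induction with
    | h0 => simp
    | ha y y' hy hy' => rw [map_add, mul_add, hy, hy', map_add, mul_add]
    | ht a' b' =>
      rw [mapLeft_mk, mapLeft_mk, mapLeft_mk, mk_star, mk_star, mk_mul, mk_mul]
      congr 1
      rw [DoubleCentralizer.mul_fst, _root_.mul_apply_eq_comp, ← (star m).central,
        DoubleCentralizer.star_snd, star_star]

theorem star_mapLeft_snd (m : 𝓜(ℂ, A)) (x : AlgTensor α β) :
    star (mapLeft α β m.snd x) = mapLeft α β (star m).fst (star x) := by
  induction x using AlgTensor.induction with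
  | h0 => simp
  | ha x x' hx hx' => rw [map_add, star_add, hx, hx', star_add, map_add]
  | ht a b =>
    rw [mapLeft_mk, mk_star, mk_star, mapLeft_mk, DoubleCentralizer.star_fst, star_star]

theorem mapLeft_central (m : 𝓜(ℂ, A)) (x y : AlgTensor α β) :
    mapLeft α β m.snd x * y = x * mapLeft α β m.fst y := by
  induction x using AlgTensor.induction with
  | h0 => simp
  | ha x x' hx hx' => rw [map_add, add_mul, hx, hx', add_mul]
  | ht a b =>
    induction y using AlgTensor.induction with
    | h0 => simp
    | ha y y' hy hy' => rw [map_add, mul_add, hy, hy', mul_add]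
    | ht a' b' => rw [mapLeft_mk, mapLeft_mk, mk_mul, mk_mul, m.central]

theorem norm_mapLeft_fst_le (m : 𝓜(ℂ, A)) (x : AlgTensor α β) :
    ‖mapLeft α β m.fst x‖ ≤ ‖m‖ * ‖x‖ := by
  let _ := CStarAlgebra.spectralOrder 𝓜(ℂ, A)
  have := CStarAlgebra.spectralOrderedRing 𝓜(ℂ, A)
  let _ := CStarAlgebra.spectralOrder (Completion (AlgTensor α β))
  have := CStarAlgebra.spectralOrderedRing (Completion (AlgTensor α β))
  have hm : 0 ≤ algebraMap ℝ 𝓜(ℂ, A) (‖m‖ ^ 2) - star m * m :=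
    sub_nonneg.2 CStarAlgebra.star_mul_le_algebraMap_norm_sq
  obtain ⟨c, hc⟩ := CStarAlgebra.nonneg_iff_eq_star_mul_self.1 hm
  have h1 : algebraMap ℝ 𝓜(ℂ, A) (‖m‖ ^ 2) = star c * c + star m * m := by rw [← hc]; abel
  have h2 : ((‖m‖ ^ 2 : ℝ) : ℂ) • (star x * x)
      = star (mapLeft α β c.fst x) * mapLeft α β c.fst x
        + star (mapLeft α β m.fst x) * mapLeft α β m.fst x := by
    rw [star_mapLeft_mul, star_mapLeft_mul, ← mul_add, ← mapLeft_add, ← DoubleCentralizer.add_fst,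
      ← h1, mapLeft_real_smul_one, mul_smul_comm]
  have h3 := congrArg (fun z : AlgTensor α β => (z : Completion (AlgTensor α β))) h2
  simp only [Completion.coe_add, PreCStarAlgebra.coe_mul, PreCStarAlgebra.coe_star] at h3
  have h4 : star ((mapLeft α β m.fst x : AlgTensor α β) : Completion (AlgTensor α β))
        * (mapLeft α β m.fst x : AlgTensor α β)
      ≤ ((((‖m‖ ^ 2 : ℝ) : ℂ) • (star x * x) : AlgTensor α β) : Completion (AlgTensor α β)) := by
    rw [h3]
    exact le_add_of_nonneg_left (star_mul_self_nonneg _)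
  have h5 := CStarAlgebra.norm_le_norm_of_nonneg_of_le (star_mul_self_nonneg _) h4
  rw [CStarRing.norm_star_mul_self, Completion.norm_coe, Completion.norm_coe, norm_smul,
    PreCStarAlgebra.norm_star_mul_self_eq, Complex.norm_real, Real.norm_of_nonneg (by positivity)]
    at h5
  refine (pow_le_pow_iff_left₀ (norm_nonneg _) (by positivity) two_ne_zero).1 ?_
  calc _ = _ := sq _
    _ ≤ _ := h5
    _ = _ := by ring

theorem norm_mapLeft_snd_le (m : 𝓜(ℂ, A)) (x : AlgTensor α β) :
    ‖mapLeft α β m.snd x‖ ≤ ‖m‖ * ‖x‖ := by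
  rw [← PreCStarAlgebra.norm_star_eq, star_mapLeft_snd, ← PreCStarAlgebra.norm_star_eq x,
    ← norm_star m]
  exact norm_mapLeft_fst_le _ _

end AlgTensor

/-- The multiplier `m ⊗ 1` of `A ⊗^X B`, determined by `(m ⊗ 1)(a ⊗ b) = m a ⊗ b`
(and `(a ⊗ b)(m ⊗ 1) = a m ⊗ b`). -/
noncomputable def tensorOne (α : GAction G A) (β : GAction G B) (m : 𝓜(ℂ, A)) :
    𝓜(ℂ, BalTensor α β) where
  fst := ((AlgTensor.mapLeft α β m.fst).mkContinuous ‖m‖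
    (AlgTensor.norm_mapLeft_fst_le m)).completion
  snd := ((AlgTensor.mapLeft α β m.snd).mkContinuous ‖m‖
    (AlgTensor.norm_mapLeft_snd_le m)).completion
  central x y := Completion.induction_on₂ x y (isClosed_eq (by fun_prop) (by fun_prop))
    fun x y => by
      rw [ContinuousLinearMap.completion_apply_coe, ContinuousLinearMap.completion_apply_coe,
        ← PreCStarAlgebra.coe_mul, ← PreCStarAlgebra.coe_mul]
      exact congrArg _ (AlgTensor.mapLeft_central m x y)

theorem tensorOne_fst_tmul (α : GAction G A) (β : GAction G B) (m : 𝓜(ℂ, A)) (a : A) (b : B) :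
    (tensorOne α β m).fst (BalTensor.tmul α β a b) = BalTensor.tmul α β (m.fst a) b :=
  ContinuousLinearMap.completion_apply_coe _ _

theorem tensorOne_snd_tmul (α : GAction G A) (β : GAction G B) (m : 𝓜(ℂ, A)) (a : A) (b : B) :
    (tensorOne α β m).snd (BalTensor.tmul α β a b) = BalTensor.tmul α β (m.snd a) b :=
  ContinuousLinearMap.completion_apply_coe _ _

theorem tensorOne_one (α : GAction G A) (β : GAction G B) :
    tensorOne α β (1 : 𝓜(ℂ, A)) = 1 := by
  refine DoubleCentralizer.ext _ _ _ _ (Prod.ext ?_ ?_)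
  · ext x
    exact BalTensor.ext_add ((tensorOne α β (1 : 𝓜(ℂ, A))).fst : _ →+ BalTensor α β)
      (AddMonoidHom.id _) (ContinuousLinearMap.continuous _) continuous_id
      (tensorOne_fst_tmul α β 1) x
  · ext x
    exact BalTensor.ext_add ((tensorOne α β (1 : 𝓜(ℂ, A))).snd : _ →+ BalTensor α β)
      (AddMonoidHom.id _) (ContinuousLinearMap.continuous _) continuous_id
      (tensorOne_snd_tmul α β 1) x

/-- `A` has a strictly positive element: some `h ≥ 0` such that `h A` is dense in `A`. -/
def HasStrictlyPositiveElement (A : Type*) [NonUnitalCStarAlgebra A] : Prop :=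
  ∃ h : A, (∃ b : A, h = star b * b) ∧ Dense (Set.range fun a : A => h * a)

/-- The projection `p ∈ 𝓜(A)` is full: `A p A` spans a dense subspace of `A`. -/
def IsFullMultiplier (p : 𝓜(ℂ, A)) : Prop :=
  Dense (Submodule.span ℂ {x : A | ∃ a b : A, x = a * p.fst b} : Set A)

/-- The multiplier `m ∈ 𝓜(A)` is `G`-invariant: as an operator on `A` it commutes with every
`α_g`. -/
def GAction.IsInvariant (α : GAction G A) (m : 𝓜(ℂ, A)) : Prop :=
  ∀ (g : G) (a : A), m.fst (α.act g a) = α.act g (m.fst a)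

end Multipliers

/-! ### `G`-Hilbert modules and the induced actions on operators -/

section GHilbert

open HilbertModule

variable {G B E : Type*} [InverseSemigroup G] [NonUnitalCStarAlgebra B] [PartialOrder B]
  [StarOrderedRing B] [NormedAddCommGroup E] [NormedSpace ℂ E] [SMul B E] [CStarModule B E]

/-- The structure of a (trivially graded) `G`-Hilbert module over the `G`-algebra `(B, β)`. -/
structure GHilbertModule (β : GAction G B) (E : Type*) [NormedAddCommGroup E] [NormedSpace ℂ E]
    [SMul B E] [CStarModule B E] where
  U : G → E →ₗ[ℂ] E
  U_mul : ∀ g h x, U (g * h) x = U g (U h x)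
  U_one : ∀ e, IsOne e → ∀ x, U e x = x
  U_zero : ∀ z, IsZero z → ∀ x, U z x = 0
  inner_U : ∀ g x y, inner B (U g x) (U g y) = β.act g (inner B x y)
  U_smul : ∀ g (b : B) x, U g (b • x) = β.act g b • U g x
  compat : ∀ g (b : B) x, b • U (g * g⁻¹) x = β.act (g * g⁻¹) b • x

namespace GHilbertModule

variable {β : GAction G B} (M : GHilbertModule β E)

theorem norm_U_le (g : G) (x : E) : ‖M.U g x‖ ≤ ‖x‖ := by
  refine (pow_le_pow_iff_left₀ (norm_nonneg _) (norm_nonneg _) two_ne_zero).1 ?_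
  rw [CStarModule.norm_sq_eq B, CStarModule.norm_sq_eq B, M.inner_U]
  exact NonUnitalStarAlgHom.norm_apply_le _ _

/-- `U_g` as a continuous linear map. -/
noncomputable def UL (g : G) : E →L[ℂ] E :=
  (M.U g).mkContinuous 1 fun x => by rw [one_mul]; exact M.norm_U_le g x

theorem UL_apply (g : G) (x : E) : M.UL g x = M.U g x := rfl

theorem inner_U_idem {e : G} (he : e * e = e) (x z : E) :
    inner B z (M.U e x) = β.act e (inner B z x) := by
  have h : ∀ b : B, b * (inner B z (M.U e x) - β.act e (inner B z x)) = 0 := fun b => by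
    have h1 := M.compat e b x
    rw [inv_idem he, he] at h1
    have h2 := congrArg (inner B z) h1
    rw [CStarModule.inner_op_smul_right, CStarModule.inner_op_smul_right,
      β.compat_idem he] at h2
    rw [mul_sub, h2, sub_self]
  have h3 := h (star (inner B z (M.U e x) - β.act e (inner B z x)))
  rw [CStarRing.star_mul_self_eq_zero_iff] at h3
  exact sub_eq_zero.1 h3

theorem U_idem_inner {e : G} (he : e * e = e) (x z : E) :
    inner B (M.U e x) z = β.act e (inner B x z) := by
  rw [← CStarModule.star_inner (A := B) z, M.inner_U_idem he, ← map_star,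
    CStarModule.star_inner]

theorem inner_U_left (g : G) (x y : E) :
    inner B (M.U g x) y = β.act g (inner B x (M.U g⁻¹ y)) := by
  rw [← M.inner_U, ← M.U_mul, M.inner_U_idem (mul_inv_idem g), ← M.U_idem_inner (mul_inv_idem g),
    ← M.U_mul, mul_inv_mul]

theorem inner_U_right (g : G) (x y : E) :
    inner B x (M.U g y) = β.act g (inner B (M.U g⁻¹ x) y) := by
  rw [← CStarModule.star_inner (A := B) (M.U g y), M.inner_U_left, ← map_star,
    CStarModule.star_inner]

theorem U_idem_comm {e : G} (he : e * e = e) (T : adjointable B E) (x : E) :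
    M.U e ((T : E →L[ℂ] E) x) = (T : E →L[ℂ] E) (M.U e x) :=
  ext_inner B fun z => by
    rw [M.inner_U_idem he, ← adj_inner, ← M.inner_U_idem he, adj_inner]

theorem U_inv_U (g : G) (x : E) : M.U g (M.U g⁻¹ (M.U g x)) = M.U g x := by
  rw [← M.U_mul, ← M.U_mul, mul_inv_mul]

/-- `g(T) = U_g T U_{g⁻¹}` for an adjointable operator `T`. -/
noncomputable def conjOp (g : G) (T : adjointable B E) : adjointable B E :=
  ⟨M.UL g * (T : E →L[ℂ] E) * M.UL g⁻¹, M.UL g * adj T * M.UL g⁻¹, fun x y => by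
    change inner B (M.U g ((T : E →L[ℂ] E) (M.U g⁻¹ x))) y
      = inner B x (M.U g (adj T (M.U g⁻¹ y)))
    rw [M.inner_U_left, M.inner_U_right g x, inner_adj]⟩

theorem conjOp_apply (g : G) (T : adjointable B E) (x : E) :
    (M.conjOp g T : E →L[ℂ] E) x = M.U g ((T : E →L[ℂ] E) (M.U g⁻¹ x)) := rfl

theorem adjointable_ext {S T : adjointable B E}
    (h : ∀ x, (S : E →L[ℂ] E) x = (T : E →L[ℂ] E) x) : S = T :=
  Subtype.ext (ContinuousLinearMap.ext h)

theorem conjOp_mul (g : G) (S T : adjointable B E) :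
    M.conjOp g (S * T) = M.conjOp g S * M.conjOp g T := adjointable_ext fun x => by
  change M.U g ((S : E →L[ℂ] E) ((T : E →L[ℂ] E) (M.U g⁻¹ x)))
    = M.U g ((S : E →L[ℂ] E) (M.U g⁻¹ (M.U g ((T : E →L[ℂ] E) (M.U g⁻¹ x)))))
  rw [← M.U_mul g⁻¹ g, M.U_idem_comm (inv_mul_idem g), ← M.U_mul (g⁻¹ * g), inv_mul_inv]

variable [CompleteSpace E]

/-- The `⋆`-endomorphism `T ↦ U_g T U_{g⁻¹}` of `𝓛(E)`. -/
noncomputable def conjHom (g : G) : adjointable B E →⋆ₙₐ[ℂ] adjointable B E where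
  toFun := M.conjOp g
  map_smul' c T := adjointable_ext fun x => by
    change M.U g (c • (T : E →L[ℂ] E) (M.U g⁻¹ x)) = c • M.U g ((T : E →L[ℂ] E) (M.U g⁻¹ x))
    rw [map_smul]
  map_zero' := adjointable_ext fun x => map_zero (M.U g)
  map_add' S T := adjointable_ext fun x => map_add (M.U g) _ _
  map_mul' := M.conjOp_mul g
  map_star' T := (star_eq_of _ _ fun x y => by
    rw [conjOp_apply, conjOp_apply, M.inner_U_left, M.inner_U_right g x, inner_star]).symm

theorem conjHom_apply (g : G) (T : adjointable B E) (x : E) :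
    (M.conjHom g T : E →L[ℂ] E) x = M.U g ((T : E →L[ℂ] E) (M.U g⁻¹ x)) := rfl

/-- The `G`-algebra `𝓛(E)`. -/
noncomputable def actionAdjointable : GAction G (adjointable B E) where
  act := M.conjHom
  act_mul g h T := adjointable_ext fun x => by
    rw [conjHom_apply, conjHom_apply, conjHom_apply, mul_inv_rev', M.U_mul, M.U_mul]
  act_one e he T := adjointable_ext fun x => by
    rw [conjHom_apply, M.U_one e he, inv_idem (he e).1, M.U_one e he]
  act_zero z hz T := adjointable_ext fun x => by
    rw [conjHom_apply, M.U_zero z hz]; rfl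
  compat g S T := adjointable_ext fun x => by
    have he := mul_inv_idem g
    set e := g * g⁻¹
    change (M.conjHom e S : E →L[ℂ] E) ((T : E →L[ℂ] E) x)
      = (S : E →L[ℂ] E) ((M.conjHom e T : E →L[ℂ] E) x)
    rw [conjHom_apply, conjHom_apply, inv_idem he, M.U_idem_comm he, ← M.U_mul, he,
      M.U_idem_comm he T (M.U e x), ← M.U_mul, he, M.U_idem_comm he]

theorem conjHom_theta (g : G) (x y : E) :
    M.conjHom g (theta x y : adjointable B E) = theta (M.U g x) (M.U g y) :=
  adjointable_ext fun z => by
    rw [conjHom_apply]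
    change M.U g (inner B y (M.U g⁻¹ z) • x) = inner B (M.U g y) z • M.U g x
    rw [M.U_smul, M.inner_U_left]

theorem conjHom_mem (g : G) {T : adjointable B E} (hT : T ∈ compacts B E) :
    M.conjHom g T ∈ compacts B E := by
  have h : compacts B E ≤ (compacts B E).comap (M.conjHom g) := by
    refine NonUnitalStarSubalgebra.topologicalClosure_minimal _
      (NonUnitalStarAlgebra.adjoin_le ?_) ?_
    · rintro _ ⟨x, y, rfl⟩
      change M.conjHom g _ ∈ compacts B E
      rw [conjHom_theta]
      exact theta_mem _ _
    · have hc : Continuous (M.conjHom g) :=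
        AddMonoidHomClass.continuous_of_bound (M.conjHom g) 1 fun T => by
          rw [one_mul]; exact NonUnitalStarAlgHom.norm_apply_le _ _
      exact IsClosed.preimage hc
        (NonUnitalStarSubalgebra.isClosed_topologicalClosure _)
  exact h hT

/-- The `G`-algebra `𝓚(E)`, with action `T ↦ U_g T U_{g⁻¹}`. -/
noncomputable def actionCompacts : GAction G (Compacts B E) where
  act g :=
    { toFun := fun T => ⟨M.conjHom g T.val, M.conjHom_mem g T.2⟩
      map_smul' := fun c T => Compacts.ext (map_smul (M.conjHom g) c T.val)
      map_zero' := Compacts.ext (map_zero (M.conjHom g))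
      map_add' := fun S T => Compacts.ext (map_add (M.conjHom g) S.val T.val)
      map_mul' := fun S T => Compacts.ext (map_mul (M.conjHom g) S.val T.val)
      map_star' := fun T => Compacts.ext (map_star (M.conjHom g) T.val) }
  act_mul g h T := Compacts.ext (M.actionAdjointable.act_mul g h T.val)
  act_one e he T := Compacts.ext (M.actionAdjointable.act_one e he T.val)
  act_zero z hz T := Compacts.ext (M.actionAdjointable.act_zero z hz T.val)
  compat g S T := Compacts.ext (M.actionAdjointable.compat g S.val T.val)

theorem actionCompacts_val (g : G) (T : Compacts B E) :
    (M.actionCompacts.act g T).val = M.conjHom g T.val := rfl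

end GHilbertModule

end GHilbert

/-! ### The space `X` and the `G`-algebra `C₀(X)` -/

section Spectrum

open scoped ZeroAtInfty

/-- A continuous function that vanishes off a compact set, as an element of `C₀`. -/
noncomputable def c0OfCompact {X : Type*} [TopologicalSpace X] (f : X → ℂ) (hf : Continuous f)
    (K : Set X) (hK : IsCompact K) (h : ∀ x, x ∉ K → f x = 0) : C₀(X, ℂ) where
  toFun := f
  continuous_toFun := hf
  zero_at_infty' := by
    refine Filter.Tendsto.congr' ?_ tendsto_const_nhds
    filter_upwards [hK.compl_mem_cocompact] with x hx
    exact (h x hx).symm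

section Order

variable {X : Type*} [TopologicalSpace X]

noncomputable instance : PartialOrder C₀(X, ℂ) := CStarAlgebra.spectralOrder _

instance : StarOrderedRing C₀(X, ℂ) := CStarAlgebra.spectralOrderedRing _

/-- The order of `C₀(X)` is the pointwise one. -/
theorem c0_nonneg {f : C₀(X, ℂ)} (h : ∀ x, f x = ((f x).re : ℂ) ∧ 0 ≤ (f x).re) : 0 ≤ f := by
  let s : C₀(X, ℂ) :=
    { toFun := fun x => (Real.sqrt (f x).re : ℂ)
      continuous_toFun := Complex.continuous_ofReal.comp
        (Real.continuous_sqrt.comp (Complex.continuous_re.comp (map_continuous f)))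
      zero_at_infty' := by
        have h1 := ((Complex.continuous_ofReal.comp
          (Real.continuous_sqrt.comp Complex.continuous_re)).tendsto 0).comp (zero_at_infty f)
        simp only [Function.comp_apply, Complex.zero_re, Real.sqrt_zero, Complex.ofReal_zero] at h1
        exact h1 }
  have hs : f = star s * s := by
    ext x
    change f x = star (Real.sqrt (f x).re : ℂ) * (Real.sqrt (f x).re : ℂ)
    rw [Complex.star_def, Complex.conj_ofReal, ← Complex.ofReal_mul, Real.mul_self_sqrt (h x).2]
    exact (h x).1
  rw [hs]
  exact star_mul_self_nonneg s

end Order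

variable (G : Type*) [InverseSemigroup G]

/-- The semilattice `E` of idempotents of `G`. -/
@[ext] structure Idem where
  val : G
  idem : val * val = val

variable {G}

namespace Idem

theorem mul_idem {e f : G} (he : e * e = e) (hf : f * f = f) : e * f * (e * f) = e * f := by
  calc e * f * (e * f) = e * (f * e) * f := by simp only [mul_assoc]
    _ = e * (e * f) * f := by rw [idem_comm f e hf he]
    _ = (e * e) * (f * f) := by simp only [mul_assoc]
    _ = e * f := by rw [he, hf]

instance : Mul (Idem G) := ⟨fun e f => ⟨e.val * f.val, mul_idem e.idem f.idem⟩⟩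

theorem coe_mul (e f : Idem G) : (e * f).1 = e.val * f.val := rfl

theorem conj_mul_aux (g : G) (e f : Idem G) :
    g * e.val * g⁻¹ * (g * f.val * g⁻¹) = g * (e.val * f.val) * g⁻¹ := by
  calc g * e.val * g⁻¹ * (g * f.val * g⁻¹) = g * (e.val * (g⁻¹ * g)) * f.val * g⁻¹ := by
        simp only [mul_assoc]
    _ = g * ((g⁻¹ * g) * e.val) * f.val * g⁻¹ := by rw [idem_comm _ _ e.idem (inv_mul_idem g)]
    _ = (g * g⁻¹ * g) * (e.val * f.val) * g⁻¹ := by simp only [mul_assoc]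
    _ = _ := by rw [mul_inv_mul]

/-- The idempotent `g e g⁻¹`. -/
def conj (g : G) (e : Idem G) : Idem G :=
  ⟨g * e.val * g⁻¹, by rw [conj_mul_aux, e.idem]⟩

theorem conj_mul (g : G) (e f : Idem G) : conj g (e * f) = conj g e * conj g f :=
  Idem.ext (conj_mul_aux g e f).symm

theorem conj_conj (g h : G) (e : Idem G) : conj (g * h) e = conj g (conj h e) :=
  Idem.ext (by simp only [conj, mul_inv_rev', mul_assoc])

/-- The range idempotent `g g⁻¹`. -/
def ran (g : G) : Idem G := ⟨g * g⁻¹, mul_inv_idem g⟩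

theorem ran_mul (g h : G) : ran (g * h) = conj g (ran h) :=
  Idem.ext (by simp only [ran, conj, mul_inv_rev', mul_assoc])

theorem conj_mul_ran (g : G) (e : Idem G) : conj g e * ran g = conj g e :=
  Idem.ext (by
    change g * e.val * g⁻¹ * (g * g⁻¹) = g * e.val * g⁻¹
    rw [mul_assoc (g * e.val), ← mul_assoc g⁻¹, inv_mul_inv])

theorem ran_idem (e : Idem G) : ran e.val = e :=
  Idem.ext (by change e.val * e.val⁻¹ = e.val; rw [inv_idem e.idem, e.idem])

theorem conj_idem (e f : Idem G) : conj e.val f = e * f :=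
  Idem.ext (by
    change e.val * f.val * e.val⁻¹ = e.val * f.val
    rw [inv_idem e.idem, mul_assoc, idem_comm f.val e.val f.idem e.idem, ← mul_assoc, e.idem])

end Idem

variable (G) in
/-- The Gelfand spectrum `X` of the commutative C⋆-algebra generated by the semilattice `E` of
commuting projections: the nonzero multiplicative maps `E → {0, 1}` (which send the zero element
of `G`, if there is one, to `0`), with the topology of pointwise convergence. -/
@[ext] structure Spec where
  toFun : Idem G → Bool
  map_mul : ∀ e f, toFun (e * f) = (toFun e && toFun f)
  exists_true : ∃ e, toFun e = true
  map_zero : ∀ z : Idem G, IsZero z.val → toFun z = false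

namespace Spec

instance : CoeFun (Spec G) (fun _ => Idem G → Bool) := ⟨Spec.toFun⟩

instance : TopologicalSpace (Spec G) := TopologicalSpace.induced Spec.toFun inferInstance

theorem isInducing : Topology.IsInducing (Spec.toFun : (Spec G) → Idem G → Bool) := ⟨rfl⟩

theorem continuous_eval (e : Idem G) : Continuous (fun χ : Spec G => χ e) :=
  (continuous_apply e).comp isInducing.continuous

/-- The carrier of the projection `1_e`. -/
def D (e : Idem G) : Set (Spec G) := {χ | χ e = true}

theorem isClopen_D (e : Idem G) : IsClopen (D e) :=
  (isClopen_discrete {true}).preimage (continuous_eval e)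

theorem isCompact_D (e : Idem G) : IsCompact (D e) := by
  have hcl : IsClosed {χ : Idem G → Bool | (∀ e f, χ (e * f) = (χ e && χ f)) ∧ χ e = true ∧
      ∀ z : Idem G, IsZero z.val → χ z = false} := by
    simp only [Set.ofPred_and, Set.ofPred_forall]
    refine IsClosed.inter (isClosed_iInter fun e => isClosed_iInter fun f => ?_)
      (IsClosed.inter ?_ (isClosed_iInter fun z => isClosed_iInter fun _ => ?_))
    · exact isClosed_eq (continuous_apply _) (Continuous.comp (g := fun p : Bool × Bool => (p.1 && p.2))
        (f := fun x : Idem G → Bool => (x e, x f)) continuous_of_discreteTopology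
        ((continuous_apply e).prodMk (continuous_apply f)))
    · exact isClosed_eq (continuous_apply _) continuous_const
    · exact isClosed_eq (continuous_apply _) continuous_const
  rw [isInducing.isCompact_iff]
  convert! hcl.isCompact using 1
  ext χ
  constructor
  · rintro ⟨χ', h, rfl⟩
    exact ⟨χ'.map_mul, h, χ'.map_zero⟩
  · rintro ⟨h1, h2, h3⟩
    exact ⟨⟨χ, h1, ⟨e, h2⟩, h3⟩, h2, rfl⟩

open Classical in
/-- The projection `1_e ∈ C₀(X)`. -/
noncomputable def ind (e : Idem G) : C₀(Spec G, ℂ) :=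
  c0OfCompact (fun χ => if χ e = true then 1 else 0)
    ((continuous_of_discreteTopology (f := fun b : Bool => if b = true then (1 : ℂ) else 0)).comp
      (continuous_eval e))
    (D e) (isCompact_D e) fun _ hχ => if_neg hχ

theorem zero_conj {g : G} {z : Idem G} (hz : IsZero z.val) : IsZero (Idem.conj g z).1 := by
  have h : (Idem.conj g z).1 = z.val := by
    change g * z.val * g⁻¹ = z.val
    rw [(hz.2 g).2, (hz.2 _).1]
  rwa [h]

/-- The character `e ↦ χ(g e g⁻¹)`, defined for `χ` in the carrier of `g g⁻¹`. -/
def pull (g : G) (χ : Spec G) (h : χ (Idem.ran g) = true) : Spec G where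
  toFun e := χ (Idem.conj g e)
  map_mul e f := by rw [Idem.conj_mul, map_mul]
  exists_true := ⟨Idem.ran g⁻¹, by
    have : Idem.conj g (Idem.ran g⁻¹) = Idem.ran g := Idem.ext (by
      change g * (g⁻¹ * g⁻¹⁻¹) * g⁻¹ = g * g⁻¹
      rw [inv_inv', ← mul_assoc, mul_inv_mul])
    rw [this, h]⟩
  map_zero z hz := χ.map_zero _ (zero_conj hz)

theorem pull_apply (g : G) (χ : Spec G) (h : χ (Idem.ran g) = true) (e : Idem G) :
    pull g χ h e = χ (Idem.conj g e) := rfl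

open Classical in
/-- The function `g(f)`: `g(f)(χ) = f(χ(g · g⁻¹))` on the carrier of `g g⁻¹`, and `0` elsewhere. -/
noncomputable def transFun (g : G) (f : C₀(Spec G, ℂ)) (χ : Spec G) : ℂ :=
  if h : χ (Idem.ran g) = true then f (pull g χ h) else 0

theorem transFun_pos {g : G} {f : C₀(Spec G, ℂ)} {χ : Spec G} (h : χ (Idem.ran g) = true) :
    transFun g f χ = f (pull g χ h) := dif_pos h

theorem transFun_neg {g : G} {f : C₀(Spec G, ℂ)} {χ : Spec G} (h : ¬ χ (Idem.ran g) = true) :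
    transFun g f χ = 0 := dif_neg h

theorem continuous_transFun (g : G) (f : C₀(Spec G, ℂ)) : Continuous (transFun g f) := by
  have h1 : ContinuousOn (transFun g f) (D (Idem.ran g)) := by
    rw [continuousOn_iff_continuous_domRestrict]
    have : (D (Idem.ran g)).domRestrict (transFun g f)
        = fun χ : D (Idem.ran g) => f (pull g χ.1 χ.2) := funext fun χ => transFun_pos χ.2
    rw [this]
    refine (map_continuous f).comp (isInducing.continuous_iff.2 (continuous_pi fun e => ?_))
    exact (continuous_eval (Idem.conj g e)).comp continuous_subtype_val
  have h2 : ContinuousOn (transFun g f) (D (Idem.ran g))ᶜ :=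
    (continuousOn_const (c := (0 : ℂ))).congr fun χ hχ => transFun_neg hχ
  rw [← continuousOn_univ, ← Set.union_compl_self (D (Idem.ran g))]
  exact h1.union_of_isOpen h2 (isClopen_D _).isOpen (isClopen_D _).compl.isOpen

/-- `g(f)` as an element of `C₀(X)`. -/
noncomputable def trans (g : G) (f : C₀(Spec G, ℂ)) : C₀(Spec G, ℂ) :=
  c0OfCompact (transFun g f) (continuous_transFun g f) (D (Idem.ran g)) (isCompact_D _)
    fun _ h => transFun_neg h

theorem trans_pos {g : G} {f : C₀(Spec G, ℂ)} {χ : Spec G} (h : χ (Idem.ran g) = true) :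
    trans g f χ = f (pull g χ h) := dif_pos h

theorem trans_neg {g : G} {f : C₀(Spec G, ℂ)} {χ : Spec G} (h : ¬ χ (Idem.ran g) = true) :
    trans g f χ = 0 := dif_neg h

/-- The action is the one determined by `g(1_e) = 1_{g e g⁻¹}`. -/
theorem trans_ind (g : G) (e : Idem G) : trans g (ind e) = ind (Idem.conj g e) := by
  ext χ
  by_cases h : χ (Idem.ran g) = true
  · rw [trans_pos h]; rfl
  · rw [trans_neg h]
    have : ¬ χ (Idem.conj g e) = true := fun h' => h (by
      have := map_mul χ (Idem.conj g e) (Idem.ran g)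
      rw [Idem.conj_mul_ran, h'] at this
      simpa using this.symm)
    exact (if_neg this).symm

theorem trans_idem_pos {e : Idem G} {f : C₀(Spec G, ℂ)} {χ : Spec G} (h : χ e = true) :
    trans e.val f χ = f χ := by
  have h' : χ (Idem.ran e.val) = true := by rwa [Idem.ran_idem]
  rw [trans_pos h']
  congr 1
  refine Spec.ext (funext fun e' => ?_)
  change χ (Idem.conj e.val e') = χ e'
  rw [Idem.conj_idem, map_mul, h, Bool.true_and]

theorem trans_idem_neg {e : Idem G} {f : C₀(Spec G, ℂ)} {χ : Spec G} (h : ¬ χ e = true) :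
    trans e.val f χ = 0 := trans_neg (by rwa [Idem.ran_idem])

/-- The `G`-algebra `C₀(X)`. -/
noncomputable def c0Action : GAction G C₀(Spec G, ℂ) where
  act g :=
    { toFun := trans g
      map_smul' := fun c f => by
        ext χ
        by_cases h : χ (Idem.ran g) = true
        · simp [trans_pos h]
        · simp [trans_neg h]
      map_zero' := by
        ext χ
        by_cases h : χ (Idem.ran g) = true
        · simp [trans_pos h]
        · simp [trans_neg h]
      map_add' := fun f f' => by
        ext χ
        by_cases h : χ (Idem.ran g) = true
        · simp [trans_pos h]
        · simp [trans_neg h]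
      map_mul' := fun f f' => by
        ext χ
        by_cases h : χ (Idem.ran g) = true
        · simp [trans_pos h]
        · simp [trans_neg h]
      map_star' := fun f => by
        ext χ
        by_cases h : χ (Idem.ran g) = true
        · simp [trans_pos h]
        · simp [trans_neg h] }
  act_mul g h f := by
    ext χ
    change trans (g * h) f χ = trans g (trans h f) χ
    by_cases h1 : χ (Idem.ran g) = true
    · rw [trans_pos h1]
      by_cases h2 : pull g χ h1 (Idem.ran h) = true
      · have h3 : χ (Idem.ran (g * h)) = true := by rwa [Idem.ran_mul]
        rw [trans_pos h2, trans_pos h3]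
        congr 1
        exact Spec.ext (funext fun e => by
          change χ (Idem.conj (g * h) e) = χ (Idem.conj g (Idem.conj h e))
          rw [Idem.conj_conj])
      · rw [trans_neg h2, trans_neg (by rwa [Idem.ran_mul])]
    · rw [trans_neg h1, trans_neg]
      intro h3
      rw [Idem.ran_mul] at h3
      have := map_mul χ (Idem.conj g (Idem.ran h)) (Idem.ran g)
      rw [Idem.conj_mul_ran, h3] at this
      exact h1 (by simpa using this.symm)
  act_one e he f := by
    ext χ
    obtain ⟨d, hd⟩ := χ.exists_true
    have h1 : χ (⟨e, (he e).1⟩ : Idem G) = true := by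
      have h2 : (⟨e, (he e).1⟩ : Idem G) * d = d := Idem.ext (he d.1).1
      have := map_mul χ ⟨e, (he e).1⟩ d
      rw [h2, hd] at this
      simpa using this.symm
    exact trans_idem_pos (e := ⟨e, (he e).1⟩) h1
  act_zero z hz f := by
    ext χ
    refine trans_idem_neg (e := ⟨z, hz.idem⟩) ?_
    rw [χ.map_zero ⟨z, hz.idem⟩ hz]
    exact Bool.false_ne_true
  compat g f f' := by
    ext χ
    change trans (Idem.ran g).1 f χ * f' χ = f χ * trans (Idem.ran g).1 f' χ
    by_cases h : χ (Idem.ran g) = true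
    · rw [trans_idem_pos h, trans_idem_pos h]
    · rw [trans_idem_neg h, trans_idem_neg h, zero_mul, mul_zero]

theorem c0Action_apply (g : G) (f : C₀(Spec G, ℂ)) : c0Action.act g f = trans g f := rfl

end Spec

open Classical in
/-- The function `⋁ {1_e | e ∈ E, e ≤ g}` on `X`. -/
noncomputable def supFun (g : G) (χ : Spec G) : ℂ :=
  if ∃ e : Idem G, NatLE e.val g ∧ χ e = true then 1 else 0

variable (G) in
/-- `G` is `E`-continuous: the functions `⋁ {1_e | e ∈ E, e ≤ g}` lie in `C₀(X)`. -/
class IsEContinuous : Prop where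
  exists_c0 : ∀ g : G, ∃ f : C₀(Spec G, ℂ), ∀ χ, f χ = supFun g χ

end Spectrum

/-! ### The Hilbert `C₀(X)`-module of a positive definite kernel -/

section Kernel

open scoped ZeroAtInfty BoundedContinuousFunction
open UniformSpace

/-- A positive definite kernel on the set `I` with values in the bounded continuous functions
on `X`. -/
structure PosKernel (X I : Type*) [TopologicalSpace X] where
  k : I → I → X →ᵇ ℂ
  herm : ∀ i j χ, k j i χ = star (k i j χ)
  pos : ∀ χ (c : I →₀ ℂ), 0 ≤ (c.sum fun i a => c.sum fun j b => star a * b * k i j χ).re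

variable {X I : Type*} [TopologicalSpace X]

/-- The product of a bounded continuous function and an element of `C₀(X)`. -/
noncomputable def kmul (k : X →ᵇ ℂ) (f : C₀(X, ℂ)) : C₀(X, ℂ) where
  toFun χ := k χ * f χ
  continuous_toFun := k.continuous.mul (map_continuous f)
  zero_at_infty' := by
    refine squeeze_zero_norm (a := fun χ => ‖k‖ * ‖f χ‖) (fun χ => ?_) ?_
    · rw [norm_mul]
      exact mul_le_mul_of_nonneg_right (k.norm_coe_le_norm χ) (norm_nonneg _)
    · simpa using (zero_at_infty f).norm.const_mul ‖k‖

theorem kmul_apply (k : X →ᵇ ℂ) (f : C₀(X, ℂ)) (χ : X) : kmul k f χ = k χ * f χ := rfl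

theorem c0_norm_le {f : C₀(X, ℂ)} {c : ℝ} (hc : 0 ≤ c) (h : ∀ χ, ‖f χ‖ ≤ c) : ‖f‖ ≤ c :=
  (BoundedContinuousFunction.norm_le hc).2 h

theorem c0_apply_le (f : C₀(X, ℂ)) (χ : X) : ‖f χ‖ ≤ ‖f‖ :=
  f.toBCF.norm_coe_le_norm χ

namespace PosKernel

variable (K : PosKernel X I)

/-- The sesquilinear form of the kernel at the point `χ`. -/
noncomputable def form (χ : X) (c d : I →₀ ℂ) : ℂ :=
  c.sum fun i a => d.sum fun j b => star a * b * K.k i j χ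

theorem form_add_left (χ : X) (c c' d : I →₀ ℂ) :
    K.form χ (c + c') d = K.form χ c d + K.form χ c' d :=
  Finsupp.sum_add_index' (by simp) fun i a b => by
    rw [← Finsupp.sum_add]
    exact Finsupp.sum_congr fun j _ => by rw [star_add]; ring

theorem form_star (χ : X) (c d : I →₀ ℂ) : star (K.form χ c d) = K.form χ d c := by
  simp only [form, Finsupp.sum, star_sum]
  rw [Finset.sum_comm]
  refine Finset.sum_congr rfl fun j _ => Finset.sum_congr rfl fun i _ => ?_
  rw [K.herm i j]
  simp only [star_mul', star_star]
  ring

theorem form_smul_left (χ : X) (r : ℂ) (c d : I →₀ ℂ) :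
    K.form χ (r • c) d = star r * K.form χ c d := by
  rw [form, Finsupp.sum_smul_index' (by simp), form, Finsupp.mul_sum]
  refine Finsupp.sum_congr fun i _ => ?_
  rw [Finsupp.mul_sum]
  exact Finsupp.sum_congr fun j _ => by rw [smul_eq_mul, star_mul']; ring

/-- The positive semidefinite form at `χ` as an inner product. -/
noncomputable abbrev formCore (χ : X) : PreInnerProductSpace.Core ℂ (I →₀ ℂ) where
  inner := K.form χ
  conj_inner_symm c d := K.form_star χ d c
  re_inner_nonneg := K.pos χ
  add_left := K.form_add_left χ
  smul_left c d r := K.form_smul_left χ r c d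

theorem form_cauchy (χ : X) (c d : I →₀ ℂ) :
    ‖K.form χ c d‖ * ‖K.form χ c d‖ ≤ (K.form χ c c).re * (K.form χ d d).re := by
  let := K.formCore χ
  have h := InnerProductSpace.Core.inner_mul_inner_self_le (𝕜 := ℂ) c d
  have h2 : ‖K.form χ d c‖ = ‖K.form χ c d‖ := by rw [← K.form_star χ c d, norm_star]
  change ‖K.form χ c d‖ * ‖K.form χ d c‖ ≤ (K.form χ c c).re * (K.form χ d d).re at h
  rwa [h2] at h

theorem form_self (χ : X) (c : I →₀ ℂ) : K.form χ c c = ((K.form χ c c).re : ℂ) :=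
  (Complex.conj_eq_iff_re.1 (K.form_star χ c c)).symm

/-- Finite formal sums `∑ φ_i f_i`, `i ∈ I`, `f_i ∈ C₀(X)`, to be equipped with the `C₀(X)`-valued
semi-inner product `⟨φ_i f, φ_j f'⟩ = f⋆ f' k(i, j)`. -/
def Pre (_K : PosKernel X I) : Type _ := I →₀ C₀(X, ℂ)

namespace Pre

variable {K}

noncomputable instance : AddCommGroup K.Pre := inferInstanceAs (AddCommGroup (I →₀ C₀(X, ℂ)))
noncomputable instance : Module ℂ K.Pre := inferInstanceAs (Module ℂ (I →₀ C₀(X, ℂ)))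

variable (K) in
/-- The element `φ_i f`. -/
noncomputable def single (i : I) (f : C₀(X, ℂ)) : K.Pre := Finsupp.single i f

theorem induction {P : K.Pre → Prop} (x : K.Pre) (h0 : P 0)
    (ha : ∀ x y, P x → P y → P (x + y)) (hs : ∀ i f, P (single K i f)) : P x :=
  Finsupp.induction_linear x h0 ha hs

/-- Evaluation of the coefficients at the point `χ`. -/
noncomputable def ev (χ : X) : K.Pre →ₗ[ℂ] (I →₀ ℂ) :=
  Finsupp.mapRange.linearMap
    { toFun := fun f : C₀(X, ℂ) => f χ, map_add' := fun _ _ => rfl, map_smul' := fun _ _ => rfl }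

theorem ev_single (χ : X) (i : I) (f : C₀(X, ℂ)) :
    ev χ (single K i f) = Finsupp.single i (f χ) :=
  Finsupp.mapRange_single (hf := rfl)

noncomputable instance : Inner C₀(X, ℂ) K.Pre :=
  ⟨fun x y => Finsupp.sum x fun i f => Finsupp.sum y fun j f' => kmul (K.k i j) (star f * f')⟩

theorem inner_apply_aux (x y : I →₀ C₀(X, ℂ)) (χ : X) :
    (x.sum fun i f => y.sum fun j f' => kmul (K.k i j) (star f * f')) χ
      = x.sum fun i f => y.sum fun j f' => star (f χ) * f' χ * K.k i j χ := by
  let E : C₀(X, ℂ) →+ ℂ :=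
    { toFun := fun f => f χ, map_zero' := rfl, map_add' := fun _ _ => rfl }
  refine (map_finsuppSum E x _).trans (Finsupp.sum_congr fun i _ => ?_)
  exact (map_finsuppSum E y _).trans (Finsupp.sum_congr fun j _ => mul_comm _ _)

theorem inner_apply (x y : K.Pre) (χ : X) :
    inner C₀(X, ℂ) x y χ = K.form χ (ev χ x) (ev χ y) := by
  refine (inner_apply_aux x y χ).trans (Eq.symm ?_)
  refine (Finsupp.sum_mapRange_index (f := fun f : C₀(X, ℂ) => f χ) (hf := rfl)
    (by simp)).trans ?_
  exact Finsupp.sum_congr fun i _ => Finsupp.sum_mapRange_index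
    (f := fun f : C₀(X, ℂ) => f χ) (hf := rfl) (by simp)

theorem inner_single (i j : I) (f f' : C₀(X, ℂ)) (χ : X) :
    inner C₀(X, ℂ) (single K i f) (single K j f') χ = star (f χ) * f' χ * K.k i j χ := by
  rw [inner_apply, ev_single, ev_single, form, Finsupp.sum_single_index (by simp),
    Finsupp.sum_single_index (by simp)]

theorem star_inner (x y : K.Pre) : star (inner C₀(X, ℂ) x y) = inner C₀(X, ℂ) y x := by
  ext χ
  change star (inner C₀(X, ℂ) x y χ) = _
  rw [inner_apply, inner_apply, form_star]

theorem inner_add_left (x y z : K.Pre) :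
    inner C₀(X, ℂ) (x + y) z = inner C₀(X, ℂ) x z + inner C₀(X, ℂ) y z := by
  ext χ
  change _ = inner C₀(X, ℂ) x z χ + inner C₀(X, ℂ) y z χ
  rw [inner_apply, inner_apply, inner_apply, map_add, form_add_left]

theorem inner_smul_left (r : ℂ) (x y : K.Pre) :
    inner C₀(X, ℂ) (r • x) y = star r • inner C₀(X, ℂ) x y := by
  ext χ
  change _ = star r * inner C₀(X, ℂ) x y χ
  rw [inner_apply, inner_apply, map_smul, form_smul_left]

theorem inner_add_right (x y z : K.Pre) :
    inner C₀(X, ℂ) x (y + z) = inner C₀(X, ℂ) x y + inner C₀(X, ℂ) x z := by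
  rw [← star_inner, inner_add_left, star_add, star_inner, star_inner]

theorem inner_smul_right (r : ℂ) (x y : K.Pre) :
    inner C₀(X, ℂ) x (r • y) = r • inner C₀(X, ℂ) x y := by
  rw [← star_inner, inner_smul_left, star_smul, star_inner, star_star]

theorem inner_self_nonneg (x : K.Pre) : 0 ≤ inner C₀(X, ℂ) x x :=
  c0_nonneg fun χ => by
    rw [inner_apply]
    exact ⟨K.form_self χ _, K.pos χ _⟩

noncomputable instance : Norm K.Pre := ⟨fun x => √‖inner C₀(X, ℂ) x x‖⟩

theorem norm_sq (x : K.Pre) : ‖x‖ ^ 2 = ‖inner C₀(X, ℂ) x x‖ := Real.sq_sqrt (norm_nonneg _)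

theorem norm_nonneg' (x : K.Pre) : 0 ≤ ‖x‖ := Real.sqrt_nonneg _

theorem norm_inner_le (x y : K.Pre) : ‖inner C₀(X, ℂ) x y‖ ≤ ‖x‖ * ‖y‖ := by
  refine c0_norm_le (mul_nonneg (norm_nonneg' x) (norm_nonneg' y)) fun χ => ?_
  have hre : ∀ z : K.Pre, (K.form χ (ev χ z) (ev χ z)).re ≤ ‖z‖ ^ 2 := fun z => by
    rw [norm_sq, ← inner_apply]
    exact (Complex.re_le_norm _).trans (c0_apply_le _ χ)
  refine (pow_le_pow_iff_left₀ (norm_nonneg _)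
    (mul_nonneg (norm_nonneg' x) (norm_nonneg' y)) two_ne_zero).1 ?_
  rw [inner_apply, sq, mul_pow]
  exact (K.form_cauchy χ _ _).trans
    (mul_le_mul (hre x) (hre y) (K.pos χ _) (by positivity))

theorem core : SeminormedSpace.Core ℂ K.Pre where
  norm_nonneg := norm_nonneg'
  norm_smul c x := by
    refine (pow_left_inj₀ (norm_nonneg' _) (mul_nonneg (norm_nonneg _) (norm_nonneg' _))
      two_ne_zero).1 ?_
    rw [norm_sq, inner_smul_left, inner_smul_right, norm_smul, norm_smul, mul_pow, norm_sq,
      norm_star]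
    ring
  norm_triangle x y := by
    refine (pow_le_pow_iff_left₀ (norm_nonneg' _)
      (add_nonneg (norm_nonneg' _) (norm_nonneg' _)) two_ne_zero).1 ?_
    rw [norm_sq, inner_add_left, inner_add_right, inner_add_right]
    calc _ ≤ ‖inner C₀(X, ℂ) x x‖ + ‖inner C₀(X, ℂ) x y‖
          + (‖inner C₀(X, ℂ) y x‖ + ‖inner C₀(X, ℂ) y y‖) :=
          (norm_add_le _ _).trans (add_le_add (norm_add_le _ _) (norm_add_le _ _))
      _ ≤ ‖x‖ * ‖x‖ + ‖x‖ * ‖y‖ + (‖y‖ * ‖x‖ + ‖y‖ * ‖y‖) := by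
          gcongr <;> exact norm_inner_le _ _
      _ = (‖x‖ + ‖y‖) ^ 2 := by ring

noncomputable instance : SeminormedAddCommGroup K.Pre := SeminormedAddCommGroup.ofCore core

noncomputable instance : NormedSpace ℂ K.Pre where
  norm_smul_le c x := (core.norm_smul c x).le

/-- The inner product as a continuous sesquilinear map. -/
noncomputable def innerL : K.Pre →L⋆[ℂ] K.Pre →L[ℂ] C₀(X, ℂ) :=
  LinearMap.mkContinuous₂
    (LinearMap.mk₂'ₛₗ (starRingEnd ℂ) (RingHom.id ℂ) (fun x y : K.Pre => inner C₀(X, ℂ) x y)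
      inner_add_left inner_smul_left inner_add_right inner_smul_right) 1
    fun x y => by rw [one_mul]; exact norm_inner_le x y

theorem continuous_inner : Continuous fun p : K.Pre × K.Pre => inner C₀(X, ℂ) p.1 p.2 :=
  ((innerL (K := K)).continuous.comp continuous_fst).clm_apply continuous_snd

/-- The module structure `b (∑ φ_i f_i) = ∑ φ_i (b f_i)`. -/
noncomputable instance : SMul C₀(X, ℂ) K.Pre :=
  ⟨fun b x => Finsupp.mapRange (fun f => b * f) (mul_zero b) x⟩

theorem smul_single (b : C₀(X, ℂ)) (i : I) (f : C₀(X, ℂ)) :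
    b • single K i f = single K i (b * f) :=
  Finsupp.mapRange_single (hf := mul_zero b)

theorem ev_bsmul (χ : X) (b : C₀(X, ℂ)) (x : K.Pre) : ev χ (b • x) = b χ • ev χ x := by
  ext i; rfl

theorem smul_add' (b : C₀(X, ℂ)) (x y : K.Pre) : b • (x + y) = b • x + b • y :=
  Finsupp.ext fun _ => mul_add b _ _

theorem smul_comm' (b : C₀(X, ℂ)) (r : ℂ) (x : K.Pre) : b • (r • x) = r • (b • x) :=
  Finsupp.ext fun _ => mul_smul_comm r b _

theorem inner_bsmul_right (b : C₀(X, ℂ)) (x y : K.Pre) :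
    inner C₀(X, ℂ) x (b • y) = b * inner C₀(X, ℂ) x y := by
  ext χ
  change _ = b χ * inner C₀(X, ℂ) x y χ
  rw [inner_apply, inner_apply, ev_bsmul, ← form_star, form_smul_left, star_mul', star_star,
    form_star]

theorem norm_bsmul_le (b : C₀(X, ℂ)) (x : K.Pre) : ‖b • x‖ ≤ ‖b‖ * ‖x‖ := by
  refine (pow_le_pow_iff_left₀ (norm_nonneg' _)
    (mul_nonneg (norm_nonneg _) (norm_nonneg' _)) two_ne_zero).1 ?_
  rw [norm_sq, inner_bsmul_right, ← star_inner, inner_bsmul_right, mul_pow, norm_sq]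
  calc _ ≤ ‖b‖ * (‖b‖ * ‖inner C₀(X, ℂ) x x‖) :=
        (norm_mul_le _ _).trans (by
          gcongr
          exact (norm_star (b * inner C₀(X, ℂ) x x)).le.trans (norm_mul_le _ _))
    _ = _ := by ring

/-- Multiplication by `b` as a continuous linear map. -/
noncomputable def smulL (b : C₀(X, ℂ)) : K.Pre →L[ℂ] K.Pre :=
  LinearMap.mkContinuous
    { toFun := fun x => b • x, map_add' := smul_add' b, map_smul' := fun r x => smul_comm' b r x }
    ‖b‖ (norm_bsmul_le b)

instance : UniformContinuousConstSMul C₀(X, ℂ) K.Pre :=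
  ⟨fun b => (smulL (K := K) b).uniformContinuous⟩

end Pre

/-- The Hilbert `C₀(X)`-module of a positive definite kernel: the separated completion of the finite
sums `∑ φ_i f_i`. -/
abbrev Module (K : PosKernel X I) : Type _ := Completion K.Pre

namespace Module

variable {K}

theorem inner_coe (x y : K.Pre) :
    inner C₀(X, ℂ) (x : K.Module) (y : K.Module) = inner C₀(X, ℂ) x y :=
  (Completion.isDenseInducing_coe.prodMap Completion.isDenseInducing_coe).extend_eq
    (f := Function.uncurry (inner C₀(X, ℂ) : K.Pre → K.Pre → C₀(X, ℂ)))
    Pre.continuous_inner (x, y)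

theorem continuous_inner :
    Continuous fun p : K.Module × K.Module => inner C₀(X, ℂ) p.1 p.2 := by
  let m : K.Pre →+ K.Pre →+ C₀(X, ℂ) :=
    { toFun := fun x => ((Pre.innerL x : K.Pre →L[ℂ] C₀(X, ℂ)) : K.Pre →+ C₀(X, ℂ))
      map_zero' := by ext x; simp
      map_add' := fun x y => by ext z; simp }
  have h : Continuous fun p : K.Pre × K.Pre => m p.1 p.2 := Pre.continuous_inner
  exact ((Completion.isDenseInducing_toCompl K.Pre).extend_Z_bilin
    (Completion.isDenseInducing_toCompl K.Pre) h :)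

theorem continuous_inner' {Y : Type*} [TopologicalSpace Y] {f g : Y → K.Module}
    (hf : Continuous f) (hg : Continuous g) : Continuous fun y => inner C₀(X, ℂ) (f y) (g y) :=
  continuous_inner.comp (hf.prodMk hg)

theorem continuous_bsmul (b : C₀(X, ℂ)) : Continuous fun x : K.Module => b • x :=
  (uniformContinuous_const_smul b).continuous

theorem norm_sq (x : K.Module) : ‖x‖ ^ 2 = ‖inner C₀(X, ℂ) x x‖ :=
  Completion.induction_on x
    (isClosed_eq (by fun_prop) (continuous_inner' continuous_id continuous_id).norm) fun x => by
      rw [Completion.norm_coe, inner_coe, Pre.norm_sq]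

noncomputable instance : CStarModule C₀(X, ℂ) K.Module where
  inner_add_right {x y z} := Completion.induction_on₃ x y z
    (isClosed_eq (continuous_inner' (by fun_prop) (by fun_prop))
      ((continuous_inner' (by fun_prop) (by fun_prop)).add
        (continuous_inner' (by fun_prop) (by fun_prop)))) fun x y z => by
      rw [← Completion.coe_add, inner_coe, inner_coe, inner_coe, Pre.inner_add_right]
  inner_self_nonneg {x} := Completion.induction_on x
    (CStarAlgebra.isClosed_nonneg.preimage (continuous_inner' continuous_id continuous_id))
    fun x => by rw [inner_coe]; exact Pre.inner_self_nonneg x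
  inner_self {x} := by
    rw [← norm_eq_zero, ← norm_sq, sq_eq_zero_iff, norm_eq_zero]
  inner_op_smul_right {b x y} := Completion.induction_on₂ x y
    (isClosed_eq (continuous_inner' continuous_fst ((continuous_bsmul b).comp continuous_snd))
      (continuous_const.mul continuous_inner)) fun x y => by
      rw [← Completion.coe_smul, inner_coe, inner_coe, Pre.inner_bsmul_right]
  inner_smul_right_complex {r x y} := Completion.induction_on₂ x y
    (isClosed_eq (continuous_inner' continuous_fst
      ((uniformContinuous_const_smul r).continuous.comp continuous_snd))
      (continuous_inner.const_smul r)) fun x y => by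
      rw [← Completion.coe_smul, inner_coe, inner_coe, Pre.inner_smul_right]
  star_inner x y := Completion.induction_on₂ x y
    (isClosed_eq continuous_inner.star (continuous_inner' continuous_snd continuous_fst))
    fun x y => by rw [inner_coe, inner_coe, Pre.star_inner]
  norm_eq_sqrt_norm_inner_self x := by
    rw [← norm_sq, Real.sqrt_sq (norm_nonneg _)]

theorem ext_inner_pre {x y : K.Module}
    (h : ∀ z : K.Pre, inner C₀(X, ℂ) (z : K.Module) x = inner C₀(X, ℂ) (z : K.Module) y) :
    x = y :=
  HilbertModule.ext_inner C₀(X, ℂ) fun z => Completion.induction_on z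
    (isClosed_eq (continuous_inner' continuous_id continuous_const)
      (continuous_inner' continuous_id continuous_const)) h

end Module

end PosKernel

end Kernel

/-! ### The `G`-Hilbert modules `C₀(X)^∞` and `L²(G)`, and the `G`-algebra `𝓚_G` -/

section KG

open scoped ZeroAtInfty BoundedContinuousFunction
open UniformSpace

/-- The kernel `1_R` of a partial equivalence relation `R` is positive definite. -/
theorem relation_pos {I : Type*} (R : I → I → Prop) (hs : ∀ i j, R i j → R j i)
    (ht : ∀ i j l, R i j → R j l → R i l) (k : I → I → ℂ) (hk1 : ∀ i j, R i j → k i j = 1)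
    (hk0 : ∀ i j, ¬ R i j → k i j = 0) (c : I →₀ ℂ) :
    0 ≤ (c.sum fun i a => c.sum fun j b => star a * b * k i j).re := by
  classical
  let v : I → Set I →₀ ℂ := fun i => if R i i then Finsupp.single {j | R i j} 1 else 0
  let T : (I →₀ ℂ) →ₗ[ℂ] (Set I →₀ ℂ) := Finsupp.linearCombination ℂ v
  have hv : ∀ i j, R i i → v j {l | R i l} = k i j := fun i j hi => by
    by_cases hij : R i j
    · have hj : R j j := ht j i j (hs i j hij) hij
      have : {l | R j l} = {l | R i l} := Set.ext fun l =>
        ⟨fun h => ht i j l hij h, fun h => ht j i l (hs i j hij) h⟩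
      simp only [v, if_pos hj, this, Finsupp.single_eq_same, hk1 i j hij]
    · rw [hk0 i j hij]
      by_cases hj : R j j
      · simp only [v, if_pos hj]
        refine Finsupp.single_eq_of_ne fun h => hij ?_
        have : j ∈ {l | R j l} := hj
        rw [← h] at this
        exact this
      · simp only [v, if_neg hj, Finsupp.zero_apply]
  have key : ∀ c d : I →₀ ℂ, (c.sum fun i a => d.sum fun j b => star a * b * k i j)
      = (T c).sum fun s a => star a * T d s := fun c d => by
    induction c using Finsupp.induction_linear with
    | zero => simp
    | add c c' h h' =>
      rw [map_add, Finsupp.sum_add_index', Finsupp.sum_add_index', h, h']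
      · simp
      · intro s a b; rw [star_add, add_mul]
      · simp
      · intro i a b
        rw [← Finsupp.sum_add]
        exact Finsupp.sum_congr fun j _ => by rw [star_add]; ring
    | single i a =>
      rw [Finsupp.sum_single_index (by simp)]
      have hT : T (Finsupp.single i a) = a • v i := by simp [T]
      rw [hT]
      by_cases hi : R i i
      · have h1 : a • v i = Finsupp.single {j | R i j} a := by simp [v, hi]
        have h2 : T d {j | R i j} = d.sum fun j b => b * k i j := by
          refine (map_finsuppSum (Finsupp.applyAddHom {j | R i j} : (Set I →₀ ℂ) →+ ℂ) d _).trans ?_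
          refine Finsupp.sum_congr fun j _ => ?_
          change d j * v j {j | R i j} = _
          rw [hv i j hi]
        rw [h1, Finsupp.sum_single_index (by simp), h2, Finsupp.mul_sum]
        exact Finsupp.sum_congr fun j _ => by ring
      · have h1 : v i = 0 := by simp [v, hi]
        rw [h1, smul_zero, Finsupp.sum_zero_index]
        refine Finset.sum_eq_zero fun j _ => ?_
        change _ * k i j = 0
        rw [hk0 i j fun hij => hi (ht i j i hij (hs i j hij)), mul_zero]
  rw [key, Finsupp.sum, Complex.re_sum]
  refine Finset.sum_nonneg fun s _ => ?_
  rw [Complex.star_def, ← Complex.normSq_eq_conj_mul_self, Complex.ofReal_re]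
  exact Complex.normSq_nonneg _

variable {G : Type*} [InverseSemigroup G]

theorem Spec.pull_idem {e : Idem G} {χ : Spec G} (h : χ e = true)
    (h' : χ (Idem.ran e.val) = true) : pull e.val χ h' = χ :=
  Spec.ext (funext fun d => by
    change χ (Idem.conj e.val d) = χ d
    rw [Idem.conj_idem, Spec.map_mul, h, Bool.true_and])

/-- A positive definite kernel on `X` over an index set `I` with a compatible action of `G`. -/
structure GKernel (G I : Type*) [InverseSemigroup G] extends PosKernel (Spec G) I where
  mv : G → I → I
  mv_mul : ∀ g h i, mv (g * h) i = mv g (mv h i)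
  mv_one : ∀ e, IsOne e → ∀ i, mv e i = i
  equivariant : ∀ g i j χ (h : χ (Idem.ran g) = true),
    k (mv g i) (mv g j) χ = k i j (χ.pull g h)
  compat : ∀ (e : Idem G) i j χ, χ e = true → k (mv e.val i) j χ = k i j χ

namespace GKernel

variable {I : Type*} (K : GKernel G I)

open PosKernel Spec

/-- `U_g (φ_i f) = φ_{g i} g(f)` on finite sums. -/
noncomputable def uPre (g : G) : K.Pre →ₗ[ℂ] K.Pre :=
  Finsupp.lmapDomain C₀(Spec G, ℂ) ℂ (K.mv g) ∘ₗ
    Finsupp.mapRange.linearMap ((c0Action.act g : C₀(Spec G, ℂ) →ₙₐ[ℂ] C₀(Spec G, ℂ)) :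
      C₀(Spec G, ℂ) →ₗ[ℂ] C₀(Spec G, ℂ))

theorem uPre_single (g : G) (i : I) (f : C₀(Spec G, ℂ)) :
    K.uPre g (Pre.single K.toPosKernel i f) = Pre.single K.toPosKernel (K.mv g i) (trans g f) := by
  change Finsupp.mapDomain (K.mv g) (Finsupp.mapRange (c0Action.act g) (_root_.map_zero _)
    (Finsupp.single i f)) = Finsupp.single (K.mv g i) (trans g f)
  rw [Finsupp.mapRange_single, Finsupp.mapDomain_single, c0Action_apply]

theorem ev_uPre_pos (g : G) (x : K.Pre) (χ : Spec G) (h : χ (Idem.ran g) = true) :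
    Pre.ev χ (K.uPre g x) = Finsupp.mapDomain (K.mv g) (Pre.ev (χ.pull g h) x) := by
  induction x using Pre.induction with
  | h0 => simp
  | ha x y hx hy => simp only [map_add, hx, hy, Finsupp.mapDomain_add]
  | hs i f =>
    rw [uPre_single, Pre.ev_single, Pre.ev_single, Finsupp.mapDomain_single, trans_pos h]

theorem ev_uPre_neg (g : G) (x : K.Pre) (χ : Spec G) (h : ¬ χ (Idem.ran g) = true) :
    Pre.ev χ (K.uPre g x) = 0 := by
  induction x using Pre.induction with
  | h0 => simp
  | ha x y hx hy => simp only [map_add, hx, hy, add_zero]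
  | hs i f => rw [uPre_single, Pre.ev_single, trans_neg h, Finsupp.single_zero]

theorem form_mapDomain (g : G) (χ : Spec G) (h : χ (Idem.ran g) = true) (c d : I →₀ ℂ) :
    K.form χ (c.mapDomain (K.mv g)) (d.mapDomain (K.mv g)) = K.form (χ.pull g h) c d := by
  rw [form, Finsupp.sum_mapDomain_index (by simp)]
  · refine Finsupp.sum_congr fun i _ => ?_
    rw [Finsupp.sum_mapDomain_index (by simp) (fun j b b' => by ring)]
    exact Finsupp.sum_congr fun j _ => by rw [K.equivariant g i j χ h]
  · intro i a b
    rw [← Finsupp.sum_add]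
    exact Finsupp.sum_congr fun j _ => by rw [star_add]; ring

theorem form_mapDomain_idem (e : Idem G) (χ : Spec G) (h : χ e = true) (c d : I →₀ ℂ) :
    K.form χ (c.mapDomain (K.mv e.val)) d = K.form χ c d := by
  rw [form, Finsupp.sum_mapDomain_index (by simp)]
  · exact Finsupp.sum_congr fun i _ => Finsupp.sum_congr fun j _ => by rw [K.compat e i j χ h]
  · intro i a b
    rw [← Finsupp.sum_add]
    exact Finsupp.sum_congr fun j _ => by rw [star_add]; ring

theorem form_zero_left (χ : Spec G) (d : I →₀ ℂ) : K.form χ 0 d = 0 := Finsupp.sum_zero_index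

theorem inner_uPre (g : G) (x y : K.Pre) :
    inner C₀(Spec G, ℂ) (K.uPre g x) (K.uPre g y) = trans g (inner C₀(Spec G, ℂ) x y) := by
  ext χ
  rw [Pre.inner_apply]
  by_cases h : χ (Idem.ran g) = true
  · rw [trans_pos h, Pre.inner_apply, K.ev_uPre_pos g x χ h, K.ev_uPre_pos g y χ h,
      K.form_mapDomain]
  · rw [trans_neg h, K.ev_uPre_neg g x χ h, form_zero_left]

theorem inner_uPre_idem (e : Idem G) (b : C₀(Spec G, ℂ)) (z x : K.Pre) :
    inner C₀(Spec G, ℂ) z (b • K.uPre e.val x)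
      = inner C₀(Spec G, ℂ) z (trans e.val b • x) := by
  rw [← Pre.star_inner, ← Pre.star_inner (trans e.val b • x)]
  congr 1
  ext χ
  rw [Pre.inner_apply, Pre.inner_apply, Pre.ev_bsmul, Pre.ev_bsmul, form_smul_left,
    form_smul_left]
  by_cases h : χ e = true
  · have h' : χ (Idem.ran e.val) = true := by rwa [Idem.ran_idem]
    rw [trans_idem_pos h, K.ev_uPre_pos e.val x χ h', pull_idem h, form_mapDomain_idem _ _ _ h]
  · rw [trans_idem_neg h, K.ev_uPre_neg e.val x χ (by rwa [Idem.ran_idem]), form_zero_left]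
    simp

theorem norm_uPre_le (g : G) (x : K.Pre) : ‖K.uPre g x‖ ≤ 1 * ‖x‖ := by
  rw [one_mul]
  refine (pow_le_pow_iff_left₀ (norm_nonneg _) (norm_nonneg _) two_ne_zero).1 ?_
  rw [Pre.norm_sq, Pre.norm_sq, inner_uPre]
  exact NonUnitalStarAlgHom.norm_apply_le (c0Action.act g) _

/-- `U_g` on the completion. -/
noncomputable def uL (g : G) : K.Module →L[ℂ] K.Module :=
  ((K.uPre g).mkContinuous 1 (K.norm_uPre_le g)).completion

theorem uL_coe (g : G) (x : K.Pre) : K.uL g (x : K.Module) = (K.uPre g x : K.Module) :=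
  ContinuousLinearMap.completion_apply_coe _ _

/-- Two continuous linear maps that agree on the vectors `φ_i f` are equal. -/
theorem ext_single {S T : K.Module →L[ℂ] K.Module}
    (h : ∀ i f, S (Pre.single K.toPosKernel i f : K.Pre) = T (Pre.single K.toPosKernel i f : K.Pre))
    (x : K.Module) : S x = T x := by
  refine Completion.induction_on x (isClosed_eq S.continuous T.continuous) fun x => ?_
  induction x using Pre.induction with
  | h0 => rw [Completion.coe_zero, _root_.map_zero, _root_.map_zero]
  | ha x y hx hy => rw [Completion.coe_add, map_add, map_add, hx, hy]
  | hs i f => exact h i f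

/-- The `G`-Hilbert `C₀(X)`-module of a `G`-kernel, with `U_g (φ_i f) = φ_{g i} g(f)`. -/
noncomputable def gHilbert : GHilbertModule (c0Action (G := G)) K.Module where
  U g := K.uL g
  U_mul g h := K.ext_single (S := K.uL (g * h)) (T := K.uL g ∘L K.uL h) fun i f => by
    change K.uL (g * h) _ = K.uL g (K.uL h _)
    rw [uL_coe, uL_coe, uL_coe, uPre_single, uPre_single, uPre_single, K.mv_mul]
    congr 2
    exact c0Action.act_mul g h f
  U_one e he := K.ext_single (S := K.uL e) (T := ContinuousLinearMap.id ℂ _) fun i f => by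
    rw [uL_coe, uPre_single, K.mv_one e he]
    congr 2
    exact c0Action.act_one e he f
  U_zero z hz := K.ext_single (S := K.uL z) (T := 0) fun i f => by
    change K.uL z _ = 0
    rw [uL_coe, uPre_single, ← Completion.coe_zero]
    congr 1
    have : trans z f = 0 := c0Action.act_zero z hz f
    rw [this]
    exact Finsupp.single_zero _
  inner_U g x y := Completion.induction_on₂ x y
    (isClosed_eq (PosKernel.Module.continuous_inner'
        ((K.uL g).continuous.comp continuous_fst) ((K.uL g).continuous.comp continuous_snd))
      ((AddMonoidHomClass.continuous_of_bound (c0Action.act g) 1 fun f => by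
        rw [one_mul]; exact NonUnitalStarAlgHom.norm_apply_le _ _).comp
        PosKernel.Module.continuous_inner)) fun x y => by
      change inner C₀(Spec G, ℂ) (K.uL g x) (K.uL g y) = _
      rw [uL_coe, uL_coe, PosKernel.Module.inner_coe, PosKernel.Module.inner_coe, inner_uPre,
        c0Action_apply]
  U_smul g b x := by
    refine Completion.induction_on x (isClosed_eq
      ((K.uL g).continuous.comp (PosKernel.Module.continuous_bsmul b))
      ((PosKernel.Module.continuous_bsmul _).comp (K.uL g).continuous)) fun x => ?_
    change K.uL g _ = _ • K.uL g _
    rw [← Completion.coe_smul, uL_coe, uL_coe, ← Completion.coe_smul]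
    congr 1
    induction x using Pre.induction with
    | h0 =>
      have h0 : ∀ b : C₀(Spec G, ℂ), b • (0 : K.Pre) = 0 := fun b => Finsupp.mapRange_zero
      rw [h0, _root_.map_zero, h0]
    | ha x y hx hy => rw [Pre.smul_add', map_add, hx, hy, map_add, Pre.smul_add']
    | hs i f =>
      rw [Pre.smul_single, uPre_single, uPre_single, Pre.smul_single]
      congr 1
      exact map_mul (c0Action.act g) b f
  compat g b x := by
    refine Completion.induction_on x (isClosed_eq
      ((PosKernel.Module.continuous_bsmul _).comp (K.uL (g * g⁻¹)).continuous)
      (PosKernel.Module.continuous_bsmul _)) fun x => ?_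
    refine PosKernel.Module.ext_inner_pre fun z => ?_
    change inner C₀(Spec G, ℂ) (z : K.Module) (b • K.uL (g * g⁻¹) _) = _
    rw [uL_coe, ← Completion.coe_smul, ← Completion.coe_smul, PosKernel.Module.inner_coe,
      PosKernel.Module.inner_coe]
    exact K.inner_uPre_idem (Idem.ran g) b z x

end GKernel

open Classical in
variable (G) in
/-- The kernel of the countable direct sum `C₀(X)^∞`: the vectors `φ_n f`, `n ∈ ℕ`, with
`⟨φ_m f, φ_n f'⟩ = δ_{mn} f⋆ f'` and `g(φ_n f) = φ_n g(f)`. -/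
noncomputable def sumKernel : GKernel G ℕ where
  k m n := BoundedContinuousFunction.const _ (if m = n then 1 else 0)
  herm m n χ := by
    change (if n = m then (1 : ℂ) else 0) = star (if m = n then (1 : ℂ) else 0)
    by_cases h : m = n
    · simp [h]
    · simp [h, Ne.symm h]
  pos χ := relation_pos (fun m n => m = n) (fun _ _ h => h.symm) (fun _ _ _ h h' => h.trans h') _
    (fun _ _ h => if_pos h) (fun _ _ h => if_neg h)
  mv _ n := n
  mv_mul _ _ _ := rfl
  mv_one _ _ _ := rfl
  equivariant _ _ _ _ _ := rfl
  compat _ _ _ _ _ := rfl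

/-- The relation `⟨φ_g, φ_h⟩(χ) = 1`, where
`⟨φ_g, φ_h⟩ = ⋁ {1_e | e ∈ E, e g = e h, e ≤ g g⁻¹ h h⁻¹}`. -/
def L2Rel (χ : Spec G) (g h : G) : Prop :=
  ∃ e : Idem G, e.val * g = e.val * h ∧ NatLE e.val (g * g⁻¹ * (h * h⁻¹)) ∧ χ e = true

namespace L2Rel

theorem le_iff {e f : Idem G} : NatLE e.val f.val ↔ e * f = e :=
  ⟨fun h => Idem.ext (natLE_idem f.idem h), fun h => ⟨e.val, e.idem, (congrArg Idem.val h).symm⟩⟩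

theorem apply_of_le {χ : Spec G} {e f : Idem G} (h : e * f = e) (he : χ e = true) :
    χ f = true := by
  have := χ.map_mul e f
  rw [h, he] at this
  simpa using this.symm

theorem mul_comm' (e f : Idem G) : e * f = f * e := Idem.ext (idem_comm _ _ e.idem f.idem)

theorem mul_assoc' (e f d : Idem G) : e * f * d = e * (f * d) := Idem.ext (mul_assoc _ _ _)

theorem mul_self (e : Idem G) : e * e = e := Idem.ext e.idem

theorem iff_ran {χ : Spec G} {g h : G} : L2Rel χ g h ↔ ∃ e : Idem G, e.val * g = e.val * h ∧
    e * Idem.ran g = e ∧ e * Idem.ran h = e ∧ χ e = true := by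
  refine exists_congr fun e => and_congr_right fun _ => ?_
  have h1 : NatLE e.val (g * g⁻¹ * (h * h⁻¹)) ↔ e * (Idem.ran g * Idem.ran h) = e :=
    le_iff (f := Idem.ran g * Idem.ran h)
  rw [h1]
  constructor
  · rintro ⟨h2, h3⟩
    refine ⟨?_, ?_, h3⟩
    · rw [← h2, mul_assoc', mul_comm' (Idem.ran g) (Idem.ran h), mul_assoc', mul_self]
    · rw [← h2, mul_assoc', mul_assoc', mul_self]
  · rintro ⟨h2, h3, h4⟩
    exact ⟨by rw [← mul_assoc', h2, h3], h4⟩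

theorem symm {χ : Spec G} {g h : G} (H : L2Rel χ g h) : L2Rel χ h g := by
  obtain ⟨e, h1, h2, h3, h4⟩ := iff_ran.1 H
  exact iff_ran.2 ⟨e, h1.symm, h3, h2, h4⟩

theorem trans {χ : Spec G} {g h l : G} (H : L2Rel χ g h) (H' : L2Rel χ h l) : L2Rel χ g l := by
  obtain ⟨e, h1, h2, h3, h4⟩ := iff_ran.1 H
  obtain ⟨f, k1, k2, k3, k4⟩ := iff_ran.1 H'
  refine iff_ran.2 ⟨e * f, ?_, ?_, ?_, ?_⟩
  · have hc : e.val * f.val = f.val * e.val := idem_comm _ _ e.idem f.idem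
    calc e.val * f.val * g = f.val * (e.val * g) := by rw [hc, mul_assoc]
      _ = e.val * (f.val * h) := by rw [h1, ← mul_assoc, ← hc, mul_assoc]
      _ = _ := by rw [k1, ← mul_assoc]; rfl
  · rw [mul_assoc', mul_comm' f, ← mul_assoc', h2]
  · rw [mul_assoc', k3]
  · rw [χ.map_mul, h4, k4]; rfl

/-- `⟨φ_g, φ_h⟩ = g g⁻¹ ⋁ {1_e | e ≤ h g⁻¹}`. -/
theorem iff_le {χ : Spec G} {g h : G} : L2Rel χ g h ↔
    χ (Idem.ran g) = true ∧ ∃ e : Idem G, NatLE e.val (h * g⁻¹) ∧ χ e = true := by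
  rw [iff_ran]
  constructor
  · rintro ⟨e, h1, h2, h3, h4⟩
    refine ⟨apply_of_le h2 h4, e, ⟨e.val, e.idem, ?_⟩, h4⟩
    calc e.val = e.val * (g * g⁻¹) := (congrArg Idem.val h2).symm
      _ = _ := by rw [← mul_assoc, h1, mul_assoc]
  · rintro ⟨h1, e, ⟨d, hd, he⟩, h2⟩
    have e1 : e.val = e.val * (h * g⁻¹) := by
      have : d * e.val = e.val := by rw [he, ← mul_assoc, hd]
      calc e.val = e.val * e.val := e.idem.symm
        _ = e.val * d * (h * g⁻¹) := by rw [mul_assoc, ← he]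
        _ = _ := by rw [idem_comm e.val d e.idem hd, this]
    let f : Idem G := Idem.conj h (Idem.ran g⁻¹)
    have hf : f.val = h * g⁻¹ * (g * h⁻¹) := by
      change h * (g⁻¹ * g⁻¹⁻¹) * h⁻¹ = _
      rw [inv_inv']; simp only [mul_assoc]
    have e2 : e.val = g * h⁻¹ * e.val := by
      have := congrArg (fun x : G => x⁻¹) e1
      simp only [mul_inv_rev', inv_inv', inv_idem e.idem] at this
      exact this
    have e3 : e * f = e := by
      have h3 : e * f = e * f * e := by rw [mul_assoc', mul_comm' f e, ← mul_assoc', mul_self]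
      rw [h3]
      refine Idem.ext ?_
      calc e.val * f.val * e.val = e.val * (h * g⁻¹) * (g * h⁻¹ * e.val) := by
            rw [hf]; simp only [mul_assoc]
        _ = e.val := by rw [← e1, ← e2, e.idem]
    have e4 : e * Idem.ran h = e := by
      rw [← e3, mul_assoc', Idem.conj_mul_ran]
    have e5 : e.val * h * (g⁻¹ * g) = e.val * h := by
      calc e.val * h * (g⁻¹ * g) = e.val * (h * h⁻¹ * h) * (g⁻¹ * g) := by rw [mul_inv_mul]
        _ = e.val * h * ((h⁻¹ * h) * (g⁻¹ * g)) := by simp only [mul_assoc]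
        _ = e.val * (h * g⁻¹ * (g * h⁻¹)) * h := by
            rw [idem_comm _ _ (inv_mul_idem h) (inv_mul_idem g)]; simp only [mul_assoc]
        _ = e.val * h := by rw [← hf]; exact congrArg (· * h) (congrArg Idem.val e3)
    refine ⟨Idem.ran g * e, ?_, ?_, ?_, ?_⟩
    · have : e.val * g = e.val * h := by
        rw [← e5]
        conv_lhs => rw [e1]
        simp only [mul_assoc]
      change Idem.val (Idem.ran g) * e.val * g = Idem.val (Idem.ran g) * e.val * h
      rw [mul_assoc, this, mul_assoc]
    · rw [mul_assoc', mul_comm' e, ← mul_assoc', mul_self]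
    · rw [mul_assoc', e4]
    · rw [χ.map_mul, h1, h2]; rfl

theorem mul_left_iff {χ : Spec G} (e : Idem G) (he : χ e = true) {g h : G} :
    L2Rel χ (e.val * g) h ↔ L2Rel χ g h := by
  have hr : Idem.ran (e.val * g) = e * Idem.ran g := by rw [Idem.ran_mul, Idem.conj_idem]
  rw [iff_ran, iff_ran, hr]
  constructor
  · rintro ⟨f, h1, h2, h3, h4⟩
    have h5 : f * e = f := by
      rw [← h2, mul_assoc', mul_comm' e (Idem.ran g), mul_assoc', mul_self]
    refine ⟨f, ?_, ?_, h3, h4⟩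
    · rw [← h1, ← mul_assoc]
      exact congrArg (· * g) (congrArg Idem.val h5).symm
    · rwa [← mul_assoc', h5] at h2
  · rintro ⟨f, h1, h2, h3, h4⟩
    refine ⟨f * e, ?_, ?_, ?_, by rw [χ.map_mul, h4, he]; rfl⟩
    · have hc : f.val * e.val = e.val * f.val := idem_comm _ _ f.idem e.idem
      calc f.val * e.val * (e.val * g) = f.val * (e.val * e.val) * g := by simp only [mul_assoc]
        _ = e.val * (f.val * g) := by rw [e.idem, hc, mul_assoc]
        _ = _ := by rw [h1, ← mul_assoc, ← hc]; rfl
    · rw [mul_assoc', ← mul_assoc' e e, mul_self, mul_comm' e, ← mul_assoc', h2]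
    · rw [mul_assoc', mul_comm' e, ← mul_assoc', h3]

theorem pull_iff {χ : Spec G} (g : G) (hg : χ (Idem.ran g) = true) {h l : G} :
    L2Rel χ (g * h) (g * l) ↔ L2Rel (χ.pull g hg) h l := by
  have hgi : χ (Idem.conj g (Idem.ran g⁻¹)) = true := by
    have : Idem.conj g (Idem.ran g⁻¹) = Idem.ran g := Idem.ext (by
      change g * (g⁻¹ * g⁻¹⁻¹) * g⁻¹ = g * g⁻¹
      rw [inv_inv', ← mul_assoc, mul_inv_mul])
    rw [this, hg]
  have hcomm : ∀ e : Idem G, g * e.val = (Idem.conj g e).val * g := fun e => by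
    change g * e.val = g * e.val * g⁻¹ * g
    calc g * e.val = g * g⁻¹ * g * e.val := by rw [mul_inv_mul]
      _ = g * ((g⁻¹ * g) * e.val) := by simp only [mul_assoc]
      _ = g * (e.val * (g⁻¹ * g)) := by rw [idem_comm _ _ (inv_mul_idem g) e.idem]
      _ = _ := by simp only [mul_assoc]
  constructor
  · intro H
    obtain ⟨e, h1, h2, h3, h4⟩ := iff_ran.1 H
    have hback : Idem.conj g (Idem.conj g⁻¹ e) = Idem.ran g * e := by
      rw [← Idem.conj_conj, ← Idem.conj_idem]; rfl
    have hran : ∀ h : G, Idem.conj g⁻¹ (Idem.ran (g * h)) = Idem.ran g⁻¹ * Idem.ran h := fun h => by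
      rw [Idem.ran_mul, ← Idem.conj_conj, ← Idem.conj_idem]
      change Idem.conj (g⁻¹ * g) _ = Idem.conj (g⁻¹ * g⁻¹⁻¹) _
      rw [inv_inv']
    have hmul : ∀ h : G, (Idem.conj g⁻¹ e).val * h = g⁻¹ * (e.val * (g * h)) := fun h => by
      change g⁻¹ * e.val * g⁻¹⁻¹ * h = _
      rw [inv_inv']; simp only [mul_assoc]
    have hle : ∀ h : G, e * Idem.ran (g * h) = e →
        Idem.conj g⁻¹ e * Idem.ran h = Idem.conj g⁻¹ e := fun h hh => by
      have := congrArg (Idem.conj g⁻¹) hh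
      rw [Idem.conj_mul, hran, ← mul_assoc', Idem.conj_mul_ran] at this
      exact this
    refine iff_ran.2 ⟨Idem.conj g⁻¹ e, ?_, hle h h2, hle l h3, ?_⟩
    · rw [hmul, hmul, h1]
    · change χ (Idem.conj g (Idem.conj g⁻¹ e)) = true
      rw [hback, χ.map_mul, hg, h4]; rfl
  · intro H
    obtain ⟨e, h1, h2, h3, h4⟩ := iff_ran.1 H
    refine iff_ran.2 ⟨Idem.conj g e, ?_, ?_, ?_, h4⟩
    · rw [← mul_assoc, ← mul_assoc, ← hcomm, mul_assoc, mul_assoc, h1]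
    · rw [Idem.ran_mul, ← Idem.conj_mul, h2]
    · rw [Idem.ran_mul, ← Idem.conj_mul, h3]

end L2Rel

open Classical in
/-- The function `⟨φ_g, φ_h⟩ = ⋁ {1_e | e ∈ E, e g = e h, e ≤ g g⁻¹ h h⁻¹}` on `X`. -/
noncomputable def L2Inner [IsEContinuous G] (g h : G) : Spec G →ᵇ ℂ :=
  BoundedContinuousFunction.ofNormedAddCommGroup (fun χ => if L2Rel χ g h then 1 else 0)
    (by
      obtain ⟨f, hf⟩ := IsEContinuous.exists_c0 (h * g⁻¹)
      have : (fun χ : Spec G => if L2Rel χ g h then (1 : ℂ) else 0)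
          = fun χ => Spec.ind (Idem.ran g) χ * f χ := funext fun χ => by
        change _ = (if χ (Idem.ran g) = true then (1 : ℂ) else 0) * f χ
        rw [hf, supFun, ite_zero_mul_ite_zero, mul_one]
        exact if_congr L2Rel.iff_le rfl rfl
      rw [this]
      exact (map_continuous _).mul (map_continuous f)) 1
    (fun χ => by split_ifs <;> simp)

theorem L2Inner_pos [IsEContinuous G] {g h : G} {χ : Spec G} (H : L2Rel χ g h) :
    L2Inner g h χ = 1 := if_pos H

theorem L2Inner_neg [IsEContinuous G] {g h : G} {χ : Spec G} (H : ¬ L2Rel χ g h) :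
    L2Inner g h χ = 0 := if_neg H

theorem L2Inner_congr [IsEContinuous G] {g h g' h' : G} {χ χ' : Spec G}
    (H : L2Rel χ g h ↔ L2Rel χ' g' h') : L2Inner g h χ = L2Inner g' h' χ' := by
  by_cases h1 : L2Rel χ g h
  · rw [L2Inner_pos h1, L2Inner_pos (H.1 h1)]
  · rw [L2Inner_neg h1, L2Inner_neg (mt H.2 h1)]

variable (G) in
/-- The kernel of the compatible `L²(G)`: vectors `φ_g`, `g ∈ G`, with the inner products
`⟨φ_g, φ_h⟩` and the action `g(φ_h) = φ_{gh}`. In its Hilbert module one has `φ_{eg} = φ_g 1_e` for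
`e ∈ E`, so that the closure of the linear span of the `φ_g` is a `C₀(X)`-module and is the whole
module. -/
noncomputable def L2Kernel [IsEContinuous G] : GKernel G G where
  k := L2Inner
  herm g h χ := by
    by_cases H : L2Rel χ g h
    · rw [L2Inner_pos H, L2Inner_pos H.symm, star_one]
    · rw [L2Inner_neg H, L2Inner_neg fun H' => H H'.symm, star_zero]
  pos χ := relation_pos (L2Rel χ) (fun _ _ => L2Rel.symm) (fun _ _ _ => L2Rel.trans) _
    (fun _ _ => L2Inner_pos) (fun _ _ => L2Inner_neg)
  mv g h := g * h
  mv_mul := mul_assoc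
  mv_one _ he h := (he h).1
  equivariant g _ _ _ hg := L2Inner_congr (L2Rel.pull_iff g hg)
  compat e _ _ _ he := L2Inner_congr (L2Rel.mul_left_iff e he)

variable (G) in
/-- The `G`-Hilbert `C₀(X)`-module `C₀(X)^∞`. -/
noncomputable def c0Infty : GHilbertModule (Spec.c0Action (G := G)) (sumKernel G).Module :=
  (sumKernel G).gHilbert

variable (G) in
/-- The `G`-Hilbert `C₀(X)`-module `L²(G)`. -/
noncomputable def L2 [IsEContinuous G] :
    GHilbertModule (Spec.c0Action (G := G)) (L2Kernel G).Module :=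
  (L2Kernel G).gHilbert

variable (G) in
/-- The C⋆-algebra `𝓚_G = 𝓚(C₀(X)^∞) ⊗^X 𝓚(L²(G))`. -/
abbrev KG [IsEContinuous G] : Type _ :=
  BalTensor (c0Infty G).actionCompacts (L2 G).actionCompacts

variable (G) in
/-- The `G`-action of `𝓚_G`. -/
noncomputable def kgAction [IsEContinuous G] : GAction G (KG G) :=
  BalTensor.action (c0Infty G).actionCompacts (L2 G).actionCompacts

end KG

/-! ### Multipliers: strict limits, invariant multipliers and polar decomposition -/

section StrictTopology

open Filter Topology InverseSemigroup
open scoped MultiplierAlgebra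

/-! This is an equivariant form of the fact that a full corner of a σ-unital algebra fills the whole
algebra after stabilization. Put B = A ⊗^X 𝓚_G and P = p ⊗ 1. The two tensor factors of 𝓚_G play
different roles: C₀(X)^∞ supplies room, and L²(G) supplies invariance.

Room (`GAction.exists_invariant_equivalence`). The factor C₀(X)^∞ gives invariant matrix units E_ij
that commute with P. Suppose there are invariant contractions L_k for which the ranges of the L_k P
are jointly total. Out of the L_k and E_ij one forms a single invariant multiplier t = (1-P) l P + P
D, where l = ∑ 2⁻ⁿ L_{κ(n)} E_{ι(n),n}, D = ∑ 4⁻ⁿ E_nn, and (κ(n), ι(n)) takes every value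
infinitely often. Multiplying column n of t by 2ⁿ leaves (1-P) L_k P E_jj plus an error of order
2⁻ⁿ. Hence the closed range of t contains first (1-P)B and then PB, so t has dense range, while t⋆
has range dense in PB. The polar part v of t therefore satisfies v⋆v = P and vv⋆ = 1. It is
invariant because t(|t| + ε)⁻¹ is invariant by functional calculus and v is the strict limit of
these (`GAction.exists_invariant_polar`).

Invariance (`Amplification.exists_amplify`). The obvious candidates a ⊗ 1 ⊗ 1 for L_k are moved by
G. Let q_g be the projection onto φ_g C₀(X) in L²(G). At each character χ the kernel ⟨φ_g, φ_h⟩ is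
the indicator of a partial equivalence relation, so the q_g commute; moreover G sends q_h to q_{gh},
and the ranges of the q_g are jointly total. The multiplier which is α_g(a) ⊗ 1 ⊗ 1 on the range of
1 ⊗ 1 ⊗ q_g is therefore invariant, once it exists. Existence is an overlap condition: α_g(a) and
α_h(a) must agree on q_g q_h. By E-continuity the support of ⟨φ_g, φ_h⟩ is compact, so it is covered
by finitely many idempotents e with eg = eh; the balancing relation moves these e onto α_g(a) -
α_h(a), which they annihilate (`Amplification.left_act_mul_proj_mul_proj`). Commuting projections
can be orthogonalized, and the local homomorphisms glue in the strict topology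
(`DoubleCentralizer.exists_glue`).

Fullness and the strictly positive element h enter together. Fullness approximates h by combinations
of a_k p b for one sequence of contractions a_k, and the amplifications of the a_k serve as L_k.
Since p is invariant, (p ⊗ 1) times the amplification of b is the amplification of pb; so the closed
span of the ranges of the L_k P contains that of the amplification of h, and this already spans
everything (`Amplification.mem_of_amplify_mem`). -/

/-- If a continuous linear map sends a total set into a closed subspace, it sends everything
there. -/
theorem ContinuousLinearMap.mem_of_dense_span {B F : Type*} [NormedAddCommGroup B]
    [NormedSpace ℂ B] [NormedAddCommGroup F] [NormedSpace ℂ F] (T : B →L[ℂ] F)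
    {W : Submodule ℂ F} (hW : IsClosed (W : Set F)) {S : Set B}
    (hS : Dense (Submodule.span ℂ S : Set B)) (h : ∀ b ∈ S, T b ∈ W) (b : B) : T b ∈ W := by
  have h1 : Submodule.span ℂ S ≤ W.comap (T : B →ₗ[ℂ] F) := Submodule.span_le.2 h
  have h2 : IsClosed (W.comap (T : B →ₗ[ℂ] F) : Set B) := hW.preimage T.continuous
  exact closure_minimal h1 h2 (hS b)

theorem ContinuousLinearMap.eq_of_dense_span {B F : Type*} [NormedAddCommGroup B]
    [NormedSpace ℂ B] [NormedAddCommGroup F] [NormedSpace ℂ F] {T T' : B →L[ℂ] F} {S : Set B}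
    (hS : Dense (Submodule.span ℂ S : Set B)) (h : ∀ b ∈ S, T b = T' b) : T = T' := by
  ext b
  have := (T - T').mem_of_dense_span (W := ⊥) isClosed_singleton hS
    (fun b hb => by simp [h b hb]) b
  simpa [sub_eq_zero] using this

/-- A bounded sequence of operators that converges on a total set converges everywhere. -/
theorem ContinuousLinearMap.exists_tendsto_of_dense_span {B : Type*} [NormedAddCommGroup B]
    [NormedSpace ℂ B] [CompleteSpace B] (L : ℕ → B →L[ℂ] B) {C : ℝ} (hC : ∀ n, ‖L n‖ ≤ C)
    {S : Set B} (hS : Dense (Submodule.span ℂ S : Set B))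
    (h : ∀ b ∈ S, ∃ c, Tendsto (fun n => L n b) atTop (𝓝 c)) (b : B) :
    ∃ c, Tendsto (fun n => L n b) atTop (𝓝 c) := by
  have hC0 : 0 ≤ C := (norm_nonneg _).trans (hC 0)
  have hspan : ∀ b ∈ Submodule.span ℂ S, ∃ c, Tendsto (fun n => L n b) atTop (𝓝 c) := by
    intro b hb
    induction hb using Submodule.span_induction with
    | mem b hb => exact h b hb
    | zero => exact ⟨0, by simp⟩
    | add x y _ _ hx hy =>
      obtain ⟨c, hc⟩ := hx
      obtain ⟨d, hd⟩ := hy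
      exact ⟨c + d, by simpa using hc.add hd⟩
    | smul r x _ hx =>
      obtain ⟨c, hc⟩ := hx
      exact ⟨r • c, by simpa using hc.const_smul r⟩
  refine cauchySeq_tendsto_of_complete (Metric.cauchySeq_iff'.2 fun ε hε => ?_)
  -- An ε/3 argument; C + 1 in place of C keeps the denominator nonzero when C = 0.
  obtain ⟨c, hc, hbc⟩ := Metric.mem_closure_iff.1 (hS b) (ε / (3 * (C + 1))) (by positivity)
  obtain ⟨d, hd⟩ := hspan c hc
  obtain ⟨N, hN⟩ := Metric.cauchySeq_iff'.1 hd.cauchySeq (ε / 3) (by positivity)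
  refine ⟨N, fun n hn => ?_⟩
  have key : ∀ n, dist (L n b) (L n c) < ε / 3 := fun n => by
    rw [dist_eq_norm, ← map_sub]
    rw [dist_eq_norm] at hbc
    calc ‖L n (b - c)‖ ≤ C * ‖b - c‖ := (L n).le_of_opNorm_le (hC n) _
      _ ≤ (C + 1) * ‖b - c‖ := by gcongr; linarith
      _ < (C + 1) * (ε / (3 * (C + 1))) := by gcongr
      _ = ε / 3 := by field_simp
  have h1 := key n
  have h2 := key N
  have h3 := hN n hn
  rw [dist_comm] at h2
  calc dist (L n b) (L N b) ≤ dist (L n b) (L n c) + dist (L n c) (L N c) + dist (L N c) (L N b) :=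
        dist_triangle4 _ _ _ _
    _ < ε := by linarith

namespace DoubleCentralizer

variable {B : Type*} [NonUnitalCStarAlgebra B]

/-- The norm of a multiplier is the norm of its left action, so the right action needs no separate
check. -/
theorem ext_fst {m n : 𝓜(ℂ, B)} (h : m.fst = n.fst) : m = n := by
  rw [← sub_eq_zero, ← norm_eq_zero, ← norm_fst, sub_fst, h, sub_self, norm_zero]

theorem mul_fst_apply (m n : 𝓜(ℂ, B)) (b : B) : (m * n).fst b = m.fst (n.fst b) := by
  rw [mul_fst]; rfl

theorem norm_fst_apply_le (m : 𝓜(ℂ, B)) (b : B) : ‖m.fst b‖ ≤ ‖m‖ * ‖b‖ := by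
  rw [← norm_fst]; exact m.fst.le_opNorm b

/-- By centrality every z annihilates the difference of the two sides from the left; the adjoint of
the difference is one such z. -/
theorem fst_mul (m : 𝓜(ℂ, B)) (x y : B) : m.fst (x * y) = m.fst x * y := by
  have h : ∀ z : B, z * (m.fst (x * y) - m.fst x * y) = 0 := fun z => by
    rw [mul_sub, ← m.central, ← mul_assoc, ← mul_assoc, m.central, sub_self]
  have := h (star (m.fst (x * y) - m.fst x * y))
  rw [CStarRing.star_mul_self_eq_zero_iff] at this
  exact sub_eq_zero.1 this

/-- A bounded sequence of multipliers that converges, together with its adjoints, on total sets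
has a strict limit. -/
theorem exists_strict_limit (m : ℕ → 𝓜(ℂ, B)) {C : ℝ} (hC : ∀ n, ‖m n‖ ≤ C) {S S' : Set B}
    (hS : Dense (Submodule.span ℂ S : Set B)) (hS' : Dense (Submodule.span ℂ S' : Set B))
    (h : ∀ b ∈ S, ∃ c, Tendsto (fun n => (m n).fst b) atTop (𝓝 c))
    (h' : ∀ b ∈ S', ∃ c, Tendsto (fun n => (star (m n)).fst b) atTop (𝓝 c)) :
    ∃ v : 𝓜(ℂ, B), (∀ b, Tendsto (fun n => (m n).fst b) atTop (𝓝 (v.fst b))) ∧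
      ∀ b, Tendsto (fun n => (star (m n)).fst b) atTop (𝓝 ((star v).fst b)) := by
  have h1 := ContinuousLinearMap.exists_tendsto_of_dense_span (fun n => (m n).fst)
    (fun n => (norm_fst (m n)).trans_le (hC n)) hS h
  have h2 := ContinuousLinearMap.exists_tendsto_of_dense_span (fun n => (star (m n)).fst)
    (fun n => (norm_fst (star (m n))).trans_le ((norm_star (m n)).trans_le (hC n))) hS' h'
  choose f hf using h1
  choose f' hf' using h2
  -- Right multiplication by `m n` is b ↦ ((m n)⋆ b⋆)⋆, so convergence of the adjoints supplies the
  -- right half of the limit.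
  have hs : ∀ b, Tendsto (fun n => (m n).snd b) atTop (𝓝 (star (f' (star b)))) := fun b => by
    have := (hf' (star b)).star
    simpa only [star_fst, star_star] using this
  let v : 𝓜(ℂ, B) :=
    { fst := continuousLinearMapOfTendsto (fun n => (m n).fst) (tendsto_pi_nhds.2 hf)
      snd := continuousLinearMapOfTendsto (fun n => (m n).snd) (tendsto_pi_nhds.2 hs)
      central := fun x y => tendsto_nhds_unique ((hs x).mul_const y)
        (((hf y).const_mul x).congr fun n => ((m n).central x y).symm) }
  refine ⟨v, hf, fun b => ?_⟩
  have : (star v).fst b = f' b := by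
    rw [star_fst]
    change star (star (f' (star (star b)))) = f' b
    rw [star_star, star_star]
  rw [this]
  exact hf' b

end DoubleCentralizer

namespace GAction

variable {G B : Type*} [InverseSemigroup G] [NonUnitalCStarAlgebra B] (β : GAction G B)

theorem continuous_act (g : G) : Continuous (β.act g) :=
  AddMonoidHomClass.continuous_of_bound (β.act g) 1 fun b => by
    rw [one_mul]; exact NonUnitalStarAlgHom.norm_apply_le _ _

/-- `α_g` as a continuous linear map. -/
noncomputable def actL (g : G) : B →L[ℂ] B where
  toFun := β.act g
  map_add' := map_add _
  map_smul' := map_smul _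
  cont := β.continuous_act g

/-- Idempotents act as central multipliers: compatibility turns α_e(x) α_e(y) into x α_e(α_e(y)),
and α_e is idempotent. -/
theorem act_idem_mul {e : G} (he : e * e = e) (x y : B) : β.act e (x * y) = x * β.act e y := by
  rw [map_mul, ← β.compat_idem he, β.compat_idem he, ← β.compat_idem he, ← β.act_mul, he,
    β.compat_idem he]

variable {β}

/-- Invariance is defined through left multiplication; this transfers it to right multiplication, so
that adjoints of invariant multipliers are invariant. Tested against y on the right, α_g(c) absorbs
g g⁻¹, so y may be replaced by α_g(α_{g⁻¹}(y)) and the whole product pulled inside α_g. -/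
theorem IsInvariant.snd {m : 𝓜(ℂ, B)} (hm : β.IsInvariant m) (g : G) (c : B) :
    m.snd (β.act g c) = β.act g (m.snd c) := by
  have he := mul_inv_idem g
  have hg : ∀ b, β.act (g * g⁻¹) (β.act g b) = β.act g b := fun b => by
    rw [← β.act_mul, mul_inv_mul]
  have h : ∀ y : B, (m.snd (β.act g c) - β.act g (m.snd c)) * y = 0 := fun y => by
    have h1 : m.snd (β.act g c) * y = β.act g (m.snd c * β.act g⁻¹ y) := by
      rw [m.central, m.central, map_mul, ← hm, ← β.act_mul, hm, ← β.compat, hg]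
    rw [sub_mul, h1, map_mul, ← β.act_mul, ← β.compat, hg, sub_self]
  have := h (star (m.snd (β.act g c) - β.act g (m.snd c)))
  rw [CStarRing.mul_star_self_eq_zero_iff] at this
  exact sub_eq_zero.1 this

variable (β) in
/-- The closed `⋆`-algebra of `G`-invariant multipliers. -/
noncomputable def invariants : StarSubalgebra ℝ 𝓜(ℂ, B) where
  carrier := {m | β.IsInvariant m}
  mul_mem' {m n} hm hn g b := by
    rw [DoubleCentralizer.mul_fst_apply, DoubleCentralizer.mul_fst_apply, hn, hm]
  add_mem' {m n} hm hn g b := by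
    rw [DoubleCentralizer.add_fst, _root_.add_apply, _root_.add_apply, hm, hn, map_add]
  algebraMap_mem' r g b := by
    rw [Algebra.algebraMap_eq_smul_one, DoubleCentralizer.smul_fst, DoubleCentralizer.one_fst]
    exact (map_smul (β.actL g) (r : ℂ) b).symm
  star_mem' {m} hm g b := by
    rw [DoubleCentralizer.star_fst, DoubleCentralizer.star_fst, ← map_star (β.act g),
      IsInvariant.snd hm, map_star (β.act g)]

theorem mem_invariants {m : 𝓜(ℂ, B)} : m ∈ β.invariants ↔ β.IsInvariant m := Iff.rfl

/-- The polar part below is only a strict limit, for which norm closedness of the invariants would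
not suffice. -/
theorem IsInvariant.of_tendsto {m : ℕ → 𝓜(ℂ, B)} (hm : ∀ n, β.IsInvariant (m n)) {v : 𝓜(ℂ, B)}
    (hv : ∀ b, Tendsto (fun n => (m n).fst b) atTop (𝓝 (v.fst b))) : β.IsInvariant v :=
  fun g b => tendsto_nhds_unique (hv (β.act g b))
    ((((β.continuous_act g).tendsto _).comp (hv b)).congr fun n => (hm n g b).symm)

/-- Norm closedness is what keeps functional calculus of t⋆t and norm convergent series inside the
invariants. -/
theorem isClosed_invariants : IsClosed (β.invariants : Set 𝓜(ℂ, B)) := by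
  rw [← isSeqClosed_iff_isClosed]
  intro m v hm hv
  refine IsInvariant.of_tendsto hm fun b => ?_
  rw [tendsto_iff_norm_sub_tendsto_zero] at hv ⊢
  refine squeeze_zero (fun _ => norm_nonneg _) (fun n => ?_) (by simpa using hv.mul_const ‖b‖)
  rw [← _root_.sub_apply, ← DoubleCentralizer.sub_fst]
  exact DoubleCentralizer.norm_fst_apply_le _ _

end GAction

end StrictTopology

/-! ### Invariant polar decomposition and the stabilization argument. -/

section PolarDecomposition

open Filter Topology InverseSemigroup
open scoped MultiplierAlgebra

variable {G B : Type*} [InverseSemigroup G] [NonUnitalCStarAlgebra B] {β : GAction G B}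

/-- In a unital C⋆-algebra, `|t|` and regularized inverses of it. -/
theorem exists_abs_regularized {M : Type*} [CStarAlgebra M] (t : M) :
    ∃ s ∈ StarAlgebra.elemental ℝ (star t * t), star s = s ∧ s * s = star t * t ∧
      ∀ ε : ℝ, 0 < ε → ∃ w ∈ StarAlgebra.elemental ℝ (star t * t), star w = w ∧
        w * s = 1 - ε • w ∧ s * w = 1 - ε • w ∧ ‖w * s‖ ≤ 1 := by
  have ha : IsSelfAdjoint (star t * t) := IsSelfAdjoint.star_mul_self t
  have hpos : ∀ x ∈ spectrum ℝ (star t * t), 0 ≤ x := fun x hx => spectrum_star_mul_self_nonneg x hx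
  have hc : ContinuousOn Real.sqrt (spectrum ℝ (star t * t)) := Real.continuous_sqrt.continuousOn
  refine ⟨cfc Real.sqrt (star t * t), cfc_mem_elemental _ _,
    (cfc_predicate Real.sqrt (star t * t) : IsSelfAdjoint _), ?_, fun ε hε => ?_⟩
  · rw [← cfc_mul _ _ _ hc hc]
    conv_rhs => rw [← cfc_id ℝ (star t * t)]
    exact cfc_congr fun x hx => Real.mul_self_sqrt (hpos x hx)
  · have hne : ∀ x, Real.sqrt x + ε ≠ 0 := fun x => (add_pos_of_nonneg_of_pos
      (Real.sqrt_nonneg x) hε).ne'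
    have hw : ContinuousOn (fun x => (Real.sqrt x + ε)⁻¹) (spectrum ℝ (star t * t)) :=
      ((Real.continuous_sqrt.add continuous_const).inv₀ hne).continuousOn
    -- The scalar identity √x / (√x + ε) = 1 - ε / (√x + ε).
    have key : cfc (fun x => (Real.sqrt x + ε)⁻¹ * Real.sqrt x) (star t * t)
        = 1 - ε • cfc (fun x => (Real.sqrt x + ε)⁻¹) (star t * t) := by
      have h1 := cfc_sub (fun _ : ℝ => (1 : ℝ)) (fun x => ε • (Real.sqrt x + ε)⁻¹) (star t * t)
        continuousOn_const (hw.const_smul ε)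
      rw [← cfc_smul ε _ _ hw, ← cfc_const_one ℝ (star t * t), ← h1]
      refine cfc_congr fun x _ => ?_
      have := hne x
      simp only [smul_eq_mul]
      field_simp
      ring
    refine ⟨cfc (fun x => (Real.sqrt x + ε)⁻¹) (star t * t), cfc_mem_elemental _ _,
      (cfc_predicate (fun x => (Real.sqrt x + ε)⁻¹) (star t * t) : IsSelfAdjoint _), ?_, ?_, ?_⟩
    · rw [← cfc_mul _ _ _ hw hc, key]
    · rw [← cfc_mul _ _ _ hc hw, ← key]
      exact cfc_congr fun x _ => mul_comm _ _
    · rw [← cfc_mul _ _ _ hw hc]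
      refine norm_cfc_le zero_le_one fun x _ => ?_
      have h1 := Real.sqrt_nonneg x
      rw [Real.norm_of_nonneg (by positivity), inv_mul_le_iff₀ (by positivity)]
      linarith

/-- Polar decomposition of an invariant multiplier `t = t P` with dense range whose adjoint has
range dense in `P B`. -/
theorem GAction.exists_invariant_polar {t P : 𝓜(ℂ, B)} (ht : β.IsInvariant t)
    (hP : IsStarProjection P) (htP : t * P = t) (h1 : DenseRange t.fst)
    (h2 : ∀ b, P.fst b ∈ closure (Set.range (star t).fst)) :
    ∃ v : 𝓜(ℂ, B), β.IsInvariant v ∧ star v * v = P ∧ v * star v = 1 := by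
  obtain ⟨s, hs, hss, hs2, hw⟩ := exists_abs_regularized t
  -- Since the invariants form a norm closed real ⋆-algebra, all functional calculus of t⋆t, in
  -- particular every `w n`, is invariant.
  have hle : StarAlgebra.elemental ℝ (star t * t) ≤ β.invariants :=
    StarAlgebra.elemental.le_of_mem isClosed_invariants
      (mul_mem (star_mem (mem_invariants.2 ht)) (mem_invariants.2 ht))
  have hε : ∀ n : ℕ, (0 : ℝ) < 1 / (n + 1) := fun n => by positivity
  choose w hwm hwstar hw1 hw2 hw3 using fun n : ℕ => hw (1 / (n + 1)) (hε n)
  have hPs : star P = P := hP.isSelfAdjoint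
  have hPP : P * P = P := hP.isIdempotentElem
  -- (s(1-P))⋆ s(1-P) = (1-P) t⋆t (1-P), and t(1-P) = 0.
  have hsP : s * P = s := by
    have h3 : star (s * (1 - P)) * (s * (1 - P)) = 0 := by
      calc star (s * (1 - P)) * (s * (1 - P)) = (1 - P) * (s * s) * (1 - P) := by
            rw [star_mul, star_sub, star_one, hPs, hss]; noncomm_ring
        _ = 0 := by rw [hs2, mul_assoc, mul_assoc, mul_sub t, mul_one, htP, sub_self]; simp
    have h4 := (CStarRing.star_mul_self_eq_zero_iff _).1 h3
    rw [mul_sub, mul_one, sub_eq_zero] at h4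
    exact h4.symm
  have hPs' : P * s = s := by
    have := congrArg star hsP
    rwa [star_mul, hss, hPs] at this
  -- The set on which `t * w n` converges visibly: t (w n) s b tends to t b, and t (w n) (1-P) is 0.
  set S : Set B := Set.range s.fst ∪ Set.range (1 - P).fst with hSdef
  have hS : Dense (Submodule.span ℂ S : Set B) := by
    set W := (Submodule.span ℂ S).topologicalClosure with hW
    have hWc : IsClosed (W : Set B) := Submodule.isClosed_topologicalClosure _
    have hsub : S ⊆ W := Submodule.subset_span.trans (Submodule.le_topologicalClosure _)
    -- As t⋆t = s s, the closed span W contains t⋆(tB), hence t⋆B because t has dense range, hence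
    -- PB; together with (1-P)B this is everything.
    have h5 : ∀ b, (star t).fst b ∈ W := by
      have h6 : ∀ b ∈ Set.range t.fst, (star t).fst b ∈ W := by
        rintro _ ⟨b, rfl⟩
        refine hsub (Or.inl ⟨s.fst b, ?_⟩)
        rw [← DoubleCentralizer.mul_fst_apply, ← DoubleCentralizer.mul_fst_apply, hs2]
      exact (star t).fst.mem_of_dense_span hWc (h1.mono Submodule.subset_span) h6
    have h7 : ∀ b, P.fst b ∈ W := fun b =>
      closure_minimal (Set.range_subset_iff.2 h5) hWc (h2 b)
    intro b
    have h8 : b = P.fst b + (1 - P).fst b := by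
      rw [DoubleCentralizer.sub_fst, DoubleCentralizer.one_fst, _root_.sub_apply,
        one_apply_eq_self]
      abel
    change b ∈ W
    rw [h8]
    exact add_mem (h7 b) (hsub (Or.inr ⟨b, rfl⟩))
  -- The square of the norm is ‖w t⋆t w‖ = ‖(ws)(ws)⋆‖, and ws is a contraction.
  have hbound : ∀ n, ‖t * w n‖ ≤ 1 := fun n => by
    have h3 : ‖t * w n‖ * ‖t * w n‖ ≤ 1 := by
      rw [← CStarRing.norm_star_mul_self]
      have : star (t * w n) * (t * w n) = (w n * s) * star (w n * s) := by
        calc star (t * w n) * (t * w n) = w n * (star t * t) * w n := by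
              rw [star_mul, hwstar]; noncomm_ring
          _ = _ := by rw [← hs2, star_mul, hwstar, hss]; noncomm_ring
      rw [this, CStarRing.norm_self_mul_star]
      exact mul_le_one₀ (hw3 n) (norm_nonneg _) (hw3 n)
    nlinarith [norm_nonneg (t * w n)]
  have hlim0 : Tendsto (fun n : ℕ => (1 : ℝ) / (n + 1)) atTop (𝓝 0) :=
    tendsto_one_div_add_atTop_nhds_zero_nat
  have hsmall : ∀ (m : ℕ → 𝓜(ℂ, B)) (_ : ∀ n, ‖m n‖ ≤ 1) (b : B),
      Tendsto (fun n : ℕ => ((1 : ℝ) / (n + 1)) • (m n).fst b) atTop (𝓝 0) := fun m hm b => by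
    refine squeeze_zero_norm (a := fun n : ℕ => (1 : ℝ) / (n + 1) * ‖b‖) (fun n => ?_)
      (by simpa using hlim0.mul_const ‖b‖)
    rw [norm_smul, Real.norm_of_nonneg (hε n).le]
    refine mul_le_mul_of_nonneg_left ?_ (hε n).le
    exact (DoubleCentralizer.norm_fst_apply_le _ _).trans
      (mul_le_of_le_one_left (norm_nonneg _) (hm n))
  have hvs : ∀ b, Tendsto (fun n => (t * w n).fst (s.fst b)) atTop (𝓝 (t.fst b)) := fun b => by
    have h3 : ∀ n, (t * w n).fst (s.fst b)
        = t.fst b - ((1 : ℝ) / (n + 1)) • (t * w n).fst b := fun n => by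
      rw [← DoubleCentralizer.mul_fst_apply, mul_assoc, hw1, mul_sub, mul_one, mul_smul_comm,
        DoubleCentralizer.sub_fst, DoubleCentralizer.smul_fst]
      rfl
    simp only [h3]
    simpa using (hsmall _ hbound b).const_sub (t.fst b)
  -- From ε w = 1 - ws and s(1-P) = 0 follows w(1-P) = ε⁻¹(1-P), which t annihilates.
  have hwP : ∀ n, t * w n * (1 - P) = 0 := fun n => by
    have h3 : w n * (1 - P) = ((1 : ℝ) / (n + 1))⁻¹ • (1 - P) := by
      have h4 : ((1 : ℝ) / (n + 1)) • w n = 1 - w n * s := by rw [hw1]; abel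
      have h5 : w n = ((1 : ℝ) / (n + 1))⁻¹ • (1 - w n * s) := by
        rw [← h4, inv_smul_smul₀ (hε n).ne']
      have h6 : (1 - w n * s) * (1 - P) = 1 - P := by
        rw [sub_mul, one_mul, mul_assoc, mul_sub, mul_one, hsP, sub_self, mul_zero, sub_zero]
      conv_lhs => rw [h5]
      rw [smul_mul_assoc, h6]
    rw [mul_assoc, h3, mul_smul_comm, mul_sub, mul_one, htP, sub_self, smul_zero]
  have hvt : ∀ b, Tendsto (fun n => (star (t * w n)).fst (t.fst b)) atTop (𝓝 (s.fst b)) :=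
    fun b => by
      have h3 : ∀ n, (star (t * w n)).fst (t.fst b)
          = s.fst b - ((1 : ℝ) / (n + 1)) • (w n * s).fst b := fun n => by
        have h4 : star (t * w n) * t = s - ((1 : ℝ) / (n + 1)) • (w n * s) := by
          rw [star_mul, hwstar, mul_assoc, ← hs2, ← mul_assoc]
          nth_rw 1 [hw1]
          rw [sub_mul, one_mul, smul_mul_assoc]
        rw [← DoubleCentralizer.mul_fst_apply, h4, DoubleCentralizer.sub_fst,
          DoubleCentralizer.smul_fst]
        rfl
      simp only [h3]
      simpa using (hsmall _ hw3 b).const_sub (s.fst b)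
  obtain ⟨v, hv, hv'⟩ := DoubleCentralizer.exists_strict_limit (fun n => t * w n) hbound hS
    (h1.mono Submodule.subset_span) (by
      rintro _ (⟨b, rfl⟩ | ⟨b, rfl⟩)
      · exact ⟨_, hvs b⟩
      · refine ⟨0, ?_⟩
        simp only [← DoubleCentralizer.mul_fst_apply, hwP]
        exact tendsto_const_nhds) (by
      rintro _ ⟨b, rfl⟩
      exact ⟨_, hvt b⟩)
  have e1 : v * s = t := DoubleCentralizer.ext_fst <| ContinuousLinearMap.ext fun b => by
    rw [DoubleCentralizer.mul_fst_apply]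
    exact tendsto_nhds_unique (hv _) (hvs b)
  have e2 : v * (1 - P) = 0 := DoubleCentralizer.ext_fst <| ContinuousLinearMap.ext fun b => by
    rw [DoubleCentralizer.mul_fst_apply]
    refine tendsto_nhds_unique (hv _) ?_
    simp only [← DoubleCentralizer.mul_fst_apply, hwP]
    exact tendsto_const_nhds
  have e3 : star v * t = s := DoubleCentralizer.ext_fst <| ContinuousLinearMap.ext fun b => by
    rw [DoubleCentralizer.mul_fst_apply]
    exact tendsto_nhds_unique (hv' _) (hvt b)
  refine ⟨v, IsInvariant.of_tendsto (fun n => ?_) hv, ?_, ?_⟩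
  · exact mul_mem (mem_invariants.2 ht) (hle (hwm n))
  -- v⋆v s = v⋆t = s = P s and v⋆v (1-P) = 0 = P(1-P); the ranges of s and 1-P are jointly total.
  · refine DoubleCentralizer.ext_fst (ContinuousLinearMap.eq_of_dense_span hS ?_)
    rintro _ (⟨b, rfl⟩ | ⟨b, rfl⟩)
    · rw [← DoubleCentralizer.mul_fst_apply, ← DoubleCentralizer.mul_fst_apply, mul_assoc, e1, e3,
        hPs']
    · rw [← DoubleCentralizer.mul_fst_apply, ← DoubleCentralizer.mul_fst_apply, mul_assoc, e2,
        mul_zero, mul_sub, mul_one, hPP, sub_self]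
  -- v v⋆ t = v s = t, and t has dense range.
  · refine DoubleCentralizer.ext_fst (ContinuousLinearMap.eq_of_dense_span
      (h1.mono Submodule.subset_span) ?_)
    rintro _ ⟨b, rfl⟩
    rw [← DoubleCentralizer.mul_fst_apply, ← DoubleCentralizer.mul_fst_apply, mul_assoc, e3, e1,
      one_mul]

/-- Stabilization: an invariant projection `P` that is full in a strong sense, commuting with
an invariant system of matrix units, is equivalent to `1`. -/
theorem GAction.exists_invariant_equivalence {P : 𝓜(ℂ, B)} (hP : IsStarProjection P)
    (hPi : β.IsInvariant P) (E : ℕ → ℕ → 𝓜(ℂ, B))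
    (hE : ∀ i j k, E i j * E j k = E i k) (hE0 : ∀ i j k l, j ≠ k → E i j * E k l = 0)
    (hEs : ∀ i, star (E i i) = E i i) (hEn : ∀ i j, ‖E i j‖ ≤ 1)
    (hEi : ∀ i j, β.IsInvariant (E i j)) (hEP : ∀ i j, P * E i j = E i j * P)
    (hEd : Dense (Submodule.span ℂ (⋃ i, Set.range (E i i).fst) : Set B))
    (L : ℕ → 𝓜(ℂ, B)) (hLn : ∀ k, ‖L k‖ ≤ 1) (hLi : ∀ k, β.IsInvariant (L k))
    (hLd : Dense (Submodule.span ℂ (⋃ k, Set.range (L k * P).fst) : Set B)) :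
    ∃ v : 𝓜(ℂ, B), β.IsInvariant v ∧ star v * v = P ∧ v * star v = 1 := by
  have hPs : star P = P := hP.isSelfAdjoint
  have hPP : P * P = P := hP.isIdempotentElem
  -- Each pair (k, j) equals (κ n, ι n) for infinitely many n, namely for all codes n of ((k, j),
  -- m).
  let κ : ℕ → ℕ := fun n => (Nat.unpair (Nat.unpair n).1).1
  let ι : ℕ → ℕ := fun n => (Nat.unpair (Nat.unpair n).1).2
  have hsum : ∀ (r : ℝ) (_ : 0 ≤ r) (_ : r < 1) (m : ℕ → 𝓜(ℂ, B)) (_ : ∀ n, ‖m n‖ ≤ 1),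
      Summable fun n => r ^ n • m n := fun r h0 h1 m hm => by
    refine Summable.of_norm_bounded (summable_geometric_of_lt_one h0 h1) fun n => ?_
    rw [norm_smul, norm_pow, Real.norm_of_nonneg h0]
    exact mul_le_of_le_one_right (by positivity) (hm n)
  have hs1 := hsum (1 / 2) (by norm_num) (by norm_num) (fun n => L (κ n) * E (ι n) n) fun n =>
    (norm_mul_le _ _).trans (mul_le_one₀ (hLn _) (norm_nonneg _) (hEn _ _))
  have hs2 := hsum (1 / 4) (by norm_num) (by norm_num) (fun n => E n n) fun n => hEn _ _
  -- The weights differ on purpose: after column n is multiplied by 2ⁿ, the contribution of l keeps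
  -- full size while that of D is still of order 2⁻ⁿ.
  set l : 𝓜(ℂ, B) := ∑' n, (1 / 2 : ℝ) ^ n • (L (κ n) * E (ι n) n) with hl
  set D : 𝓜(ℂ, B) := ∑' n, (1 / 4 : ℝ) ^ n • E n n with hD
  have hlE : ∀ n i, l * E n i = (1 / 2 : ℝ) ^ n • (L (κ n) * E (ι n) i) := fun n i => by
    rw [hl, ← hs1.tsum_mul_right, tsum_eq_single n fun m hm => by
      rw [smul_mul_assoc, mul_assoc, hE0 _ _ _ _ hm, mul_zero, smul_zero],
      smul_mul_assoc, mul_assoc, hE]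
  have hDE : ∀ n i, D * E n i = (1 / 4 : ℝ) ^ n • E n i := fun n i => by
    rw [hD, ← hs2.tsum_mul_right, tsum_eq_single n fun m hm => by
      rw [smul_mul_assoc, hE0 _ _ _ _ hm, smul_zero], smul_mul_assoc, hE]
  have hDP : P * D = D * P := by
    rw [hD, ← hs2.tsum_mul_right, ← hs2.tsum_mul_left]
    exact tsum_congr fun n => by rw [mul_smul_comm, smul_mul_assoc, hEP]
  have hDs : star D = D := by
    rw [hD, tsum_star]
    exact tsum_congr fun n => by rw [star_smul, hEs, star_trivial]
  have hli : l ∈ β.invariants := tsum_mem isClosed_invariants fun n =>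
    SMulMemClass.smul_mem _ (mul_mem (mem_invariants.2 (hLi _)) (mem_invariants.2 (hEi _ _)))
  have hDi : D ∈ β.invariants := tsum_mem isClosed_invariants fun n =>
    SMulMemClass.smul_mem _ (mem_invariants.2 (hEi _ _))
  -- The corner P D gives t⋆ a range dense in PB; the off-diagonal corner (1-P) l P makes the range
  -- of t reach the complement of PB.
  set t : 𝓜(ℂ, B) := (1 - P) * l * P + P * D with ht
  have htP : t * P = t := by
    rw [ht, add_mul, mul_assoc _ P P, hPP, mul_assoc P D P, ← hDP, ← mul_assoc P P D, hPP]
  have hti : β.IsInvariant t := add_mem (mul_mem (mul_mem (sub_mem (one_mem _)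
    (mem_invariants.2 hPi)) hli) (mem_invariants.2 hPi)) (mul_mem (mem_invariants.2 hPi) hDi)
  let W : Submodule ℂ B := (LinearMap.range (t.fst : B →ₗ[ℂ] B)).topologicalClosure
  have hWc : IsClosed (W : Set B) := Submodule.isClosed_topologicalClosure _
  have htW : ∀ b, t.fst b ∈ W := fun b => Submodule.le_topologicalClosure _ ⟨b, rfl⟩
  -- Column n of t times 2ⁿ is (1-P)(L k)P E j j plus 2⁻ⁿ P E n j. Letting n run to infinity through
  -- the codes of (k, j) leaves the first term in the closed range.
  have s1 : ∀ k j c, ((1 - P) * (L k * P) * E j j).fst c ∈ W := fun k j c => by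
    let n : ℕ → ℕ := fun m => Nat.pair (Nat.pair k j) m
    have hκ : ∀ m, κ (n m) = k := fun m => by simp [κ, n]
    have hι : ∀ m, ι (n m) = j := fun m => by simp [ι, n]
    have h1 : ∀ m, t * ((2 : ℝ) ^ n m • E (n m) j)
        = (1 - P) * (L k * P) * E j j + (1 / 2 : ℝ) ^ n m • (P * E (n m) j) := fun m => by
      have h2 : (1 - P) * l * P * E (n m) j
          = (1 / 2 : ℝ) ^ n m • ((1 - P) * (L k * P) * E j j) := by
        calc (1 - P) * l * P * E (n m) j = (1 - P) * (l * E (n m) j) * P := by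
              rw [mul_assoc _ P, hEP]; noncomm_ring
          _ = (1 / 2 : ℝ) ^ n m • ((1 - P) * (L k * (E j j * P))) := by
              rw [hlE, hκ, hι, mul_smul_comm, smul_mul_assoc]; noncomm_ring
          _ = _ := by rw [← hEP]; noncomm_ring
      rw [ht, mul_smul_comm, add_mul, h2, mul_assoc P, hDE, mul_smul_comm, smul_add, smul_smul,
        smul_smul, ← mul_pow, ← mul_pow]
      norm_num
    have hn : Tendsto n atTop atTop :=
      tendsto_atTop_mono (fun m => Nat.right_le_pair _ m) tendsto_id
    have hz : Tendsto (fun m => ((1 / 2 : ℝ) ^ n m • (P * E (n m) j)).fst c) atTop (𝓝 0) := by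
      refine squeeze_zero_norm (a := fun m => (1 / 2 : ℝ) ^ n m * (‖P‖ * ‖c‖)) (fun m => ?_) ?_
      · refine (DoubleCentralizer.norm_fst_apply_le _ _).trans ?_
        rw [norm_smul, norm_pow, Real.norm_of_nonneg (by norm_num : (0 : ℝ) ≤ 1 / 2), mul_assoc]
        gcongr
        exact (norm_mul_le _ _).trans (mul_le_of_le_one_right (norm_nonneg _) (hEn _ _))
      · simpa using ((tendsto_pow_atTop_nhds_zero_of_lt_one (by norm_num : (0 : ℝ) ≤ 1 / 2)
          (by norm_num)).comp hn).mul_const (‖P‖ * ‖c‖)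
    refine hWc.mem_of_tendsto (b := atTop)
      (f := fun m => (t * ((2 : ℝ) ^ n m • E (n m) j)).fst c) ?_
      (Eventually.of_forall fun m => ?_)
    · simp only [h1, DoubleCentralizer.add_fst, _root_.add_apply]
      simpa using hz.const_add (((1 - P) * (L k * P) * E j j).fst c)
    · rw [DoubleCentralizer.mul_fst_apply]
      exact htW _
  have s2 : ∀ k c, ((1 - P) * (L k * P)).fst c ∈ W := fun k =>
    ContinuousLinearMap.mem_of_dense_span _ hWc hEd fun b hb => by
      obtain ⟨j, c, rfl⟩ := Set.mem_iUnion.1 hb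
      rw [← DoubleCentralizer.mul_fst_apply]
      exact s1 k j c
  have s3 : ∀ c, (1 - P).fst c ∈ W :=
    ContinuousLinearMap.mem_of_dense_span _ hWc hLd fun b hb => by
      obtain ⟨k, c, rfl⟩ := Set.mem_iUnion.1 hb
      rw [← DoubleCentralizer.mul_fst_apply]
      exact s2 k c
  -- t applied to 4ʲ E j j gives P E j j plus a term in (1-P)B, and the latter is in W by `s3`.
  have s4 : ∀ c, P.fst c ∈ W :=
    ContinuousLinearMap.mem_of_dense_span _ hWc hEd fun b hb => by
      obtain ⟨j, c, rfl⟩ := Set.mem_iUnion.1 hb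
      rw [← DoubleCentralizer.mul_fst_apply]
      have h1 : P * E j j = t * ((4 : ℝ) ^ j • E j j)
          - (1 - P) * (l * P * ((4 : ℝ) ^ j • E j j)) := by
        have h4 : (4 : ℝ) ^ j • (1 / 4 : ℝ) ^ j • (P * E j j) = P * E j j := by
          rw [smul_smul, ← mul_pow]; norm_num
        rw [ht, add_mul, mul_assoc P, mul_smul_comm _ D, hDE, mul_smul_comm _ P,
          mul_smul_comm _ P, h4]
        noncomm_ring
      rw [h1, DoubleCentralizer.sub_fst, _root_.sub_apply, DoubleCentralizer.mul_fst_apply t,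
        DoubleCentralizer.mul_fst_apply (1 - P)]
      exact sub_mem (htW _) (s3 _)
  refine exists_invariant_polar hti hP htP (fun b => ?_) fun b => ?_
  · have h1 : b = P.fst b + (1 - P).fst b := by
      rw [DoubleCentralizer.sub_fst, DoubleCentralizer.one_fst, _root_.sub_apply,
        one_apply_eq_self]
      abel
    change b ∈ W
    rw [h1]
    exact add_mem (s4 b) (s3 b)
  · let W' : Submodule ℂ B := (LinearMap.range ((star t).fst : B →ₗ[ℂ] B)).topologicalClosure
    change P.fst b ∈ W'
    refine ContinuousLinearMap.mem_of_dense_span _ (Submodule.isClosed_topologicalClosure _) hEd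
      (fun b hb => ?_) b
    obtain ⟨j, c, rfl⟩ := Set.mem_iUnion.1 hb
    -- t⋆ = P l⋆ (1-P) + D P: the first summand vanishes on PB, and the factor 4ʲ inverts D on the
    -- range of E j j.
    have h1 : star t * (P * ((4 : ℝ) ^ j • E j j)) = P * E j j := by
      have h2 : (1 - P) * P = 0 := by rw [sub_mul, one_mul, hPP, sub_self]
      have h4 : (4 : ℝ) ^ j • (1 / 4 : ℝ) ^ j • (P * E j j) = P * E j j := by
        rw [smul_smul, ← mul_pow]; norm_num
      calc star t * (P * ((4 : ℝ) ^ j • E j j))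
          = P * star l * ((1 - P) * P) * ((4 : ℝ) ^ j • E j j)
            + D * (P * P) * ((4 : ℝ) ^ j • E j j) := by
            rw [ht, star_add, star_mul, star_mul, star_mul, star_sub, star_one, hPs, hDs]
            generalize (4 : ℝ) ^ j • E j j = X
            noncomm_ring
        _ = P * E j j := by
            rw [h2, hPP, mul_zero, zero_mul, zero_add, ← hDP, mul_smul_comm, mul_assoc, hDE,
              mul_smul_comm, h4]
    rw [← DoubleCentralizer.mul_fst_apply, ← h1, DoubleCentralizer.mul_fst_apply]
    exact Submodule.le_topologicalClosure _ ⟨_, rfl⟩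

end PolarDecomposition

/-! ### The multipliers `m ⊗ 1` and `1 ⊗ m` of a balanced tensor product -/

section TensorMultipliers

open TensorProduct UniformSpace InverseSemigroup
open scoped MultiplierAlgebra

variable {G A B : Type*} [InverseSemigroup G] [NonUnitalCStarAlgebra A] [NonUnitalCStarAlgebra B]

namespace AlgTensor

variable {α : GAction G A} {β : GAction G B}

/-- `id ⊗ T` on the algebraic tensor product. -/
noncomputable def mapRight (α : GAction G A) (β : GAction G B) (T : B →L[ℂ] B) :
    AlgTensor α β →ₗ[ℂ] AlgTensor α β :=
  TensorProduct.map LinearMap.id (T : B →ₗ[ℂ] B)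

theorem mapRight_mk (T : B →L[ℂ] B) (a : A) (b : B) :
    mapRight α β T (mk α β a b) = mk α β a (T b) := rfl

theorem mapRight_add (S T : B →L[ℂ] B) (x : AlgTensor α β) :
    mapRight α β (S + T) x = mapRight α β S x + mapRight α β T x := by
  induction x using AlgTensor.induction with
  | h0 => simp
  | ht a b => exact TensorProduct.tmul_add _ _ _
  | ha x y hx hy => rw [map_add, map_add, map_add, hx, hy]; abel

theorem mapRight_real_smul_one (r : ℝ) (x : AlgTensor α β) :
    mapRight α β ((algebraMap ℝ 𝓜(ℂ, B) r).fst) x = (r : ℂ) • x := by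
  have h : ∀ b, (algebraMap ℝ 𝓜(ℂ, B) r).fst b = (r : ℂ) • b := fun b => by
    rw [Algebra.algebraMap_eq_smul_one]
    change ((r : ℝ) • (1 : 𝓜(ℂ, B))).fst b = _
    rfl
  induction x using AlgTensor.induction with
  | h0 => simp
  | ht a b => rw [mapRight_mk, h]; exact TensorProduct.tmul_smul _ _ _
  | ha x y hx hy => rw [map_add, hx, hy, smul_add]

theorem star_mapRight_mul (m n : 𝓜(ℂ, B)) (x y : AlgTensor α β) :
    star (mapRight α β m.fst x) * mapRight α β n.fst y
      = star x * mapRight α β (star m * n).fst y := by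
  induction x using AlgTensor.induction with
  | h0 => simp
  | ha x x' hx hx' => rw [map_add, star_add, add_mul, hx, hx', star_add, add_mul]
  | ht a b =>
    induction y using AlgTensor.induction with
    | h0 => simp
    | ha y y' hy hy' => rw [map_add, mul_add, hy, hy', map_add, mul_add]
    | ht a' b' =>
      rw [mapRight_mk, mapRight_mk, mapRight_mk, mk_star, mk_star, mk_mul, mk_mul]
      congr 1
      rw [DoubleCentralizer.mul_fst, _root_.mul_apply_eq_comp, ← (star m).central,
        DoubleCentralizer.star_snd, star_star]

theorem star_mapRight_snd (m : 𝓜(ℂ, B)) (x : AlgTensor α β) :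
    star (mapRight α β m.snd x) = mapRight α β (star m).fst (star x) := by
  induction x using AlgTensor.induction with
  | h0 => simp
  | ha x x' hx hx' => rw [map_add, star_add, hx, hx', star_add, map_add]
  | ht a b =>
    rw [mapRight_mk, mk_star, mk_star, mapRight_mk, DoubleCentralizer.star_fst, star_star]

theorem mapRight_central (m : 𝓜(ℂ, B)) (x y : AlgTensor α β) :
    mapRight α β m.snd x * y = x * mapRight α β m.fst y := by
  induction x using AlgTensor.induction with
  | h0 => simp
  | ha x x' hx hx' => rw [map_add, add_mul, hx, hx', add_mul]
  | ht a b =>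
    induction y using AlgTensor.induction with
    | h0 => simp
    | ha y y' hy hy' => rw [map_add, mul_add, hy, hy', mul_add]
    | ht a' b' => rw [mapRight_mk, mapRight_mk, mk_mul, mk_mul, m.central]

/-- Writing ‖m‖² - m⋆m = c⋆c gives ‖m‖² x⋆x = (cx)⋆(cx) + (mx)⋆(mx). In the completion (mx)⋆(mx) is
thus dominated by ‖m‖² x⋆x, and the norm is monotone on positive elements. -/
theorem norm_mapRight_fst_le (m : 𝓜(ℂ, B)) (x : AlgTensor α β) :
    ‖mapRight α β m.fst x‖ ≤ ‖m‖ * ‖x‖ := by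
  let _ := CStarAlgebra.spectralOrder 𝓜(ℂ, B)
  have := CStarAlgebra.spectralOrderedRing 𝓜(ℂ, B)
  let _ := CStarAlgebra.spectralOrder (Completion (AlgTensor α β))
  have := CStarAlgebra.spectralOrderedRing (Completion (AlgTensor α β))
  have hm : 0 ≤ algebraMap ℝ 𝓜(ℂ, B) (‖m‖ ^ 2) - star m * m :=
    sub_nonneg.2 CStarAlgebra.star_mul_le_algebraMap_norm_sq
  obtain ⟨c, hc⟩ := CStarAlgebra.nonneg_iff_eq_star_mul_self.1 hm
  have h1 : algebraMap ℝ 𝓜(ℂ, B) (‖m‖ ^ 2) = star c * c + star m * m := by rw [← hc]; abel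
  have h2 : ((‖m‖ ^ 2 : ℝ) : ℂ) • (star x * x)
      = star (mapRight α β c.fst x) * mapRight α β c.fst x
        + star (mapRight α β m.fst x) * mapRight α β m.fst x := by
    rw [star_mapRight_mul, star_mapRight_mul, ← mul_add, ← mapRight_add,
      ← DoubleCentralizer.add_fst, ← h1, mapRight_real_smul_one, mul_smul_comm]
  have h3 := congrArg (fun z : AlgTensor α β => (z : Completion (AlgTensor α β))) h2
  simp only [Completion.coe_add, PreCStarAlgebra.coe_mul, PreCStarAlgebra.coe_star] at h3
  have h4 : star ((mapRight α β m.fst x : AlgTensor α β) : Completion (AlgTensor α β))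
        * (mapRight α β m.fst x : AlgTensor α β)
      ≤ ((((‖m‖ ^ 2 : ℝ) : ℂ) • (star x * x) : AlgTensor α β) : Completion (AlgTensor α β)) := by
    rw [h3]
    exact le_add_of_nonneg_left (star_mul_self_nonneg _)
  have h5 := CStarAlgebra.norm_le_norm_of_nonneg_of_le (star_mul_self_nonneg _) h4
  rw [CStarRing.norm_star_mul_self, Completion.norm_coe, Completion.norm_coe, norm_smul,
    PreCStarAlgebra.norm_star_mul_self_eq, Complex.norm_real, Real.norm_of_nonneg (by positivity)]
    at h5
  refine (pow_le_pow_iff_left₀ (norm_nonneg _) (by positivity) two_ne_zero).1 ?_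
  calc _ = _ := sq _
    _ ≤ _ := h5
    _ = _ := by ring

theorem norm_mapRight_snd_le (m : 𝓜(ℂ, B)) (x : AlgTensor α β) :
    ‖mapRight α β m.snd x‖ ≤ ‖m‖ * ‖x‖ := by
  rw [← PreCStarAlgebra.norm_star_eq, star_mapRight_snd, ← PreCStarAlgebra.norm_star_eq x,
    ← norm_star m]
  exact norm_mapRight_fst_le _ _

end AlgTensor

/-- The multiplier `1 ⊗ m` of `A ⊗^X B`, determined by `(1 ⊗ m)(a ⊗ b) = a ⊗ m b`. -/
noncomputable def oneTensor (α : GAction G A) (β : GAction G B) (m : 𝓜(ℂ, B)) :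
    𝓜(ℂ, BalTensor α β) where
  fst := ((AlgTensor.mapRight α β m.fst).mkContinuous ‖m‖
    (AlgTensor.norm_mapRight_fst_le m)).completion
  snd := ((AlgTensor.mapRight α β m.snd).mkContinuous ‖m‖
    (AlgTensor.norm_mapRight_snd_le m)).completion
  central x y := Completion.induction_on₂ x y (isClosed_eq (by fun_prop) (by fun_prop))
    fun x y => by
      rw [ContinuousLinearMap.completion_apply_coe, ContinuousLinearMap.completion_apply_coe,
        ← PreCStarAlgebra.coe_mul, ← PreCStarAlgebra.coe_mul]
      exact congrArg _ (AlgTensor.mapRight_central m x y)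

theorem oneTensor_fst_tmul (α : GAction G A) (β : GAction G B) (m : 𝓜(ℂ, B)) (a : A) (b : B) :
    (oneTensor α β m).fst (BalTensor.tmul α β a b) = BalTensor.tmul α β a (m.fst b) :=
  ContinuousLinearMap.completion_apply_coe _ _

theorem oneTensor_snd_tmul (α : GAction G A) (β : GAction G B) (m : 𝓜(ℂ, B)) (a : A) (b : B) :
    (oneTensor α β m).snd (BalTensor.tmul α β a b) = BalTensor.tmul α β a (m.snd b) :=
  ContinuousLinearMap.completion_apply_coe _ _

namespace BalTensor

variable (α : GAction G A) (β : GAction G B)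

/-- The elementary tensor `a ⊗ b` as a continuous bilinear map. -/
noncomputable def tmulL : A →L[ℂ] B →L[ℂ] BalTensor α β :=
  LinearMap.mkContinuous₂
    (LinearMap.mk₂ ℂ (tmul α β)
      (fun a a' b => by
        rw [tmul, AlgTensor.mk_add_left, Completion.coe_add]; rfl)
      (fun c a b => by
        rw [tmul, tmul, ← Completion.coe_smul]
        exact congrArg _ (TensorProduct.smul_tmul' c a b).symm)
      (fun a b b' => by
        rw [tmul, tmul, tmul, ← Completion.coe_add]
        exact congrArg _ (TensorProduct.tmul_add a b b'))
      (fun c a b => by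
        rw [tmul, tmul, ← Completion.coe_smul]
        exact congrArg _ (TensorProduct.tmul_smul c a b))) 1
    fun a b => by
      change ‖tmul α β a b‖ ≤ _
      rw [one_mul, tmul, Completion.norm_coe]
      exact AlgTensor.norm_mk_le a b

theorem tmul_star (a : A) (b : B) : star (tmul α β a b) = tmul α β (star a) (star b) := by
  rw [tmul, ← PreCStarAlgebra.coe_star, AlgTensor.mk_star, tmul]

/-- The elementary tensors are total. -/
theorem dense_span_tmul :
    Dense (Submodule.span ℂ (Set.range fun x : A × B => tmul α β x.1 x.2) :
      Set (BalTensor α β)) := by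
  set W := (Submodule.span ℂ
    (Set.range fun x : A × B => tmul α β x.1 x.2)).topologicalClosure with hW
  have hc : IsClosed (W : Set (BalTensor α β)) := Submodule.isClosed_topologicalClosure _
  intro x
  change x ∈ W
  refine Completion.induction_on x hc fun x => ?_
  induction x using AlgTensor.induction with
  | h0 => rw [Completion.coe_zero]; exact zero_mem _
  | ht a b => exact Submodule.le_topologicalClosure _ (Submodule.subset_span ⟨(a, b), rfl⟩)
  | ha x y hx hy => rw [Completion.coe_add]; exact add_mem hx hy

variable {α β}

/-- Elementary tensors are total and the left action determines a multiplier, so identities between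
multipliers can be read off from a ⊗ b. -/
theorem multiplier_ext {m n : 𝓜(ℂ, BalTensor α β)}
    (h : ∀ a b, m.fst (tmul α β a b) = n.fst (tmul α β a b)) : m = n :=
  DoubleCentralizer.ext_fst (ContinuousLinearMap.eq_of_dense_span (dense_span_tmul α β) (by
    rintro _ ⟨⟨a, b⟩, rfl⟩
    exact h a b))

end BalTensor

open BalTensor DoubleCentralizer

/-- `m ↦ m ⊗ 1` as a `⋆`-homomorphism. -/
noncomputable def tensorOneHom (α : GAction G A) (β : GAction G B) :
    𝓜(ℂ, A) →⋆ₐ[ℂ] 𝓜(ℂ, BalTensor α β) where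
  toFun := tensorOne α β
  map_one' := tensorOne_one α β
  map_mul' m n := multiplier_ext fun a b => by
    rw [mul_fst_apply, tensorOne_fst_tmul, tensorOne_fst_tmul, tensorOne_fst_tmul, mul_fst_apply]
  map_zero' := multiplier_ext fun a b => by
    rw [tensorOne_fst_tmul, zero_fst, zero_fst]
    exact congrArg (fun f => f b) (map_zero (tmulL α β))
  map_add' m n := multiplier_ext fun a b => by
    rw [add_fst, _root_.add_apply, tensorOne_fst_tmul, tensorOne_fst_tmul, tensorOne_fst_tmul,
      add_fst, _root_.add_apply]
    exact congrArg (fun f => f b) (map_add (tmulL α β) _ _)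
  commutes' c := multiplier_ext fun a b => by
    rw [tensorOne_fst_tmul, algebraMap_fst, algebraMap_fst]
    exact congrArg (fun f => f b) (map_smul (tmulL α β) c a)
  map_star' m := multiplier_ext fun a b => by
    rw [star_fst, tmul_star, tensorOne_fst_tmul, tensorOne_snd_tmul, tmul_star, star_star, star_fst]

theorem tensorOneHom_apply (α : GAction G A) (β : GAction G B) (m : 𝓜(ℂ, A)) :
    tensorOneHom α β m = tensorOne α β m := rfl

/-- `m ↦ 1 ⊗ m` as a `⋆`-homomorphism. -/
noncomputable def oneTensorHom (α : GAction G A) (β : GAction G B) :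
    𝓜(ℂ, B) →⋆ₐ[ℂ] 𝓜(ℂ, BalTensor α β) where
  toFun := oneTensor α β
  map_one' := multiplier_ext fun a b => oneTensor_fst_tmul α β 1 a b
  map_mul' m n := multiplier_ext fun a b => by
    rw [mul_fst_apply, oneTensor_fst_tmul, oneTensor_fst_tmul, oneTensor_fst_tmul, mul_fst_apply]
  map_zero' := multiplier_ext fun a b => by
    rw [oneTensor_fst_tmul, zero_fst, zero_fst]
    exact map_zero (tmulL α β a)
  map_add' m n := multiplier_ext fun a b => by
    rw [add_fst, _root_.add_apply, oneTensor_fst_tmul, oneTensor_fst_tmul, oneTensor_fst_tmul,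
      add_fst, _root_.add_apply]
    exact map_add (tmulL α β a) _ _
  commutes' c := multiplier_ext fun a b => by
    rw [oneTensor_fst_tmul, algebraMap_fst, algebraMap_fst]
    exact map_smul (tmulL α β a) c b
  map_star' m := multiplier_ext fun a b => by
    rw [star_fst, tmul_star, oneTensor_fst_tmul, oneTensor_snd_tmul, tmul_star, star_star, star_fst]

theorem tensorOne_mul_oneTensor (α : GAction G A) (β : GAction G B) (m : 𝓜(ℂ, A)) (n : 𝓜(ℂ, B)) :
    tensorOne α β m * oneTensor α β n = oneTensor α β n * tensorOne α β m :=
  multiplier_ext fun a b => by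
    rw [mul_fst_apply, mul_fst_apply, oneTensor_fst_tmul, tensorOne_fst_tmul, tensorOne_fst_tmul,
      oneTensor_fst_tmul]

/-- Compatibility of two multipliers `m, m'` with `α_g`: `α_g(m a) = m' α_g(a)`. -/
def GAction.Intertwines (α : GAction G A) (g : G) (m m' : 𝓜(ℂ, A)) : Prop :=
  ∀ a, α.act g (m.fst a) = m'.fst (α.act g a)

namespace GAction

/-- Intertwining pairs handle multipliers that G moves, such as a ↦ α_g(a) here; invariance is the
diagonal case `isInvariant_iff`. -/
theorem Intertwines.coe (α : GAction G A) (g : G) (a : A) :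
    α.Intertwines g (a : 𝓜(ℂ, A)) (α.act g a : A) := fun b => by
  rw [coe_fst, coe_fst]
  exact map_mul (α.act g) a b

theorem Intertwines.ext_dense {α : GAction G A} {g : G} {m m' : 𝓜(ℂ, A)} {S : Set A}
    (hS : Dense (Submodule.span ℂ S : Set A))
    (h : ∀ a ∈ S, α.act g (m.fst a) = m'.fst (α.act g a)) : α.Intertwines g m m' := fun a =>
  congrArg (fun f : A →L[ℂ] A => f a) (ContinuousLinearMap.eq_of_dense_span
    (T := (α.actL g).comp m.fst) (T' := m'.fst.comp (α.actL g)) hS h)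

variable {α : GAction G A} {β : GAction G B} {g : G}

theorem Intertwines.tensorOne {m m' : 𝓜(ℂ, A)} (h : α.Intertwines g m m') :
    (BalTensor.action α β).Intertwines g (tensorOne α β m) (tensorOne α β m') :=
  Intertwines.ext_dense (dense_span_tmul α β) (by
    rintro _ ⟨⟨a, b⟩, rfl⟩
    change actHom α β g _ = (_root_.tensorOne α β m').fst (actHom α β g _)
    rw [tensorOne_fst_tmul, actHom_tmul, actHom_tmul, tensorOne_fst_tmul, h])

theorem Intertwines.oneTensor {m m' : 𝓜(ℂ, B)} (h : β.Intertwines g m m') :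
    (BalTensor.action α β).Intertwines g (oneTensor α β m) (oneTensor α β m') :=
  Intertwines.ext_dense (dense_span_tmul α β) (by
    rintro _ ⟨⟨a, b⟩, rfl⟩
    change actHom α β g _ = (_root_.oneTensor α β m').fst (actHom α β g _)
    rw [oneTensor_fst_tmul, actHom_tmul, actHom_tmul, oneTensor_fst_tmul, h])

theorem isInvariant_iff {m : 𝓜(ℂ, A)} : α.IsInvariant m ↔ ∀ g, α.Intertwines g m m :=
  forall_congr' fun _ => forall_congr' fun _ => eq_comm

end GAction

/-- `m' = e(m)` for an idempotent `e`, in the sense that `m' a = α_e(m a)`. -/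
def GAction.Cuts (α : GAction G A) (e : G) (m m' : 𝓜(ℂ, A)) : Prop :=
  ∀ a, α.act e (m.fst a) = m'.fst a

/-- Since e acts as a central multiplier, it may be applied to the factor a instead of the product
ab. -/
theorem GAction.Cuts.coe (α : GAction G A) {e : G} (he : e * e = e) (a : A) :
    α.Cuts e (a : 𝓜(ℂ, A)) (α.act e a : A) := fun b => by
  rw [coe_fst, coe_fst]
  change α.act e (a * b) = α.act e a * b
  rw [α.act_idem_mul he, α.compat_idem he]

/-- The balancing relation collects both copies of e in e(a) ⊗ e(mb) on the second factor, where
they merge into one. -/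
theorem GAction.Cuts.oneTensor {α : GAction G A} {β : GAction G B} {e : G} (he : e * e = e)
    {m m' : 𝓜(ℂ, B)} (h : β.Cuts e m m') :
    (BalTensor.action α β).Cuts e (oneTensor α β m) (oneTensor α β m') := fun a =>
  congrArg (fun f : BalTensor α β →L[ℂ] BalTensor α β => f a)
    (ContinuousLinearMap.eq_of_dense_span (T := ((BalTensor.action α β).actL e).comp _)
      (T' := (_root_.oneTensor α β m').fst) (dense_span_tmul α β) (by
    rintro _ ⟨⟨a, b⟩, rfl⟩
    change actHom α β e ((_root_.oneTensor α β m).fst _) = _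
    rw [oneTensor_fst_tmul, actHom_tmul, oneTensor_fst_tmul, tmul_balanced e he, ← β.act_mul, he,
      h]))

/-- The balancing relation for multipliers. -/
theorem tensorOne_act_mul_oneTensor (α : GAction G A) (β : GAction G B) {e : G} (he : e * e = e)
    (a : A) {m m' : 𝓜(ℂ, B)} (h : β.Cuts e m m') :
    tensorOne α β (α.act e a : A) * oneTensor α β m
      = tensorOne α β (a : 𝓜(ℂ, A)) * oneTensor α β m' :=
  multiplier_ext fun x y => by
    rw [mul_fst_apply, mul_fst_apply, oneTensor_fst_tmul, oneTensor_fst_tmul, tensorOne_fst_tmul,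
      tensorOne_fst_tmul, coe_fst, coe_fst]
    change BalTensor.tmul α β (α.act e a * x) (m.fst y) = BalTensor.tmul α β (a * x) (m'.fst y)
    rw [α.compat_idem he, ← α.act_idem_mul he, tmul_balanced e he, h]

end TensorMultipliers

/-! ### Adjointable operators as multipliers of the compact operators -/

namespace HilbertModule

open CStarModule
open scoped MultiplierAlgebra

variable {B E : Type*} [NonUnitalCStarAlgebra B] [PartialOrder B] [StarOrderedRing B]
  [NormedAddCommGroup E] [NormedSpace ℂ E] [SMul B E] [CStarModule B E]

theorem adjointable_ext {S T : adjointable B E}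
    (h : ∀ x, (S : E →L[ℂ] E) x = (T : E →L[ℂ] E) x) : S = T :=
  Subtype.ext (ContinuousLinearMap.ext h)

/-- Adjointability forces B-linearity: move T to the other side of the inner product and pull b out
there. -/
theorem adjointable_smul_apply (T : adjointable B E) (b : B) (x : E) :
    (T : E →L[ℂ] E) (b • x) = b • (T : E →L[ℂ] E) x :=
  ext_inner B fun z => by
    rw [← adj_inner, inner_op_smul_right, adj_inner, inner_op_smul_right]

theorem theta_apply (x y z : E) :
    ((theta x y : adjointable B E) : E →L[ℂ] E) z = inner B y z • x := rfl

theorem star_theta (x y : E) : star (theta x y : adjointable B E) = theta y x :=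
  star_eq_of _ _ fun z w => by simp [theta_apply]

theorem mul_theta (T : adjointable B E) (x y : E) :
    T * theta x y = theta ((T : E →L[ℂ] E) x) y := adjointable_ext fun z => by
  change (T : E →L[ℂ] E) (inner B y z • x) = inner B y z • (T : E →L[ℂ] E) x
  rw [adjointable_smul_apply]

variable (B) in
/-- `x ↦ θ_{x,y}` as a continuous linear map. -/
noncomputable def thetaL (y : E) : E →L[ℂ] adjointable B E :=
  LinearMap.mkContinuous
    { toFun := fun x => theta x y
      map_add' := fun x x' => adjointable_ext fun z => smul_add_module _ _ _
      map_smul' := fun c x => adjointable_ext fun z => ext_inner B fun w => by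
        change inner B w (inner B y z • (c • x)) = inner B w (c • (inner B y z • x))
        rw [inner_op_smul_right, inner_smul_right_complex, inner_smul_right_complex,
          inner_op_smul_right, mul_smul_comm] } ‖y‖ fun x => by
    refine ContinuousLinearMap.opNorm_le_bound (rankOne (B := B) x y) (by positivity) fun z => ?_
    refine (norm_smul_module_le _ _).trans ?_
    calc ‖inner B y z‖ * ‖x‖ ≤ (‖y‖ * ‖z‖) * ‖x‖ := by gcongr; exact norm_inner_le E
      _ = ‖y‖ * ‖x‖ * ‖z‖ := by ring

variable [CompleteSpace E]

/-- A closed right ideal that contains `θ_{x,y}` for `x` in a total set contains all compact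
operators. -/
theorem compacts_le_of_theta_mem {W : Submodule ℂ (adjointable B E)}
    (hW : IsClosed (W : Set (adjointable B E)))
    (hr : ∀ S ∈ W, ∀ T ∈ compacts B E, S * T ∈ W) {X : Set E}
    (hX : Dense (Submodule.span ℂ X : Set E))
    (hθ : ∀ x ∈ X, ∀ y, (theta x y : adjointable B E) ∈ W) {T : adjointable B E}
    (hT : T ∈ compacts B E) : T ∈ W := by
  have hθ' : ∀ x y, (theta x y : adjointable B E) ∈ W := fun x y =>
    (thetaL B y).mem_of_dense_span hW hX (fun x hx => hθ x hx y) x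
  -- W absorbs compacts only on the right, so T⋆ has to be carried along in the induction: (ST)⋆ =
  -- T⋆S⋆ is in W because T⋆ is in W and S⋆ is compact.
  have h : ∀ T ∈ NonUnitalStarAlgebra.adjoin ℂ
      {T : adjointable B E | ∃ x y : E, T = theta x y},
      T ∈ compacts B E ∧ T ∈ W ∧ star T ∈ W := fun T hT => by
    refine ⟨NonUnitalStarSubalgebra.le_topologicalClosure _ hT, ?_⟩
    induction hT using NonUnitalStarAlgebra.adjoin_induction with
    | mem T hT =>
      obtain ⟨x, y, rfl⟩ := hT
      rw [star_theta]
      exact ⟨hθ' x y, hθ' y x⟩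
    | zero => rw [star_zero]; exact ⟨zero_mem _, zero_mem _⟩
    | add S T _ _ hS hT => rw [star_add]; exact ⟨add_mem hS.1 hT.1, add_mem hS.2 hT.2⟩
    | smul c T _ hT => rw [star_smul]; exact ⟨W.smul_mem _ hT.1, W.smul_mem _ hT.2⟩
    | mul S T hS' hT' hS hT =>
      rw [star_mul]
      exact ⟨hr _ hS.1 _ (NonUnitalStarSubalgebra.le_topologicalClosure _ hT'),
        hr _ hT.2 _ (star_mem (NonUnitalStarSubalgebra.le_topologicalClosure _ hS'))⟩
    | star T _ hT => rw [star_star]; exact ⟨hT.2, hT.1⟩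
  exact closure_minimal (fun T hT => (h T hT).2.1) hW hT

/-- `θ_{x,y}` as a compact operator. -/
noncomputable def Compacts.theta (x y : E) : Compacts B E :=
  ⟨HilbertModule.theta x y, theta_mem x y⟩

theorem Compacts.theta_val (x y : E) :
    (Compacts.theta x y : Compacts B E).val = HilbertModule.theta x y := rfl

/-- T θ_{x,y} = θ_{Tx,y}, and the S with TS compact form a closed subspace absorbing compacts on the
right. -/
theorem mul_mem_compacts (T : adjointable B E) {S : adjointable B E} (hS : S ∈ compacts B E) :
    T * S ∈ compacts B E := by
  let W : Submodule ℂ (adjointable B E) :=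
    (compacts B E).toNonUnitalSubalgebra.toSubmodule.comap (LinearMap.mulLeft ℂ T)
  have hW : IsClosed (W : Set (adjointable B E)) :=
    IsClosed.preimage (continuous_const_mul T) (inferInstance :
      IsClosed (compacts B E : Set (adjointable B E)))
  refine compacts_le_of_theta_mem hW (fun S hS S' hS' => ?_) (X := Set.univ)
    (by simp) (fun x _ y => ?_) hS
  · change T * (S * S') ∈ compacts B E
    rw [← mul_assoc]
    exact mul_mem hS hS'
  · change T * theta x y ∈ compacts B E
    rw [mul_theta]
    exact theta_mem _ _

theorem compacts_mul_mem (T : adjointable B E) {S : adjointable B E} (hS : S ∈ compacts B E) :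
    S * T ∈ compacts B E := by
  have := star_mem (mul_mem_compacts (star T) (star_mem hS))
  rwa [star_mul, star_star, star_star] at this

/-- An adjointable operator as a multiplier of the compact operators. -/
noncomputable def toMultiplier (T : adjointable B E) : 𝓜(ℂ, Compacts B E) where
  fst := LinearMap.mkContinuous
    { toFun := fun S => ⟨T * S.val, mul_mem_compacts T S.2⟩
      map_add' := fun S S' => Compacts.ext (mul_add T S.val S'.val)
      map_smul' := fun c S => Compacts.ext (mul_smul_comm c T S.val) } ‖T‖
    fun S => norm_mul_le T S.val
  snd := LinearMap.mkContinuous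
    { toFun := fun S => ⟨S.val * T, compacts_mul_mem T S.2⟩
      map_add' := fun S S' => Compacts.ext (add_mul S.val S'.val T)
      map_smul' := fun c S => Compacts.ext (smul_mul_assoc c S.val T) } ‖T‖
    fun S => (norm_mul_le S.val T).trans_eq (mul_comm _ _)
  central x y := Compacts.ext (mul_assoc x.val T y.val)

theorem toMultiplier_fst_val (T : adjointable B E) (S : Compacts B E) :
    ((toMultiplier T).fst S).val = T * S.val := rfl

theorem toMultiplier_mul (S T : adjointable B E) :
    toMultiplier (S * T) = toMultiplier S * toMultiplier T :=
  DoubleCentralizer.ext_fst <| ContinuousLinearMap.ext fun R => Compacts.ext <| by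
    rw [DoubleCentralizer.mul_fst_apply, toMultiplier_fst_val, toMultiplier_fst_val,
      toMultiplier_fst_val, mul_assoc]

theorem toMultiplier_zero : toMultiplier (0 : adjointable B E) = 0 :=
  DoubleCentralizer.ext_fst <| ContinuousLinearMap.ext fun R => Compacts.ext <| by
    rw [toMultiplier_fst_val, zero_mul]; rfl

theorem toMultiplier_star (T : adjointable B E) :
    toMultiplier (star T) = star (toMultiplier T) :=
  DoubleCentralizer.ext_fst <| ContinuousLinearMap.ext fun R => Compacts.ext <| by
    rw [toMultiplier_fst_val, DoubleCentralizer.star_fst]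
    change star T * R.val = star (star R.val * T)
    rw [star_mul, star_star]

/-- A totality test inside 𝓚(E): as 𝓚(E) is closed in 𝓛(E), the closed span of Y is closed there
too, and `compacts_le_of_theta_mem` applies. It yields totality of the ranges of the matrix units
and of the projections onto the φ_g. -/
theorem dense_span_of_theta {X : Set E} (hX : Dense (Submodule.span ℂ X : Set E))
    {Y : Set (Compacts B E)} (hr : ∀ S ∈ Y, ∀ T, S * T ∈ Y)
    (hθ : ∀ x ∈ X, ∀ y, ∃ S ∈ Y, S.val = theta x y) :
    Dense (Submodule.span ℂ Y : Set (Compacts B E)) := by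
  set V := (Submodule.span ℂ Y).topologicalClosure with hV
  have hVc : IsClosed (V : Set (Compacts B E)) := Submodule.isClosed_topologicalClosure _
  have hVr : ∀ S ∈ V, ∀ T, S * T ∈ V := fun S hS T => by
    have h1 : Submodule.span ℂ Y ≤ V.comap (LinearMap.mulRight ℂ T) :=
      Submodule.span_le.2 fun S hS =>
        Submodule.le_topologicalClosure _ (Submodule.subset_span (hr S hS T))
    exact closure_minimal h1 (hVc.preimage (continuous_mul_const T)) hS
  let ι : Compacts B E →ₗ[ℂ] adjointable B E :=
    (compacts B E).toNonUnitalSubalgebra.toSubmodule.subtype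
  have hW : IsClosed (V.map ι : Set (adjointable B E)) := by
    have : Topology.IsClosedEmbedding ι :=
      (inferInstance : IsClosed (compacts B E : Set (adjointable B E))).isClosedEmbedding_subtypeVal
    exact this.isClosedMap _ hVc
  intro T
  obtain ⟨S, hS, h⟩ := compacts_le_of_theta_mem hW (by
    rintro _ ⟨S, hS, rfl⟩ T hT
    let T' : Compacts B E := ⟨T, hT⟩
    exact ⟨S * T', hVr S hS T', rfl⟩) hX (fun x hx y => by
    obtain ⟨S, hS, h⟩ := hθ x hx y
    exact ⟨S, Submodule.le_topologicalClosure _ (Submodule.subset_span hS), h⟩) T.2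
  have : S = T := Compacts.ext h
  rw [← this]
  exact hS

end HilbertModule

namespace GHilbertModule

open HilbertModule InverseSemigroup
open scoped MultiplierAlgebra

variable {G B E : Type*} [InverseSemigroup G] [NonUnitalCStarAlgebra B] [PartialOrder B]
  [StarOrderedRing B] [NormedAddCommGroup E] [NormedSpace ℂ E] [SMul B E] [CStarModule B E]
  [CompleteSpace E] {β : GAction G B} (M : GHilbertModule β E)

/-- If T commutes with U, then U_g (TS) U_{g⁻¹} = T (U_g S U_{g⁻¹}). -/
theorem isInvariant_toMultiplier {T : adjointable B E}
    (hT : ∀ g x, M.U g ((T : E →L[ℂ] E) x) = (T : E →L[ℂ] E) (M.U g x)) :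
    M.actionCompacts.IsInvariant (toMultiplier T) := fun g _ =>
  Compacts.ext <| HilbertModule.adjointable_ext fun _ => (hT g _).symm

end GHilbertModule

section Modules

open scoped ZeroAtInfty BoundedContinuousFunction MultiplierAlgebra
open UniformSpace InverseSemigroup HilbertModule PosKernel

variable {G : Type*} [InverseSemigroup G]

theorem PosKernel.dense_span_single {X I : Type*} [TopologicalSpace X] (K : PosKernel X I) :
    Dense (Submodule.span ℂ (Set.range fun p : I × C₀(X, ℂ) =>
      ((Pre.single K p.1 p.2 : K.Pre) : K.Module)) : Set K.Module) := by
  set W := (Submodule.span ℂ (Set.range fun p : I × C₀(X, ℂ) =>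
    ((Pre.single K p.1 p.2 : K.Pre) : K.Module))).topologicalClosure with hW
  intro x
  change x ∈ W
  refine Completion.induction_on x (Submodule.isClosed_topologicalClosure _) fun x => ?_
  induction x using Pre.induction with
  | h0 => rw [Completion.coe_zero]; exact zero_mem _
  | ha x y hx hy => rw [Completion.coe_add]; exact add_mem hx hy
  | hs i f => exact Submodule.le_topologicalClosure _ (Submodule.subset_span ⟨(i, f), rfl⟩)

/-! ### Matrix units on `C₀(X)^∞` -/

namespace SumModule

variable (G) in
/-- The matrix unit `φ_k f ↦ δ_{jk} φ_i f` on finite sums. -/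
noncomputable def unitPre (i j : ℕ) : (sumKernel G).Pre →ₗ[ℂ] (sumKernel G).Pre :=
  Finsupp.lsingle i ∘ₗ Finsupp.lapply j

theorem unitPre_single_same (i j : ℕ) (f : C₀(Spec G, ℂ)) :
    unitPre G i j (Pre.single _ j f) = Pre.single _ i f := by
  change Finsupp.single i ((Finsupp.single j f : ℕ →₀ C₀(Spec G, ℂ)) j) = Finsupp.single i f
  rw [Finsupp.single_eq_same]

theorem unitPre_single_ne (i : ℕ) {j k : ℕ} (h : j ≠ k) (f : C₀(Spec G, ℂ)) :
    unitPre G i j (Pre.single _ k f) = 0 := by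
  change Finsupp.single i ((Finsupp.single k f : ℕ →₀ C₀(Spec G, ℂ)) j) = 0
  rw [Finsupp.single_eq_of_ne h, Finsupp.single_zero]

theorem inner_zero_left (y : (sumKernel G).Pre) :
    inner C₀(Spec G, ℂ) (0 : (sumKernel G).Pre) y = 0 := by
  have := Pre.inner_smul_left (0 : ℂ) y y
  rwa [zero_smul, star_zero, zero_smul] at this

theorem inner_zero_right (y : (sumKernel G).Pre) :
    inner C₀(Spec G, ℂ) y (0 : (sumKernel G).Pre) = 0 := by
  rw [← Pre.star_inner, inner_zero_left, star_zero]

theorem k_apply_same (n : ℕ) (χ : Spec G) : (sumKernel G).k n n χ = 1 := if_pos rfl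

theorem k_apply_ne {m n : ℕ} (h : m ≠ n) (χ : Spec G) : (sumKernel G).k m n χ = 0 := if_neg h

theorem inner_unitPre (i j : ℕ) (x y : (sumKernel G).Pre) :
    inner C₀(Spec G, ℂ) (unitPre G i j x) y = inner C₀(Spec G, ℂ) x (unitPre G j i y) := by
  induction x using Pre.induction with
  | h0 => rw [map_zero, inner_zero_left, inner_zero_left]
  | ha x x' hx hx' => rw [map_add, Pre.inner_add_left, Pre.inner_add_left, hx, hx']
  | hs m f =>
    induction y using Pre.induction with
    | h0 => rw [map_zero, inner_zero_right, inner_zero_right]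
    | ha x x' hx hx' => rw [map_add, Pre.inner_add_right, Pre.inner_add_right, hx, hx']
    | hs n f' =>
      ext χ
      by_cases h1 : j = m
      · subst h1
        rw [unitPre_single_same]
        by_cases h2 : i = n
        · subst h2
          rw [unitPre_single_same, Pre.inner_single, Pre.inner_single, k_apply_same, k_apply_same]
        · rw [unitPre_single_ne _ h2, Pre.inner_single, k_apply_ne h2, inner_zero_right, mul_zero]
          rfl
      · rw [unitPre_single_ne _ h1, inner_zero_left]
        by_cases h2 : i = n
        · subst h2
          rw [unitPre_single_same, Pre.inner_single, k_apply_ne (Ne.symm h1), mul_zero]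
          rfl
        · rw [unitPre_single_ne _ h2, inner_zero_right]

theorem unitPre_mul (i j k : ℕ) (x : (sumKernel G).Pre) :
    unitPre G i j (unitPre G j k x) = unitPre G i k x := by
  change Finsupp.single i ((Finsupp.single j (Finsupp.lapply (R := ℂ) k x) :
    ℕ →₀ C₀(Spec G, ℂ)) j) = _
  rw [Finsupp.single_eq_same]
  rfl

theorem unitPre_mul_ne (i : ℕ) {j k : ℕ} (h : j ≠ k) (l : ℕ) (x : (sumKernel G).Pre) :
    unitPre G i j (unitPre G k l x) = 0 := by
  change Finsupp.single i ((Finsupp.single k (Finsupp.lapply (R := ℂ) l x) :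
    ℕ →₀ C₀(Spec G, ℂ)) j) = _
  rw [Finsupp.single_eq_of_ne h, Finsupp.single_zero]
  rfl

theorem norm_unitPre_le (i j : ℕ) (x : (sumKernel G).Pre) : ‖unitPre G i j x‖ ≤ 1 * ‖x‖ := by
  -- E_ij⋆ E_ij = E_jj and Cauchy–Schwarz. The case i = j shows that E_jj is contractive, which then
  -- bounds the general case.
  have key : ∀ i j, ‖unitPre G i j x‖ ^ 2 ≤ ‖x‖ * ‖unitPre G j j x‖ := fun i j => by
    rw [Pre.norm_sq, inner_unitPre, unitPre_mul]
    exact Pre.norm_inner_le _ _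
  have h1 : ‖unitPre G j j x‖ ≤ ‖x‖ := by
    have := key j j
    nlinarith [norm_nonneg (unitPre G j j x), norm_nonneg x]
  have h2 := key i j
  rw [one_mul]
  nlinarith [norm_nonneg (unitPre G i j x), norm_nonneg x]

variable (G) in
/-- The matrix unit on `C₀(X)^∞` as a continuous map. -/
noncomputable def unitL (i j : ℕ) : (sumKernel G).Module →L[ℂ] (sumKernel G).Module :=
  ((unitPre G i j).mkContinuous 1 (norm_unitPre_le i j)).completion

theorem unitL_coe (i j : ℕ) (x : (sumKernel G).Pre) :
    unitL G i j (x : (sumKernel G).Module) = (unitPre G i j x : (sumKernel G).Module) :=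
  ContinuousLinearMap.completion_apply_coe _ _

theorem inner_unitL (i j : ℕ) (x y : (sumKernel G).Module) :
    inner C₀(Spec G, ℂ) (unitL G i j x) y = inner C₀(Spec G, ℂ) x (unitL G j i y) :=
  Completion.induction_on₂ x y (isClosed_eq
    (PosKernel.Module.continuous_inner' ((unitL G i j).continuous.comp continuous_fst)
      continuous_snd)
    (PosKernel.Module.continuous_inner' continuous_fst
      ((unitL G j i).continuous.comp continuous_snd))) fun x y => by
    rw [unitL_coe, unitL_coe, PosKernel.Module.inner_coe, PosKernel.Module.inner_coe,
      inner_unitPre]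

variable (G) in
/-- The matrix unit on `C₀(X)^∞` as an adjointable operator. -/
noncomputable def unitOp (i j : ℕ) : adjointable C₀(Spec G, ℂ) (sumKernel G).Module :=
  ⟨unitL G i j, unitL G j i, inner_unitL i j⟩

theorem unitOp_coe (i j : ℕ) (x : (sumKernel G).Pre) :
    (unitOp G i j : (sumKernel G).Module →L[ℂ] (sumKernel G).Module) (x : (sumKernel G).Module)
      = (unitPre G i j x : (sumKernel G).Module) := unitL_coe i j x

theorem star_unitOp (i j : ℕ) : star (unitOp G i j) = unitOp G j i :=
  star_eq_of _ _ (inner_unitL i j)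

theorem unitOp_mul (i j k : ℕ) : unitOp G i j * unitOp G j k = unitOp G i k :=
  adjointable_ext <| (sumKernel G).ext_single fun n f => by
    rw [MulMemClass.coe_mul, _root_.mul_apply_eq_comp, unitOp_coe, unitOp_coe, unitOp_coe,
      unitPre_mul]

theorem unitOp_mul_ne (i : ℕ) {j k : ℕ} (h : j ≠ k) (l : ℕ) :
    unitOp G i j * unitOp G k l = 0 :=
  adjointable_ext <| (sumKernel G).ext_single fun n f => by
    rw [MulMemClass.coe_mul, _root_.mul_apply_eq_comp, unitOp_coe, unitOp_coe,
      unitPre_mul_ne _ h]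
    rfl

/-- G acts on the coefficients and fixes the index; matrix units only move the index. -/
theorem uL_unitL (g : G) (i j : ℕ) (x : (sumKernel G).Module) :
    (sumKernel G).uL g (unitL G i j x) = unitL G i j ((sumKernel G).uL g x) :=
  (sumKernel G).ext_single (S := (sumKernel G).uL g ∘L unitL G i j)
    (T := unitL G i j ∘L (sumKernel G).uL g) (fun n f => by
    change (sumKernel G).uL g (unitL G i j _) = unitL G i j ((sumKernel G).uL g _)
    rw [unitL_coe, GKernel.uL_coe, GKernel.uL_coe, unitL_coe, GKernel.uPre_single,
      show (sumKernel G).mv g n = n from rfl]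
    by_cases h : j = n
    · subst h
      rw [unitPre_single_same, unitPre_single_same, GKernel.uPre_single]
      rfl
    · rw [unitPre_single_ne _ h, unitPre_single_ne _ h, map_zero]) x

variable (G) in
/-- The matrix units as multipliers of `𝓚(C₀(X)^∞)`. -/
noncomputable def unit (i j : ℕ) :
    𝓜(ℂ, Compacts C₀(Spec G, ℂ) (sumKernel G).Module) := toMultiplier (unitOp G i j)

theorem isInvariant_unit (i j : ℕ) : (c0Infty G).actionCompacts.IsInvariant (unit G i j) :=
  (c0Infty G).isInvariant_toMultiplier fun g x => uL_unitL g i j x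

theorem unit_mul (i j k : ℕ) : unit G i j * unit G j k = unit G i k := by
  rw [unit, unit, unit, ← toMultiplier_mul, unitOp_mul]

theorem unit_mul_ne (i : ℕ) {j k : ℕ} (h : j ≠ k) (l : ℕ) : unit G i j * unit G k l = 0 := by
  rw [unit, unit, ← toMultiplier_mul, unitOp_mul_ne i h, toMultiplier_zero]

theorem star_unit (i j : ℕ) : star (unit G i j) = unit G j i := by
  rw [unit, unit, ← toMultiplier_star, star_unitOp]

/-- E_nn fixes θ_{x,y} for x = φ_n f, and these x are total. -/
theorem dense_span_unit : Dense (Submodule.span ℂ (⋃ i, Set.range (unit G i i).fst) :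
    Set (Compacts C₀(Spec G, ℂ) (sumKernel G).Module)) := by
  refine dense_span_of_theta (sumKernel G).dense_span_single (fun S hS T => ?_) ?_
  · obtain ⟨i, R, rfl⟩ := Set.mem_iUnion.1 hS
    exact Set.mem_iUnion.2 ⟨i, R * T, DoubleCentralizer.fst_mul _ _ _⟩
  · rintro _ ⟨⟨n, f⟩, rfl⟩ y
    refine ⟨_, Set.mem_iUnion.2 ⟨n, ⟨Compacts.theta
      ((Pre.single (sumKernel G).toPosKernel n f : (sumKernel G).Pre) : (sumKernel G).Module) y,
      rfl⟩⟩, ?_⟩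
    rw [unit, toMultiplier_fst_val, Compacts.theta_val, mul_theta, unitOp_coe, unitPre_single_same]

end SumModule

end Modules

/-! ### Inner products in kernel modules and the vectors of L²(G). -/

section Modules

open scoped ZeroAtInfty BoundedContinuousFunction MultiplierAlgebra
open UniformSpace InverseSemigroup HilbertModule PosKernel

variable {G : Type*} [InverseSemigroup G]

namespace PosKernel.Module

variable {X I : Type*} [TopologicalSpace X] {K : PosKernel X I}

theorem star_inner (x y : K.Module) : star (inner C₀(X, ℂ) x y) = inner C₀(X, ℂ) y x :=
  CStarModule.star_inner (A := C₀(X, ℂ)) (E := K.Module) x y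

theorem inner_zero_right (x : K.Module) : inner C₀(X, ℂ) x 0 = 0 :=
  CStarModule.inner_zero_right (A := C₀(X, ℂ)) (E := K.Module)

theorem inner_zero_left (x : K.Module) : inner C₀(X, ℂ) 0 x = 0 :=
  CStarModule.inner_zero_left (A := C₀(X, ℂ)) (E := K.Module)

theorem inner_add_left (x y z : K.Module) :
    inner C₀(X, ℂ) (x + y) z = inner C₀(X, ℂ) x z + inner C₀(X, ℂ) y z :=
  CStarModule.inner_add_left (A := C₀(X, ℂ)) (E := K.Module)

theorem inner_sub_right (x y z : K.Module) :
    inner C₀(X, ℂ) x (y - z) = inner C₀(X, ℂ) x y - inner C₀(X, ℂ) x z :=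
  CStarModule.inner_sub_right (A := C₀(X, ℂ)) (E := K.Module)

theorem inner_op_smul_right (b : C₀(X, ℂ)) (x y : K.Module) :
    inner C₀(X, ℂ) x (b • y) = b * inner C₀(X, ℂ) x y :=
  CStarModule.inner_op_smul_right (A := C₀(X, ℂ)) (E := K.Module)

theorem inner_op_smul_left (b : C₀(X, ℂ)) (x y : K.Module) :
    inner C₀(X, ℂ) (b • x) y = inner C₀(X, ℂ) x y * star b :=
  CStarModule.inner_op_smul_left (A := C₀(X, ℂ)) (E := K.Module)

end PosKernel.Module

/-! ### The projections onto the vectors `φ_g` of `L²(G)` -/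

namespace L2Module

variable [IsEContinuous G]

/-- The vector `φ_g = φ_g 1_{g g⁻¹}` of `L²(G)`. -/
noncomputable def vec (g : G) : (L2Kernel G).Module :=
  ((Pre.single (L2Kernel G).toPosKernel g (Spec.ind (Idem.ran g)) : (L2Kernel G).Pre) :
    (L2Kernel G).Module)

theorem ran_of_rel {χ : Spec G} {g h : G} (H : L2Rel χ g h) :
    χ (Idem.ran g) = true ∧ χ (Idem.ran h) = true := by
  obtain ⟨e, _, h1, h2, h3⟩ := L2Rel.iff_ran.1 H
  exact ⟨L2Rel.apply_of_le h1 h3, L2Rel.apply_of_le h2 h3⟩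

theorem ind_pos {χ : Spec G} {e : Idem G} (h : χ e = true) : Spec.ind e χ = 1 := if_pos h

theorem k_pos {χ : Spec G} {g h : G} (H : L2Rel χ g h) : (L2Kernel G).k g h χ = 1 :=
  L2Inner_pos H

theorem k_neg {χ : Spec G} {g h : G} (H : ¬ L2Rel χ g h) : (L2Kernel G).k g h χ = 0 :=
  L2Inner_neg H

/-- The kernel `k j g` lives on the carrier of g g⁻¹, so the coefficient 1_{g g⁻¹} in `vec g` is
invisible to inner products. -/
theorem ind_ran_mul_k (j g : G) (χ : Spec G) :
    Spec.ind (Idem.ran g) χ * (L2Kernel G).k j g χ = (L2Kernel G).k j g χ := by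
  by_cases H : L2Rel χ j g
  · rw [ind_pos (ran_of_rel H).2, one_mul]
  · rw [k_neg H, mul_zero]

theorem inner_single_vec (j : G) (f : C₀(Spec G, ℂ)) (g : G) (χ : Spec G) :
    inner C₀(Spec G, ℂ) ((Pre.single (L2Kernel G).toPosKernel j f : (L2Kernel G).Pre) :
      (L2Kernel G).Module) (vec g) χ = star (f χ) * (L2Kernel G).k j g χ := by
  rw [vec, PosKernel.Module.inner_coe, Pre.inner_single, mul_assoc, ind_ran_mul_k]

theorem inner_vec (g h : G) (χ : Spec G) :
    inner C₀(Spec G, ℂ) (vec g) (vec h) χ = (L2Kernel G).k g h χ := by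
  rw [vec, inner_single_vec]
  by_cases H : L2Rel χ g h
  · rw [ind_pos (ran_of_rel H).1, star_one, one_mul]
  · rw [k_neg H, mul_zero]

theorem star_inner_vec (g h : G) :
    star (inner C₀(Spec G, ℂ) (vec g) (vec h)) = inner C₀(Spec G, ℂ) (vec g) (vec h) := by
  ext χ
  change star (inner C₀(Spec G, ℂ) (vec g) (vec h) χ) = _
  rw [inner_vec]
  by_cases H : L2Rel χ g h
  · rw [k_pos H, star_one]
  · rw [k_neg H, star_zero]

theorem inner_vec_comm (g h : G) :
    inner C₀(Spec G, ℂ) (vec g) (vec h) = inner C₀(Spec G, ℂ) (vec h) (vec g) := by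
  rw [← PosKernel.Module.star_inner, star_inner_vec]

theorem ext_inner_single {x y : (L2Kernel G).Module}
    (h : ∀ (j : G) (f : C₀(Spec G, ℂ)),
      inner C₀(Spec G, ℂ) ((Pre.single (L2Kernel G).toPosKernel j f : (L2Kernel G).Pre) :
        (L2Kernel G).Module) x
      = inner C₀(Spec G, ℂ) ((Pre.single (L2Kernel G).toPosKernel j f : (L2Kernel G).Pre) :
        (L2Kernel G).Module) y) : x = y := by
  refine PosKernel.Module.ext_inner_pre fun z => ?_
  induction z using Pre.induction with
  | h0 => rw [Completion.coe_zero, PosKernel.Module.inner_zero_left,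
      PosKernel.Module.inner_zero_left]
  | ha z z' hz hz' =>
    rw [Completion.coe_add, PosKernel.Module.inner_add_left,
      PosKernel.Module.inner_add_left, hz, hz']
  | hs j f => exact h j f

/-- Both sides have the same inner products with all generators. Hence the `vec g` generate the
module over C₀(X). -/
theorem single_eq_smul_vec (g : G) (f : C₀(Spec G, ℂ)) :
    ((Pre.single (L2Kernel G).toPosKernel g f : (L2Kernel G).Pre) : (L2Kernel G).Module)
      = f • vec g := ext_inner_single fun j f' => by
  ext χ
  rw [PosKernel.Module.inner_op_smul_right, PosKernel.Module.inner_coe, Pre.inner_single]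
  change _ = f χ * inner C₀(Spec G, ℂ) _ (vec g) χ
  rw [inner_single_vec]
  ring

/-- Where ⟨φ_g, φ_h⟩ is 1, g and h are related at χ, so by transitivity φ_g and φ_h have equal inner
products with every φ_j; where it is 0, both sides vanish. This local coincidence is why the
projections q_g commute. -/
theorem inner_smul_vec (g h : G) :
    inner C₀(Spec G, ℂ) (vec g) (vec h) • vec g = inner C₀(Spec G, ℂ) (vec g) (vec h) • vec h :=
  ext_inner_single fun j f => by
    ext χ
    rw [PosKernel.Module.inner_op_smul_right, PosKernel.Module.inner_op_smul_right]
    change inner C₀(Spec G, ℂ) (vec g) (vec h) χ * inner C₀(Spec G, ℂ) _ (vec g) χ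
      = inner C₀(Spec G, ℂ) (vec g) (vec h) χ * inner C₀(Spec G, ℂ) _ (vec h) χ
    rw [inner_single_vec, inner_single_vec, inner_vec]
    by_cases H : L2Rel χ g h
    · have : (L2Kernel G).k j g χ = (L2Kernel G).k j h χ :=
        L2Inner_congr ⟨fun H' => H'.trans H, fun H' => H'.trans H.symm⟩
      rw [this]
    · rw [k_neg H, zero_mul, zero_mul]

/-- ⟨φ_g, φ_g⟩ equals 1 wherever some ⟨φ_j, φ_g⟩ is nonzero, so it acts as a unit on φ_g. This makes
θ_{φ_g,φ_g} a projection. -/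
theorem inner_vec_self_smul (g : G) : inner C₀(Spec G, ℂ) (vec g) (vec g) • vec g = vec g :=
  ext_inner_single fun j f => by
    ext χ
    rw [PosKernel.Module.inner_op_smul_right]
    change inner C₀(Spec G, ℂ) (vec g) (vec g) χ * inner C₀(Spec G, ℂ) _ (vec g) χ = _
    rw [inner_single_vec, inner_vec]
    by_cases H : L2Rel χ j g
    · rw [k_pos (H.symm.trans H), one_mul]
    · rw [k_neg H, mul_zero, mul_zero]

theorem U_vec (g h : G) : (L2 G).U g (vec h) = vec (g * h) := by
  change (L2Kernel G).uL g _ = _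
  rw [vec, GKernel.uL_coe, GKernel.uPre_single, Spec.trans_ind, ← Idem.ran_mul]
  rfl

/-- The projection onto `φ_g C₀(X)`. -/
noncomputable def proj (g : G) : Compacts C₀(Spec G, ℂ) (L2Kernel G).Module :=
  Compacts.theta (vec g) (vec g)

theorem star_proj (g : G) : star (proj g) = proj g := Compacts.ext (star_theta (vec g) (vec g))

theorem proj_mul_theta (g : G) (f : C₀(Spec G, ℂ)) (y : (L2Kernel G).Module) :
    proj g * Compacts.theta (f • vec g) y = Compacts.theta (f • vec g) y := by
  refine Compacts.ext ?_
  change theta (vec g) (vec g) * theta (f • vec g) y = theta (f • vec g) y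
  rw [mul_theta, theta_apply, CStarModule.inner_op_smul_right, mul_smul_module,
    inner_vec_self_smul]

theorem proj_mul_self (g : G) : proj g * proj g = proj g := by
  refine Compacts.ext ?_
  change theta (vec g) (vec g) * theta (vec g) (vec g) = theta (vec g) (vec g)
  rw [mul_theta, theta_apply, inner_vec_self_smul]

theorem proj_mul_proj_apply (g h : G) (z : (L2Kernel G).Module) :
    ((proj g * proj h).val : (L2Kernel G).Module →L[ℂ] (L2Kernel G).Module) z
      = (inner C₀(Spec G, ℂ) (vec g) (vec h) * inner C₀(Spec G, ℂ) (vec h) z) • vec h := by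
  change inner C₀(Spec G, ℂ) (vec g) (inner C₀(Spec G, ℂ) (vec h) z • vec h) • vec g = _
  rw [PosKernel.Module.inner_op_smul_right, mul_smul_module, inner_smul_vec, ← mul_smul_module,
    mul_comm]

/-- In the presence of the factor ⟨φ_g, φ_h⟩ both occurrences of φ_h in `proj_mul_proj_apply` may be
traded for φ_g. -/
theorem proj_comm (g h : G) : proj g * proj h = proj h * proj g := by
  refine Compacts.ext (adjointable_ext fun z => ?_)
  rw [proj_mul_proj_apply, proj_mul_proj_apply]
  have h1 : ∀ a b : G, inner C₀(Spec G, ℂ) (vec a) (vec b) * inner C₀(Spec G, ℂ) (vec a) z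
      = inner C₀(Spec G, ℂ) (inner C₀(Spec G, ℂ) (vec a) (vec b) • vec a) z := fun a b => by
    rw [PosKernel.Module.inner_op_smul_left, star_inner_vec, mul_comm]
  have h2 : inner C₀(Spec G, ℂ) (vec g) (vec h) * inner C₀(Spec G, ℂ) (vec h) z
      = inner C₀(Spec G, ℂ) (vec g) (vec h) * inner C₀(Spec G, ℂ) (vec g) z := by
    rw [inner_vec_comm g h, h1, inner_smul_vec h g, inner_vec_comm h g, h1]
  rw [h2, inner_vec_comm h g, mul_comm, mul_smul_module, mul_smul_module,
    inner_smul_vec]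

theorem act_proj (g h : G) : (L2 G).actionCompacts.act g (proj h) = proj (g * h) := by
  refine Compacts.ext ?_
  change (L2 G).conjHom g (theta (vec h) (vec h)) = theta (vec (g * h)) (vec (g * h))
  rw [GHilbertModule.conjHom_theta, U_vec]

theorem dense_span_proj : Dense (Submodule.span ℂ (⋃ g : G, Set.range fun T => proj g * T) :
    Set (Compacts C₀(Spec G, ℂ) (L2Kernel G).Module)) := by
  refine dense_span_of_theta (L2Kernel G).dense_span_single (fun S hS T => ?_) ?_
  · obtain ⟨g, R, rfl⟩ := Set.mem_iUnion.1 hS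
    exact Set.mem_iUnion.2 ⟨g, R * T, (mul_assoc _ _ _).symm⟩
  · rintro _ ⟨⟨g, f⟩, rfl⟩ y
    refine ⟨Compacts.theta (f • vec g) y, Set.mem_iUnion.2 ⟨g, _, proj_mul_theta g f y⟩, ?_⟩
    rw [Compacts.theta_val, ← single_eq_smul_vec]

/-- `∏ (1 - e) T`, the product over the idempotents `e` in a list. -/
noncomputable def cutOff (T : Compacts C₀(Spec G, ℂ) (L2Kernel G).Module) (l : List (Idem G)) :
    Compacts C₀(Spec G, ℂ) (L2Kernel G).Module :=
  l.foldr (fun e T => T - (L2 G).actionCompacts.act e.val T) T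

-- At χ an idempotent e acts as the scalar χ(e), so each factor 1 - e contributes 0 or 1.
open Classical in
theorem inner_cutOff_apply (T : Compacts C₀(Spec G, ℂ) (L2Kernel G).Module) (l : List (Idem G))
    (w z : (L2Kernel G).Module) (χ : Spec G) :
    inner C₀(Spec G, ℂ) w (((cutOff T l).val : _ →L[ℂ] (L2Kernel G).Module) z) χ
      = if ∃ e ∈ l, χ e = true then 0
        else inner C₀(Spec G, ℂ) w ((T.val : _ →L[ℂ] (L2Kernel G).Module) z) χ := by
  induction l with
  | nil => simp [cutOff]
  | cons e l ih =>
    have h1 : (((cutOff T (e :: l)).val : _ →L[ℂ] (L2Kernel G).Module) z)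
        = ((cutOff T l).val : _ →L[ℂ] (L2Kernel G).Module) z
          - (L2 G).U e.val (((cutOff T l).val : _ →L[ℂ] (L2Kernel G).Module) z) := by
      change ((cutOff T l).val : _ →L[ℂ] (L2Kernel G).Module) z
        - (L2 G).U e.val (((cutOff T l).val : _ →L[ℂ] (L2Kernel G).Module)
          ((L2 G).U (e.val)⁻¹ z)) = _
      rw [inv_idem e.idem, ← (L2 G).U_idem_comm e.idem, ← (L2 G).U_mul, e.idem]
    rw [h1, PosKernel.Module.inner_sub_right, (L2 G).inner_U_idem e.idem, Spec.c0Action_apply]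
    change inner C₀(Spec G, ℂ) w (((cutOff T l).val : _ →L[ℂ] (L2Kernel G).Module) z) χ
      - Spec.trans e.val _ χ = _
    by_cases h : χ e = true
    · rw [Spec.trans_idem_pos h, sub_self, if_pos ⟨e, List.mem_cons_self, h⟩]
    · rw [Spec.trans_idem_neg h, sub_zero, ih]
      simp [h]

/-- The set is the preimage of 1 under ⟨φ_g, φ_h⟩, a continuous function vanishing at infinity; its
continuity rests on E-continuity. Compactness makes the cover in `exists_cutOff_eq_zero` finite. -/
theorem isCompact_rel (g h : G) : IsCompact {χ : Spec G | L2Rel χ g h} := by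
  let f := inner C₀(Spec G, ℂ) (vec g) (vec h)
  have hf : ∀ χ, f χ = (L2Kernel G).k g h χ := inner_vec g h
  have h1 : {χ : Spec G | L2Rel χ g h} = f ⁻¹' {1} := Set.ext fun χ => by
    change L2Rel χ g h ↔ f χ = 1
    rw [hf]
    by_cases H : L2Rel χ g h
    · simp [H, k_pos H]
    · simp [H, k_neg H]
  have h2 : ∀ᶠ χ in Filter.cocompact (Spec G), f χ ≠ 1 :=
    (ZeroAtInftyContinuousMapClass.zero_at_infty f).eventually_ne (by norm_num)
  obtain ⟨K, hK, hKs⟩ := Filter.mem_cocompact.1 h2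
  have h3 : IsClosed (f ⁻¹' {1}) := isClosed_singleton.preimage (map_continuous f)
  rw [h1]
  exact hK.of_isClosed_subset h3 fun χ hχ => by
    by_contra hn
    exact hKs hn hχ

/-- `q_g q_h` is a finite sum of pieces under idempotents `e` with `e g = e h`. -/
theorem exists_cutOff_eq_zero (g h : G) :
    ∃ l : List (Idem G), (∀ e ∈ l, e.val * g = e.val * h) ∧ cutOff (proj g * proj h) l = 0 := by
  -- By definition of the relation, its support is covered by the clopen carriers of idempotents e
  -- with eg = eh.
  obtain ⟨t, ht⟩ := (isCompact_rel g h).elim_finite_subcover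
    (fun e : {e : Idem G // e.val * g = e.val * h} => Spec.D e.1)
    (fun e => (Spec.isClopen_D e.1).isOpen) fun χ hχ => by
      obtain ⟨e, h1, _, h2⟩ := hχ
      exact Set.mem_iUnion.2 ⟨⟨e, h1⟩, h2⟩
  refine ⟨t.toList.map Subtype.val, fun e he => ?_, ?_⟩
  · obtain ⟨e', _, rfl⟩ := List.mem_map.1 he
    exact e'.2
  · refine Compacts.ext (adjointable_ext fun z => ext_inner C₀(Spec G, ℂ) fun w => ?_)
    ext χ
    classical
    rw [inner_cutOff_apply]
    change _ = inner C₀(Spec G, ℂ) w (0 : (L2Kernel G).Module) χ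
    rw [PosKernel.Module.inner_zero_right]
    change _ = (0 : ℂ)
    split_ifs with hl
    · rfl
    -- Outside the chosen carriers ⟨φ_g, φ_h⟩ is already 0, hence so is q_g q_h.
    · rw [proj_mul_proj_apply, PosKernel.Module.inner_op_smul_right]
      change (inner C₀(Spec G, ℂ) (vec g) (vec h) χ * _) * _ = (0 : ℂ)
      rw [inner_vec, k_neg, zero_mul, zero_mul]
      intro H
      obtain ⟨e, he, hχ⟩ := Set.mem_iUnion₂.1 (ht H)
      exact hl ⟨e.1, List.mem_map.2 ⟨e, Finset.mem_toList.2 he, rfl⟩, hχ⟩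

end L2Module

end Modules

/-! ### Gluing homomorphisms along commuting projections -/

section CommutingProjections

variable {M : Type*} [Ring M]

/-- `∏ (1 - q_k)`, `k < N`. -/
def projRest (q : ℕ → M) : ℕ → M
  | 0 => 1
  | N + 1 => projRest q N * (1 - q N)

/-- The orthogonal projections `∏ (1 - q_k) q_m`, `k < m`. -/
def projPiece (q : ℕ → M) (m : ℕ) : M := projRest q m * q m

variable {q : ℕ → M}

theorem commute_projRest {x : M} (h : ∀ n, Commute x (q n)) (N : ℕ) :
    Commute x (projRest q N) := by
  induction N with
  | zero => exact Commute.one_right x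
  | succ N ih => exact ih.mul_right ((Commute.one_right x).sub_right (h N))

theorem commute_projPiece {x : M} (h : ∀ n, Commute x (q n)) (N : ℕ) :
    Commute x (projPiece q N) :=
  (commute_projRest h N).mul_right (h N)

/-- A telescoping sum: the m-th piece is `projRest q m - projRest q (m + 1)`. -/
theorem sum_projPiece (q : ℕ → M) (N : ℕ) :
    ∑ m ∈ Finset.range N, projPiece q m = 1 - projRest q N := by
  induction N with
  | zero => rw [Finset.sum_range_zero, projRest, sub_self]
  | succ N ih => rw [Finset.sum_range_succ, ih, projRest, projPiece, mul_sub, mul_one]; abel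

theorem projRest_mul_self (hq : ∀ m n, Commute (q m) (q n)) (hqq : ∀ m, q m * q m = q m)
    (N : ℕ) : projRest q N * projRest q N = projRest q N := by
  induction N with
  | zero => exact one_mul 1
  | succ N ih =>
    have h1 : Commute (1 - q N) (projRest q N) :=
      (Commute.one_left _).sub_left (commute_projRest (hq N) N)
    have h2 : (1 - q N) * (1 - q N) = 1 - q N := by
      rw [mul_sub, mul_one, sub_mul, one_mul, hqq, sub_self, sub_zero]
    rw [projRest, mul_assoc, ← mul_assoc _ (projRest q N), h1.eq, mul_assoc, h2, ← mul_assoc, ih]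

theorem projRest_mul_proj (hq : ∀ m n, Commute (q m) (q n)) (hqq : ∀ m, q m * q m = q m)
    {m N : ℕ} (h : m < N) : projRest q N * q m = 0 := by
  induction N with
  | zero => exact absurd h (Nat.not_lt_zero m)
  | succ N ih =>
    have h1 : Commute (1 - q N) (q m) := (Commute.one_left _).sub_left (hq N m)
    rcases Nat.lt_succ_iff_lt_or_eq.1 h with h | h
    · rw [projRest, mul_assoc, h1.eq, ← mul_assoc, ih h, zero_mul]
    · rw [projRest, h, mul_assoc, sub_mul, one_mul, hqq, sub_self, mul_zero]

theorem projPiece_mul_self (hq : ∀ m n, Commute (q m) (q n)) (hqq : ∀ m, q m * q m = q m)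
    (m : ℕ) : projPiece q m * projPiece q m = projPiece q m := by
  rw [projPiece, mul_assoc, ← mul_assoc (q m), (commute_projRest (hq m) m).eq, mul_assoc, hqq,
    ← mul_assoc, projRest_mul_self hq hqq]

/-- For m < n the n-th piece contains the factor 1 - q m, which annihilates q m; commutativity
covers the other order. -/
theorem projPiece_mul_ne (hq : ∀ m n, Commute (q m) (q n)) (hqq : ∀ m, q m * q m = q m)
    {m n : ℕ} (h : m ≠ n) : projPiece q m * projPiece q n = 0 := by
  have key : ∀ {m n : ℕ}, m < n → projPiece q m * projPiece q n = 0 := fun {m n} h => by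
    rw [projPiece, projPiece, mul_assoc, ← mul_assoc (q m), (commute_projRest (hq m) n).eq,
      projRest_mul_proj hq hqq h, zero_mul, mul_zero]
  rcases lt_or_gt_of_ne h with h | h
  · exact key h
  · have h1 : Commute (projPiece q m) (projPiece q n) :=
      commute_projPiece (fun k => (commute_projPiece (hq k) m).symm) n
    rw [h1.eq, key h]

end CommutingProjections

theorem star_projRest {M : Type*} [Ring M] [StarRing M] {q : ℕ → M}
    (hq : ∀ m n, Commute (q m) (q n)) (hs : ∀ m, star (q m) = q m) (N : ℕ) :
    star (projRest q N) = projRest q N := by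
  induction N with
  | zero => exact star_one M
  | succ N ih =>
    rw [projRest, star_mul, ih, star_sub, star_one, hs]
    exact (Commute.one_left _).sub_left (commute_projRest (hq N) N)

theorem star_projPiece {M : Type*} [Ring M] [StarRing M] {q : ℕ → M}
    (hq : ∀ m n, Commute (q m) (q n)) (hs : ∀ m, star (q m) = q m) (m : ℕ) :
    star (projPiece q m) = projPiece q m := by
  rw [projPiece, star_mul, star_projRest hq hs, hs]
  exact commute_projRest (hq m) m

/-- A finite orthogonal sum of `⋆`-homomorphisms. -/
noncomputable def sumOrthogonalHom {A M : Type*} [NonUnitalCStarAlgebra A] [CStarAlgebra M]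
    (ψ : ℕ → A →⋆ₙₐ[ℂ] M) (Q : ℕ → M) (hs : ∀ m, star (Q m) = Q m) (hQ : ∀ m, Q m * Q m = Q m)
    (h0 : ∀ m n, m ≠ n → Q m * Q n = 0) (hc : ∀ m n a, Commute (ψ m a) (Q n)) (N : ℕ) :
    A →⋆ₙₐ[ℂ] M where
  toFun a := ∑ m ∈ Finset.range N, ψ m a * Q m
  map_smul' c a := by
    rw [MonoidHom.id_apply, Finset.smul_sum]
    exact Finset.sum_congr rfl fun m _ => by rw [map_smul, smul_mul_assoc]
  map_zero' := Finset.sum_eq_zero fun m _ => by rw [map_zero, zero_mul]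
  map_add' a b := by
    rw [← Finset.sum_add_distrib]
    exact Finset.sum_congr rfl fun m _ => by rw [map_add, add_mul]
  map_mul' a b := by
    rw [Finset.sum_mul_sum]
    refine Finset.sum_congr rfl fun m hm => ?_
    rw [Finset.sum_eq_single m]
    · rw [map_mul, mul_assoc (ψ m a) (Q m), ← mul_assoc (Q m), ← (hc m m b).eq,
        mul_assoc (ψ m b), hQ, mul_assoc]
    · intro n _ hn
      rw [mul_assoc, ← mul_assoc (Q m), ← (hc n m b).eq, mul_assoc (ψ n b), h0 m n hn.symm,
        mul_zero, mul_zero]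
    · exact fun h => absurd hm h
  map_star' a := by
    rw [star_sum]
    refine Finset.sum_congr rfl fun m _ => ?_
    rw [star_mul, hs, ← map_star, (hc m m (star a)).eq]

/-! ### Strict gluing along a countable family of commuting projections. -/

section Glue

open scoped MultiplierAlgebra
open Filter Topology DoubleCentralizer

variable {I A B : Type*} [NonUnitalCStarAlgebra A] [NonUnitalCStarAlgebra B] {q : I → 𝓜(ℂ, B)}

/-- Uniqueness of glued multipliers, from which their algebraic identities are deduced. -/
theorem DoubleCentralizer.eq_of_mul_eq_of_dense
    (hd : Dense (Submodule.span ℂ (⋃ i, Set.range (q i).fst) : Set B)) {m n : 𝓜(ℂ, B)}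
    (h : ∀ i, m * q i = n * q i) : m = n :=
  ext_fst (ContinuousLinearMap.eq_of_dense_span hd fun b hb => by
    obtain ⟨i, b, rfl⟩ := Set.mem_iUnion.1 hb
    rw [← mul_fst_apply, ← mul_fst_apply, h])

/-- `⋆`-homomorphisms `ψ i` that agree on the overlaps of commuting projections `q i` with strict
union `1` glue. -/
theorem DoubleCentralizer.exists_glue_apply [Countable I] [Nonempty I] {ψ : I → A →⋆ₙₐ[ℂ] 𝓜(ℂ, B)}
    (hq : ∀ i j, Commute (q i) (q j)) (hqq : ∀ i, q i * q i = q i) (hs : ∀ i, star (q i) = q i)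
    (hc : ∀ i j a, Commute (ψ i a) (q j))
    (hψ : ∀ i j a, ψ i a * (q i * q j) = ψ j a * (q i * q j))
    (hd : Dense (Submodule.span ℂ (⋃ i, Set.range (q i).fst) : Set B)) (a : A) :
    ∃ m : 𝓜(ℂ, B), ‖m‖ ≤ ‖a‖ ∧ ∀ i, m * q i = ψ i a * q i := by
  obtain ⟨ν, hν⟩ := exists_surjective_nat I
  have hq' : ∀ m n, Commute (q (ν m)) (q (ν n)) := fun m n => hq _ _
  have hqq' : ∀ m, q (ν m) * q (ν m) = q (ν m) := fun m => hqq _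
  have hs' : ∀ m, star (q (ν m)) = q (ν m) := fun m => hs _
  -- Orthogonal pieces make each partial sum a ⋆-homomorphism, hence contractive; this is the
  -- uniform bound needed for a strict limit.
  let Φ := sumOrthogonalHom (fun m => ψ (ν m)) (projPiece fun n => q (ν n))
    (star_projPiece hq' hs') (projPiece_mul_self hq' hqq')
    (fun m n h => projPiece_mul_ne hq' hqq' h)
    (fun m n a => commute_projPiece (fun k => hc (ν m) (ν k) a) n)
  have hn : ∀ N a, ‖Φ N a‖ ≤ ‖a‖ := fun N a => NonUnitalStarAlgHom.norm_apply_le (Φ N) a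
  -- On the range of q (ν m) the sums become constant. The n-th piece lies below q (ν n), so under
  -- its product with q (ν m) the overlap condition replaces ψ (ν n) by ψ (ν m); the pieces with n <
  -- N add up to 1 on q (ν m) as soon as m < N.
  have hΦ : ∀ a m N, m < N → Φ N a * q (ν m) = ψ (ν m) a * q (ν m) := fun a m N h => by
    have h1 : ∀ n, ψ (ν n) a * projPiece (fun n => q (ν n)) n * q (ν m)
        = ψ (ν m) a * (projPiece (fun n => q (ν n)) n * q (ν m)) := fun n => by
      have h2 := commute_projRest (fun k => hc (ν n) (ν k) a) n
      have h3 := commute_projRest (fun k => hc (ν m) (ν k) a) n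
      rw [projPiece, mul_assoc, mul_assoc (projRest _ n), ← mul_assoc, h2.eq, mul_assoc, hψ,
        ← mul_assoc, ← h3.eq, mul_assoc]
    change (∑ n ∈ Finset.range N, ψ (ν n) a * projPiece (fun n => q (ν n)) n) * q (ν m) = _
    rw [Finset.sum_mul, Finset.sum_congr rfl fun n _ => h1 n, ← Finset.mul_sum, ← Finset.sum_mul,
      sum_projPiece, sub_mul, one_mul, projRest_mul_proj hq' hqq' h, sub_zero]
  have hlim : ∀ (a : A) (i : I) (b : B),
      Tendsto (fun N => (Φ N a).fst ((q i).fst b)) atTop (𝓝 ((ψ i a * q i).fst b)) :=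
    fun a i b => by
    obtain ⟨m, rfl⟩ := hν i
    refine tendsto_const_nhds.congr' ?_
    filter_upwards [eventually_gt_atTop m] with N hN
    rw [← mul_fst_apply, hΦ a m N hN]
  obtain ⟨v, hv, -⟩ := exists_strict_limit (fun N => Φ N a) (fun N => hn N a) hd hd
    (fun b hb => by
      obtain ⟨i, b, rfl⟩ := Set.mem_iUnion.1 hb
      exact ⟨_, hlim a i b⟩) (fun b hb => by
      obtain ⟨i, b, rfl⟩ := Set.mem_iUnion.1 hb
      -- The adjoint of Φ N a is Φ N (a⋆), so adjoints converge by the same computation.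
      simp only [← map_star]
      exact ⟨_, hlim (star a) i b⟩)
  refine ⟨v, ?_, fun i => ext_fst (ContinuousLinearMap.ext fun b => ?_)⟩
  · rw [← norm_fst]
    refine ContinuousLinearMap.opNorm_le_bound _ (norm_nonneg a) fun b => ?_
    refine le_of_tendsto (hv b).norm (Eventually.of_forall fun N => ?_)
    exact (norm_fst_apply_le _ _).trans (mul_le_mul_of_nonneg_right (hn N a) (norm_nonneg _))
  · rw [mul_fst_apply]
    exact tendsto_nhds_unique (hv _) (hlim a i b)

/-- Pointwise gluing is unique, so linearity and multiplicativity can be checked after multiplying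
by each q i, where they hold for ψ i; the product needs ψ i to commute with q i. -/
theorem DoubleCentralizer.exists_glue [Countable I] [Nonempty I] {ψ : I → A →⋆ₙₐ[ℂ] 𝓜(ℂ, B)}
    (hq : ∀ i j, Commute (q i) (q j)) (hqq : ∀ i, q i * q i = q i) (hs : ∀ i, star (q i) = q i)
    (hc : ∀ i j a, Commute (ψ i a) (q j))
    (hψ : ∀ i j a, ψ i a * (q i * q j) = ψ j a * (q i * q j))
    (hd : Dense (Submodule.span ℂ (⋃ i, Set.range (q i).fst) : Set B)) :
    ∃ L : A →L[ℂ] 𝓜(ℂ, B), (∀ a, ‖L a‖ ≤ ‖a‖) ∧ (∀ a b, L (a * b) = L a * L b) ∧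
      ∀ a i, L a * q i = ψ i a * q i := by
  choose L hLn hL using exists_glue_apply hq hqq hs hc hψ hd
  refine ⟨LinearMap.mkContinuous
    { toFun := L
      map_add' := fun a b => eq_of_mul_eq_of_dense hd fun i => by
        rw [add_mul, hL, hL, hL, map_add, add_mul]
      map_smul' := fun c a => eq_of_mul_eq_of_dense hd fun i => by
        rw [RingHom.id_apply, smul_mul_assoc, hL, hL, map_smul, smul_mul_assoc] } 1
    fun a => by rw [one_mul]; exact hLn a, hLn, fun a b => eq_of_mul_eq_of_dense hd fun i => ?_, hL⟩
  change L (a * b) * q i = L a * L b * q i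
  rw [hL, mul_assoc, hL, (hc i i b).eq, ← mul_assoc, hL, mul_assoc, ← (hc i i b).eq, ← mul_assoc,
    map_mul]

/-- Evaluation `m ↦ m b` of multipliers. -/
noncomputable def DoubleCentralizer.evalL (b : B) : 𝓜(ℂ, B) →L[ℂ] B :=
  LinearMap.mkContinuous
    { toFun := fun m => m.fst b
      map_add' := fun _ _ => rfl
      map_smul' := fun _ _ => rfl } ‖b‖ fun m => by
    rw [mul_comm]
    exact norm_fst_apply_le m b

theorem DoubleCentralizer.evalL_apply (b : B) (m : 𝓜(ℂ, B)) : evalL b m = m.fst b := rfl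

/-- Multipliers that agree locally, along `q i` and `q' i`, with intertwining ones are
intertwining. -/
theorem GAction.Intertwines.of_dense {G : Type*} [InverseSemigroup G] {β : GAction G B} {g : G}
    {q' x x' : I → 𝓜(ℂ, B)} {m m' : 𝓜(ℂ, B)}
    (hd : Dense (Submodule.span ℂ (⋃ i, Set.range (q i).fst) : Set B))
    (hq : ∀ i, β.Intertwines g (q i) (q' i)) (hx : ∀ i, β.Intertwines g (x i) (x' i))
    (h : ∀ i, m * q i = x i * q i) (h' : ∀ i, m' * q' i = x' i * q' i) :
    β.Intertwines g m m' :=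
  GAction.Intertwines.ext_dense hd fun b hb => by
    obtain ⟨i, b, rfl⟩ := Set.mem_iUnion.1 hb
    rw [← mul_fst_apply, h, mul_fst_apply, hx, hq, ← mul_fst_apply, ← h', mul_fst_apply]

end Glue

/-! ### Invariant multipliers of `A ⊗^X 𝓚_G` induced by elements of `A` -/

section Amplification

open scoped MultiplierAlgebra ZeroAtInfty
open InverseSemigroup HilbertModule DoubleCentralizer

section

variable {G A B I : Type*} [InverseSemigroup G] [NonUnitalCStarAlgebra A]
  [NonUnitalCStarAlgebra B]

theorem BalTensor.dense_span_tensorOne (α : GAction G A) (β : GAction G B) {m : I → 𝓜(ℂ, A)}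
    (hm : Dense (Submodule.span ℂ (⋃ i, Set.range (m i).fst) : Set A)) :
    Dense (Submodule.span ℂ (⋃ i, Set.range (tensorOne α β (m i)).fst) : Set (BalTensor α β)) := by
  have hW := Submodule.isClosed_topologicalClosure
    (Submodule.span ℂ (⋃ i, Set.range (tensorOne α β (m i)).fst))
  refine (ContinuousLinearMap.id ℂ _).mem_of_dense_span hW (BalTensor.dense_span_tmul _ _) ?_
  rintro _ ⟨⟨a, b⟩, rfl⟩
  refine ((BalTensor.tmulL α β).flip b).mem_of_dense_span hW hm (fun a ha => ?_) a
  obtain ⟨i, a, rfl⟩ := Set.mem_iUnion.1 ha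
  exact Submodule.le_topologicalClosure _ (Submodule.subset_span
    (Set.mem_iUnion.2 ⟨i, BalTensor.tmul α β a b, tensorOne_fst_tmul α β (m i) a b⟩))

theorem BalTensor.dense_span_oneTensor (α : GAction G A) (β : GAction G B) {m : I → 𝓜(ℂ, B)}
    (hm : Dense (Submodule.span ℂ (⋃ i, Set.range (m i).fst) : Set B)) :
    Dense (Submodule.span ℂ (⋃ i, Set.range (oneTensor α β (m i)).fst) : Set (BalTensor α β)) := by
  have hW := Submodule.isClosed_topologicalClosure
    (Submodule.span ℂ (⋃ i, Set.range (oneTensor α β (m i)).fst))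
  refine (ContinuousLinearMap.id ℂ _).mem_of_dense_span hW (BalTensor.dense_span_tmul _ _) ?_
  rintro _ ⟨⟨a, b⟩, rfl⟩
  refine (BalTensor.tmulL α β a).mem_of_dense_span hW hm (fun b hb => ?_) b
  obtain ⟨i, b, rfl⟩ := Set.mem_iUnion.1 hb
  exact Submodule.le_topologicalClosure _ (Submodule.subset_span
    (Set.mem_iUnion.2 ⟨i, BalTensor.tmul α β a b, oneTensor_fst_tmul α β (m i) a b⟩))

end

variable {G A : Type*} [InverseSemigroup G] [IsEContinuous G] [NonUnitalCStarAlgebra A]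
  (α : GAction G A)

namespace Amplification

/-- The multiplier `a ⊗ 1 ⊗ 1` of `A ⊗^X 𝓚_G`. -/
noncomputable def left : A →⋆ₙₐ[ℂ] 𝓜(ℂ, BalTensor α (kgAction G)) :=
  (tensorOneHom α (kgAction G) : 𝓜(ℂ, A) →⋆ₙₐ[ℂ] 𝓜(ℂ, BalTensor α (kgAction G))).comp
    (coeHom (𝕜 := ℂ))

theorem left_apply (a : A) : left α a = tensorOne α (kgAction G) (a : 𝓜(ℂ, A)) := rfl

/-- The multiplier `1 ⊗ e_{ij} ⊗ 1` of `A ⊗^X 𝓚_G`. -/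
noncomputable def unit (i j : ℕ) : 𝓜(ℂ, BalTensor α (kgAction G)) :=
  oneTensorHom α (kgAction G) (tensorOneHom (c0Infty G).actionCompacts (L2 G).actionCompacts
    (SumModule.unit G i j))

/-- The multiplier `1 ⊗ 1 ⊗ T` of `A ⊗^X 𝓚_G`. -/
noncomputable def right :
    Compacts C₀(Spec G, ℂ) (L2Kernel G).Module →⋆ₙₐ[ℂ] 𝓜(ℂ, BalTensor α (kgAction G)) :=
  ((oneTensorHom α (kgAction G)).comp (oneTensorHom (c0Infty G).actionCompacts
    (L2 G).actionCompacts) : _ →⋆ₙₐ[ℂ] 𝓜(ℂ, BalTensor α (kgAction G))).comp (coeHom (𝕜 := ℂ))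

/-- The projection `1 ⊗ 1 ⊗ q_g`. -/
noncomputable def proj (g : G) : 𝓜(ℂ, BalTensor α (kgAction G)) :=
  right α (L2Module.proj g)

variable {α}

theorem tensorOne_comm_proj (m : 𝓜(ℂ, A)) (g : G) :
    tensorOne α (kgAction G) m * proj α g = proj α g * tensorOne α (kgAction G) m :=
  tensorOne_mul_oneTensor _ _ _ _

theorem left_comm_unit (m : 𝓜(ℂ, A)) (i j : ℕ) :
    tensorOne α (kgAction G) m * unit α i j = unit α i j * tensorOne α (kgAction G) m :=
  tensorOne_mul_oneTensor _ _ _ _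

theorem star_proj (g : G) : star (proj α g) = proj α g := by
  rw [proj, ← map_star, L2Module.star_proj]

theorem proj_mul (g h : G) :
    proj α g * proj α h = right α (L2Module.proj g * L2Module.proj h) :=
  (map_mul (right α) _ _).symm

theorem proj_mul_self (g : G) : proj α g * proj α g = proj α g := by
  rw [proj_mul, L2Module.proj_mul_self, proj]

theorem proj_comm (g h : G) : proj α g * proj α h = proj α h * proj α g := by
  rw [proj_mul, proj_mul, L2Module.proj_comm]

theorem left_comm_proj (a : A) (g : G) : left α a * proj α g = proj α g * left α a :=
  tensorOne_comm_proj _ _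

/-- The balancing relation `e(a) ⊗ 1 ⊗ T = a ⊗ 1 ⊗ e(T)`. -/
theorem left_act_mul_right {e : G} (he : e * e = e) (a : A)
    (T : Compacts C₀(Spec G, ℂ) (L2Kernel G).Module) :
    left α (α.act e a) * right α T = left α a * right α ((L2 G).actionCompacts.act e T) :=
  tensorOne_act_mul_oneTensor α (kgAction G) he a
    (GAction.Cuts.oneTensor he (GAction.Cuts.coe (L2 G).actionCompacts he T))

/-- By balancing, g g⁻¹ passes from a to q_g, which it fixes. Thus a and α_g(α_{g⁻¹}(a)) cannot be
distinguished on q_g. -/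
theorem left_act_ran_mul_proj (a : A) (g : G) :
    left α (α.act (g * g⁻¹) a) * proj α g = left α a * proj α g := by
  rw [proj, left_act_mul_right (mul_inv_idem g), L2Module.act_proj, mul_inv_mul]

/-- Balancing moves e from the right tensor factor to a, where it gives 0; each factor 1 - e
therefore acts as 1. -/
theorem left_mul_right_cutOff (a : A) (T : Compacts C₀(Spec G, ℂ) (L2Kernel G).Module)
    (l : List (Idem G)) (hl : ∀ e ∈ l, α.act e.val a = 0) :
    left α a * right α (L2Module.cutOff T l) = left α a * right α T := by
  induction l with
  | nil => rfl
  | cons e l ih =>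
    have h1 : right α (L2Module.cutOff T (e :: l)) = right α (L2Module.cutOff T l)
        - right α ((L2 G).actionCompacts.act e.val (L2Module.cutOff T l)) :=
      map_sub (right α) _ _
    have h2 := left_act_mul_right (α := α) e.idem a (L2Module.cutOff T l)
    rw [hl e List.mem_cons_self, map_zero, zero_mul] at h2
    have key : ∀ {x u v w y : 𝓜(ℂ, BalTensor α (kgAction G))}, w = u - v → 0 = x * v →
        x * u = y → x * w = y := fun h h' h'' => by rw [h, mul_sub, ← h', h'', sub_zero]
    exact key h1 h2 (ih fun e' he' => hl e' (List.mem_cons_of_mem _ he'))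

/-- The overlap condition for gluing. If eg = eh, then e annihilates α_g(a) - α_h(a), so against
this difference q_g q_h may be cut off by finitely many such e, and the cut-off operator is 0. -/
theorem left_act_mul_proj_mul_proj (a : A) (g h : G) :
    left α (α.act g a) * (proj α g * proj α h) = left α (α.act h a) * (proj α g * proj α h) := by
  obtain ⟨l, hl, h0⟩ := L2Module.exists_cutOff_eq_zero g h
  rw [← sub_eq_zero, ← sub_mul, ← map_sub, proj_mul]
  rw [← left_mul_right_cutOff _ _ l fun e he => ?_, h0, map_zero, mul_zero]
  rw [map_sub, ← α.act_mul, ← α.act_mul, hl e he, sub_self]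

theorem dense_span_proj : Dense (Submodule.span ℂ (⋃ g, Set.range (proj α g).fst) :
    Set (BalTensor α (kgAction G))) := by
  have h1 : ∀ g : G, (L2Module.proj g : 𝓜(ℂ, Compacts C₀(Spec G, ℂ) (L2Kernel G).Module)).fst
      = ContinuousLinearMap.mul ℂ _ (L2Module.proj g) := fun g => coe_fst _
  have h2 := BalTensor.dense_span_oneTensor (c0Infty G).actionCompacts (L2 G).actionCompacts
    (m := fun g : G => (L2Module.proj g : 𝓜(ℂ, Compacts C₀(Spec G, ℂ) (L2Kernel G).Module))) (by
      simp only [h1]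
      exact L2Module.dense_span_proj)
  exact BalTensor.dense_span_oneTensor α (kgAction G) h2

theorem dense_span_unit : Dense (Submodule.span ℂ (⋃ i, Set.range (unit α i i).fst) :
    Set (BalTensor α (kgAction G))) :=
  BalTensor.dense_span_oneTensor α (kgAction G) (BalTensor.dense_span_tensorOne
    (c0Infty G).actionCompacts (L2 G).actionCompacts SumModule.dense_span_unit)

theorem unit_mul (i j k : ℕ) : unit α i j * unit α j k = unit α i k := by
  rw [unit, unit, unit, ← map_mul, ← map_mul, SumModule.unit_mul]

theorem unit_mul_ne (i : ℕ) {j k : ℕ} (h : j ≠ k) (l : ℕ) : unit α i j * unit α k l = 0 := by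
  rw [unit, unit, ← map_mul, ← map_mul, SumModule.unit_mul_ne i h, map_zero, map_zero]

theorem star_unit (i j : ℕ) : star (unit α i j) = unit α j i := by
  rw [unit, unit, ← map_star, ← map_star, SumModule.star_unit]

/-- E_ij⋆ E_ij = E_jj and E_jj is a projection, so the norms x of E_ij and y of E_jj satisfy x² = y
and y² = y. -/
theorem norm_unit_le (i j : ℕ) : ‖unit α i j‖ ≤ 1 := by
  have h1 : ∀ i j, ‖unit α i j‖ * ‖unit α i j‖ = ‖unit α j j‖ := fun i j => by
    rw [← CStarRing.norm_star_mul_self, star_unit, unit_mul]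
  have h2 : ∀ x y : ℝ, x * x = y → y * y = y → x ≤ 1 := fun x y h h' => by
    by_contra! hx
    have hy : 1 < y := by nlinarith
    nlinarith
  exact h2 _ _ (h1 i j) (h1 j j)

theorem isInvariant_unit (i j : ℕ) :
    (BalTensor.action α (kgAction G)).IsInvariant (unit α i j) :=
  GAction.isInvariant_iff.2 fun g => GAction.Intertwines.oneTensor (β := kgAction G)
    (GAction.Intertwines.tensorOne
      (GAction.isInvariant_iff.1 (SumModule.isInvariant_unit i j) g))

theorem intertwines_left (g : G) (a : A) : (BalTensor.action α (kgAction G)).Intertwines g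
    (left α a) (left α (α.act g a)) :=
  GAction.Intertwines.tensorOne (GAction.Intertwines.coe α g a)

theorem intertwines_proj (g h : G) : (BalTensor.action α (kgAction G)).Intertwines g
    (proj α h) (proj α (g * h)) := by
  have := GAction.Intertwines.coe (L2 G).actionCompacts g (L2Module.proj h)
  rw [L2Module.act_proj] at this
  exact GAction.Intertwines.oneTensor (β := kgAction G) (GAction.Intertwines.oneTensor this)

end Amplification

end Amplification

/-! ### Amplified elements: invariance, compatibility with p, and totality. -/

section Amplification

open scoped MultiplierAlgebra ZeroAtInfty
open InverseSemigroup HilbertModule DoubleCentralizer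

variable {G A : Type*} [InverseSemigroup G] [IsEContinuous G] [NonUnitalCStarAlgebra A]
  [Countable G] [Nonempty G] {α : GAction G A}

namespace Amplification

/-- The multiplier a ⊗ 1 ⊗ 1 is moved by G; replacing a by α_g(a) on each q_g repairs this, because
G also moves q_h to q_{gh}. -/
theorem exists_amplify (α : GAction G A) : ∃ L : A →L[ℂ] 𝓜(ℂ, BalTensor α (kgAction G)),
    (∀ a, ‖L a‖ ≤ ‖a‖) ∧ (∀ a b, L (a * b) = L a * L b) ∧
      ∀ a g, L a * proj α g = left α (α.act g a) * proj α g :=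
  exists_glue (ψ := fun g => (left α).comp (α.act g)) proj_comm proj_mul_self star_proj
    (fun g h a => left_comm_proj (α.act g a) h) (fun g h a => left_act_mul_proj_mul_proj a g h)
    dense_span_proj

/-- The invariant multiplier `∑_g α_g(a) ⊗ 1 ⊗ [φ_g]` of `A ⊗^X 𝓚_G`. -/
noncomputable def amplify (α : GAction G A) : A →L[ℂ] 𝓜(ℂ, BalTensor α (kgAction G)) :=
  (exists_amplify α).choose

theorem norm_amplify_le (a : A) : ‖amplify α a‖ ≤ ‖a‖ := (exists_amplify α).choose_spec.1 a

theorem amplify_mul (a b : A) : amplify α (a * b) = amplify α a * amplify α b :=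
  (exists_amplify α).choose_spec.2.1 a b

theorem amplify_mul_proj (a : A) (g : G) :
    amplify α a * proj α g = left α (α.act g a) * proj α g :=
  (exists_amplify α).choose_spec.2.2 a g

/-- The action of g carries the local piece α_h(a) on q_h to α_{gh}(a) on q_{gh}, which is again a
local piece of the same multiplier. -/
theorem isInvariant_amplify (a : A) :
    (BalTensor.action α (kgAction G)).IsInvariant (amplify α a) :=
  GAction.isInvariant_iff.2 fun g => GAction.Intertwines.of_dense dense_span_proj
    (fun h => intertwines_proj g h) (fun h => intertwines_left g (α.act h a))
    (fun h => amplify_mul_proj a h) fun h => by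
      rw [← α.act_mul]
      exact amplify_mul_proj a (g * h)

/-- On each q_g this is p α_g(a) = α_g(pa), the invariance of p. -/
theorem tensorOne_mul_amplify {p : 𝓜(ℂ, A)} (hp : α.IsInvariant p) (a : A) :
    tensorOne α (kgAction G) p * amplify α a = amplify α (p.fst a) :=
  eq_of_mul_eq_of_dense dense_span_proj fun g => by
    have h1 : ∀ b : A, tensorOne α (kgAction G) p * left α b = left α (p.fst b) := fun b => by
      rw [left_apply, left_apply, ← tensorOneHom_apply, ← tensorOneHom_apply,
        ← tensorOneHom_apply, ← map_mul]
      congr 1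
      refine ext_fst (ContinuousLinearMap.ext fun c => ?_)
      rw [mul_fst_apply, coe_fst, coe_fst]
      exact p.fst_mul b c
    rw [mul_assoc, amplify_mul_proj, amplify_mul_proj, ← mul_assoc, h1, hp]

/-- A closed subspace that absorbs the multipliers `∑_g α_g(a) ⊗ 1 ⊗ [φ_g]`, `a ∈ A`, is
everything. -/
theorem mem_of_amplify_mem {h : A} (hh : Dense (Set.range fun a : A => h * a))
    {W : Submodule ℂ (BalTensor α (kgAction G))}
    (hW : IsClosed (W : Set (BalTensor α (kgAction G))))
    (hm : ∀ b, (amplify α h).fst b ∈ W) (b : BalTensor α (kgAction G)) : b ∈ W := by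
  -- amplify (h c) b = amplify h (amplify c b) is in W, and hA is dense.
  have h1 : ∀ a b, (amplify α a).fst b ∈ W := fun a b => by
    refine ((evalL b).comp (amplify α)).mem_of_dense_span hW (hh.mono Submodule.subset_span) ?_ a
    rintro _ ⟨c, rfl⟩
    rw [ContinuousLinearMap.comp_apply, evalL_apply, amplify_mul, mul_fst_apply]
    exact hm _
  -- On q_g the element a agrees with α_g(α_{g⁻¹}(a)), the local value of the amplification of
  -- α_{g⁻¹}(a).
  have h2 : ∀ a g b, (left α a * proj α g).fst b ∈ W := fun a g b => by
    rw [← left_act_ran_mul_proj, α.act_mul, ← amplify_mul_proj, mul_fst_apply]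
    exact h1 _ _
  refine (ContinuousLinearMap.id ℂ _).mem_of_dense_span hW dense_span_proj (fun b hb => ?_) b
  obtain ⟨g, b, rfl⟩ := Set.mem_iUnion.1 hb
  -- It remains to drop the left factor a of `h2`: tensors hc ⊗ w are total, and h commutes past
  -- q_g.
  refine (proj α g).fst.mem_of_dense_span hW (BalTensor.dense_span_tmul _ _) ?_ b
  rintro _ ⟨⟨a, w⟩, rfl⟩
  refine ((proj α g).fst.comp ((BalTensor.tmulL α (kgAction G)).flip w)).mem_of_dense_span hW
    (hh.mono Submodule.subset_span) ?_ a
  rintro _ ⟨c, rfl⟩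
  have h3 : BalTensor.tmul α (kgAction G) (h * c) w
      = (left α h).fst (BalTensor.tmul α (kgAction G) c w) := by
    rw [left_apply, tensorOne_fst_tmul, coe_fst]
    rfl
  change (proj α g).fst (BalTensor.tmul α (kgAction G) (h * c) w) ∈ W
  rw [h3, ← mul_fst_apply, ← left_comm_proj]
  exact h2 _ _ _

end Amplification

end Amplification

/-! ### Using fullness, and assembling the equivalence. -/

section Main

open scoped MultiplierAlgebra ZeroAtInfty
open InverseSemigroup Amplification DoubleCentralizer

/-- In an algebra with a full projection `p`, every element is a limit of linear combinations of
`a_k p b` for some sequence of contractions `a_k`. -/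
theorem exists_seq_of_full {A : Type*} [NonUnitalCStarAlgebra A] {p : 𝓜(ℂ, A)}
    (hfull : IsFullMultiplier p) (h : A) : ∃ a : ℕ → A, (∀ k, ‖a k‖ ≤ 1) ∧
      h ∈ (Submodule.span ℂ {x : A | ∃ k b, x = a k * p.fst b}).topologicalClosure := by
  -- The norm of a can be shifted to b.
  have h1 : {x : A | ∃ a b : A, x = a * p.fst b}
      ⊆ {x : A | ∃ a b : A, ‖a‖ ≤ 1 ∧ x = a * p.fst b} := by
    rintro _ ⟨a, b, rfl⟩
    by_cases ha : a = 0
    · exact ⟨0, 0, by simp, by simp [ha]⟩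
    · have hn : ‖a‖ ≠ 0 := norm_ne_zero_iff.2 ha
      refine ⟨((‖a‖⁻¹ : ℝ) : ℂ) • a, ((‖a‖ : ℝ) : ℂ) • b, ?_, ?_⟩
      · rw [norm_smul, Complex.norm_real, norm_inv, norm_norm, inv_mul_cancel₀ hn]
      · rw [map_smul, smul_mul_smul_comm, ← Complex.ofReal_mul, inv_mul_cancel₀ hn,
          Complex.ofReal_one, one_smul]
  -- Only the single element h is approximated, so finitely many products per approximant, countably
  -- many in all, suffice without separability of A.
  obtain ⟨s, hs, hlim⟩ := mem_closure_iff_seq_limit.1 (hfull h)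
  choose F hF hsF using fun n => Submodule.mem_span_finite_of_mem_span (hs n)
  -- Inserting 0 makes C nonempty, hence the range of a sequence.
  let C : Set A := insert 0 (⋃ n, (F n : Set A))
  have hC : C.Countable := (Set.countable_iUnion fun n => (F n).countable_toSet).insert 0
  obtain ⟨c, hc⟩ := hC.exists_eq_range (Set.insert_nonempty _ _)
  have hcm : ∀ k, ∃ a b : A, ‖a‖ ≤ 1 ∧ c k = a * p.fst b := fun k => by
    have : c k ∈ C := hc ▸ Set.mem_range_self k
    rcases this with h0 | hk
    · exact ⟨0, 0, by simp, by simp [h0]⟩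
    · obtain ⟨n, hn⟩ := Set.mem_iUnion.1 hk
      exact h1 (hF n hn)
  choose a b ha hab using hcm
  refine ⟨a, ha, mem_closure_of_tendsto hlim (Filter.Eventually.of_forall fun n => ?_)⟩
  refine Submodule.span_mono (fun x hx => ?_) (hsF n)
  have : x ∈ C := Set.mem_insert_of_mem _ (Set.mem_iUnion.2 ⟨n, hx⟩)
  rw [hc] at this
  obtain ⟨k, rfl⟩ := this
  exact ⟨k, b k, hab k⟩

/-- The total family of ranges of the q_g is indexed by G; for empty G it spans only 0. -/
theorem balTensor_subsingleton {G A : Type*} [InverseSemigroup G] [IsEContinuous G] [IsEmpty G]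
    [NonUnitalCStarAlgebra A] (α : GAction G A) : Subsingleton (BalTensor α (kgAction G)) := by
  have h : ∀ b ∈ (⊥ : Submodule ℂ (BalTensor α (kgAction G))), b = 0 := fun b => id
  refine subsingleton_of_forall_eq 0 fun b => h b
    ((ContinuousLinearMap.id ℂ _).mem_of_dense_span isClosed_singleton dense_span_proj ?_ b)
  rintro b hb
  obtain ⟨g, -⟩ := Set.mem_iUnion.1 hb
  exact isEmptyElim g

/-- The stabilization argument with P = p ⊗ 1, the matrix units of C₀(X)^∞, and L_k the
amplification of a_k. The one substantial hypothesis left to check is totality of the ranges of the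
L_k P. -/
theorem exists_invariant_equivalence_of_full {G : Type*} [InverseSemigroup G] [Countable G]
    [Nonempty G] [IsEContinuous G] {A : Type*} [NonUnitalCStarAlgebra A] (α : GAction G A)
    (hA : HasStrictlyPositiveElement A) {p : 𝓜(ℂ, A)} (hp : IsStarProjection p)
    (hfull : IsFullMultiplier p) (hinv : α.IsInvariant p) :
    ∃ v : 𝓜(ℂ, BalTensor α (kgAction G)), (BalTensor.action α (kgAction G)).IsInvariant v ∧
      star v * v = tensorOne α (kgAction G) p ∧ v * star v = 1 := by
  obtain ⟨h, -, hh⟩ := hA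
  obtain ⟨a, ha, hah⟩ := exists_seq_of_full hfull h
  have hP : IsStarProjection (tensorOne α (kgAction G) p) := by
    refine ⟨?_, ?_⟩
    · change tensorOneHom α (kgAction G) p * tensorOneHom α (kgAction G) p
        = tensorOneHom α (kgAction G) p
      rw [← map_mul, hp.isIdempotentElem.eq]
    · change star (tensorOneHom α (kgAction G) p) = tensorOneHom α (kgAction G) p
      rw [← map_star, hp.isSelfAdjoint.star_eq]
  refine GAction.exists_invariant_equivalence hP
    (GAction.isInvariant_iff.2 fun g =>
      GAction.Intertwines.tensorOne (GAction.isInvariant_iff.1 hinv g))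
    (unit α) unit_mul (fun i j k l hjk => unit_mul_ne i hjk l) (fun i => star_unit i i)
    norm_unit_le isInvariant_unit (left_comm_unit p) dense_span_unit (fun k => amplify α (a k))
    (fun k => (norm_amplify_le _).trans (ha k)) (fun k => isInvariant_amplify _) ?_
  set W := (Submodule.span ℂ (⋃ k, Set.range
    (amplify α (a k) * tensorOne α (kgAction G) p).fst)).topologicalClosure with hWdef
  have hW : IsClosed (W : Set (BalTensor α (kgAction G))) :=
    Submodule.isClosed_topologicalClosure _
  refine mem_of_amplify_mem hh hW fun b => ?_
  -- The amplification of a_k (p c) is L_k P times the amplification of c, so its range lies in W; a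
  -- limit of combinations of such elements gives the amplification of h.
  have hle : Submodule.span ℂ {x : A | ∃ k b, x = a k * p.fst b} ≤
      W.comap ((evalL b).comp (amplify α) : A →L[ℂ] _).toLinearMap := by
    refine Submodule.span_le.2 ?_
    rintro _ ⟨k, c, rfl⟩
    change (amplify α (a k * p.fst c)).fst b ∈ W
    rw [amplify_mul, ← tensorOne_mul_amplify hinv, ← mul_assoc, mul_fst_apply]
    exact Submodule.le_topologicalClosure _ (Submodule.subset_span
      (Set.mem_iUnion.2 ⟨k, _, rfl⟩))
  exact closure_minimal hle (hW.preimage ((evalL b).comp (amplify α)).continuous) hah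

end Main

theorem mainTheorem6 {G : Type*} [InverseSemigroup G] [Countable G] [IsEContinuous G]
    {A : Type*} [NonUnitalCStarAlgebra A] (α : GAlgebra G A)
    (hA : HasStrictlyPositiveElement A)
    (p : DoubleCentralizer ℂ A) (hp : IsStarProjection p) (hfull : IsFullMultiplier p)
    (hinv : α.toGAction.IsInvariant p) :
    ∃ v : DoubleCentralizer ℂ (BalTensor α.toGAction (kgAction G)),
      v * star v * v = v ∧
      star v * v = tensorOne α.toGAction (kgAction G) p ∧
      v * star v = tensorOne α.toGAction (kgAction G) 1 ∧
      (BalTensor.action α.toGAction (kgAction G)).IsInvariant v := by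
  -- Gluing enumerates G by ℕ and so needs a nonempty G; for empty G the tensor product is zero.
  rcases isEmpty_or_nonempty G with hG | hG
  · have := balTensor_subsingleton α.toGAction
    have h : ∀ m n : DoubleCentralizer ℂ (BalTensor α.toGAction (kgAction G)), m = n :=
      fun m n => DoubleCentralizer.ext_fst (ContinuousLinearMap.ext fun _ => Subsingleton.elim _ _)
    exact ⟨0, h _ _, h _ _, h _ _, fun _ _ => Subsingleton.elim _ _⟩
  · obtain ⟨v, h1, h2, h3⟩ :=
      exists_invariant_equivalence_of_full α.toGAction hA hp hfull hinv
    exact ⟨v, by rw [h3, one_mul], h2, by rw [h3, tensorOne_one], h1⟩
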